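/- Let $n\ge 0$, let $W=\mathfrak S_n$ be the symmetric group with its set $S$ of adjacent transpositions, length function $\ell$ and Bruhat order $\le$. Let $H(W)$ be its Hecke algebra over $\mathbb Z[q^{1/2},q^{-1/2}]$, with basis $\{T_w\}_{w\in W}$ and multiplication determined by $T_yT_w=T_{yw}$ if $\ell(y)+\ell(w)=\ell(yw)$ and $(T_s+1)(T_s-q)=0$ for $s\in S$; let $h\mapsto\overline h$ be the ring automorphism with $\overline{q^{1/2}}=q^{-1/2}$, $\overline{T_w}=T_{w^{-1}}^{-1}$. For $w\in W$ let $C_w=\sum_{y\le w}P_{y,w}(q)T_y$ be the Kazhdan–Lusztig basis element, i.e. the unique element of this form with $P_{w,w}=1$, $P_{y,w}\in\mathbb Z[q]$ of degree at most $(\ell(w)-\ell(y)-1)/2$ for $y<w$, and $\overline{C_w}=q^{-\ell(w)}C_w$. Let $I_w$ be the intersection of all two-sided ideals of $H(W)$ that contain $C_w$ and are spanned over $\mathbb Z[q^{1/2},q^{-1/2}]$ by a subset of $\{C_y\mid y\in W\}$. Write $y\le_{LR}w$ if $I_y\subset I_w$; the two-sided cells are the classes of the relation $I_y=I_w$. For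 a two-sided cell $\mathcal C$ and $w\in\mathcal C$ put $H(W)_{\le\mathcal C}=I_w$, $H(W)_{<\mathcal C}=\sum_{y\le_{LR}w,\ y\notin\mathcal C}I_y$, and let $H(W)_{\mathcal C}=H(W)_{\le\mathcal C}/H(W)_{<\mathcal C}$, an $H(W)$-bimodule. Let $\mathcal C$ be any two-sided cell of $W$, and let $v\in\mathcal C$ be a parabolic element, that is, the longest element $w_T$ of the subgroup $\langle T\rangle$ for some $T\subset S$. Then the $H(W)$-bimodule $H(W)_{\mathcal C}$ is generated by the image of $C_v$. -/

import Mathlib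

open scoped TensorProduct

noncomputable section

namespace SymHecke

/-! ## The symmetric group as a Coxeter group -/

/-- The set `S` of simple reflections of the symmetric group: the adjacent transpositions
`(i i+1)`. -/
def simples (n : ℕ) : Set (Equiv.Perm (Fin n)) :=
  {s | ∃ i j : Fin n, (i : ℕ) + 1 = j ∧ s = Equiv.swap i j}

/-- The Coxeter length: the least number of factors in an expression of `w` as a product of
simple reflections. -/
def len {n : ℕ} (w : Equiv.Perm (Fin n)) : ℕ :=
  sInf {k | ∃ l : List (Equiv.Perm (Fin n)), (∀ s ∈ l, s ∈ simples n) ∧ l.prod = w ∧ l.length = k}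

/-- Reflections: the conjugates of the simple reflections. -/
def IsRefl {n : ℕ} (t : Equiv.Perm (Fin n)) : Prop :=
  ∃ s ∈ simples n, ∃ g : Equiv.Perm (Fin n), t = g * s * g⁻¹

/-- The standard partial order (Bruhat order): the reflexive-transitive closure of
`u < t u` for reflections `t` with `ℓ(u) < ℓ(t u)`. -/
def BruhatLE {n : ℕ} (y w : Equiv.Perm (Fin n)) : Prop :=
  Relation.ReflTransGen (fun u v => ∃ t, IsRefl t ∧ v = t * u ∧ len u < len v) y w

/-- `v` is a parabolic element: the longest element `w_T` of the subgroup `⟨T⟩` generated by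
some set `T` of simple reflections. -/
def IsParabolic {n : ℕ} (v : Equiv.Perm (Fin n)) : Prop :=
  ∃ T ⊆ simples n, v ∈ Subgroup.closure T ∧ ∀ u ∈ Subgroup.closure T, len u ≤ len v

/-! ### Facts on the length needed to build the Hecke algebra -/

/-- The inversions of a permutation. -/
def invSet {n : ℕ} (w : Equiv.Perm (Fin n)) : Finset (Fin n × Fin n) :=
  Finset.univ.filter fun p => p.1 < p.2 ∧ w p.2 < w p.1

theorem mem_invSet {n : ℕ} (w : Equiv.Perm (Fin n)) (p : Fin n × Fin n) :
    p ∈ invSet w ↔ p.1 < p.2 ∧ w p.2 < w p.1 := by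
  rw [invSet, Finset.mem_filter]
  exact and_iff_right (Finset.mem_univ p)

theorem invSet_one {n : ℕ} : invSet (1 : Equiv.Perm (Fin n)) = ∅ := by
  ext p
  rw [mem_invSet]
  simp only [Equiv.Perm.one_apply, Finset.notMem_empty, iff_false, not_and, not_lt]
  exact fun h => h.le

theorem simple_mul_self {n : ℕ} {s : Equiv.Perm (Fin n)} (hs : s ∈ simples n) : s * s = 1 := by
  obtain ⟨i, j, -, rfl⟩ := hs
  exact Equiv.swap_mul_self i j

theorem simple_inv {n : ℕ} {s : Equiv.Perm (Fin n)} (hs : s ∈ simples n) : s⁻¹ = s :=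
  inv_eq_of_mul_eq_one_left (simple_mul_self hs)

/-- An adjacent transposition preserves the order of every pair but its own. -/
theorem swap_lt_swap {n : ℕ} {i j : Fin n} (hij : (i : ℕ) + 1 = j) {a b : Fin n}
    (h1 : ¬ (a = i ∧ b = j)) (h2 : ¬ (a = j ∧ b = i)) :
    Equiv.swap i j a < Equiv.swap i j b ↔ a < b := by
  simp only [Equiv.swap_apply_def]
  simp only [Fin.ext_iff] at h1 h2
  split_ifs with c1 c2 c3 c4 c5 c6 c7 c8 <;> simp only [Fin.ext_iff] at * <;>
    rw [Fin.lt_def, Fin.lt_def] <;> omega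

theorem card_invSet_mul_swap {n : ℕ} (w : Equiv.Perm (Fin n)) {i j : Fin n}
    (hij : (i : ℕ) + 1 = j) (h : w i < w j) :
    (invSet (w * Equiv.swap i j)).card = (invSet w).card + 1 := by
  have hlt : i < j := by rw [Fin.lt_def]; omega
  have e : invSet (w * Equiv.swap i j) =
      insert (i, j) ((invSet w).map
        (((Equiv.swap i j).prodCongr (Equiv.swap i j)).toEmbedding)) := by
    ext ⟨a, b⟩
    simp only [mem_invSet, Finset.mem_insert, Finset.mem_map_equiv, Equiv.Perm.mul_apply,
      Equiv.prodCongr_symm, Equiv.symm_swap, Equiv.prodCongr_apply, Prod.map_apply, Prod.mk.injEq]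
    by_cases h1 : a = i ∧ b = j
    · obtain ⟨rfl, rfl⟩ := h1
      simp [h, hlt]
    · by_cases h2 : a = j ∧ b = i
      · obtain ⟨rfl, rfl⟩ := h2
        simp [h.le, hlt.ne']
      · rw [swap_lt_swap hij h1 h2]
        simp [h1]
  rw [e, Finset.card_insert_of_notMem, Finset.card_map]
  simp [mem_invSet, Finset.mem_map_equiv, hlt.le]

theorem card_invSet_mul_swap' {n : ℕ} (w : Equiv.Perm (Fin n)) {i j : Fin n}
    (hij : (i : ℕ) + 1 = j) (h : w j < w i) :
    (invSet (w * Equiv.swap i j)).card + 1 = (invSet w).card := by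
  have := card_invSet_mul_swap (w * Equiv.swap i j) hij (by simpa using h)
  rw [← this, mul_assoc, Equiv.swap_mul_self, mul_one]

/-- A permutation other than the identity has a descent. -/
theorem exists_descent {n : ℕ} (w : Equiv.Perm (Fin n)) (hw : w ≠ 1) :
    ∃ i j : Fin n, (i : ℕ) + 1 = j ∧ w j < w i := by
  by_contra hcon
  push Not at hcon
  apply hw
  have hm : StrictMono w := by
    cases n with
    | zero => intro a; exact a.elim0
    | succ m =>
      rw [Fin.strictMono_iff_lt_succ]
      intro i
      refine lt_of_le_of_ne (hcon i.castSucc i.succ (by simp)) fun he => ?_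
      exact (Fin.castSucc_lt_succ (i := i)).ne (w.injective he)
  have h1 := Subsingleton.elim (hm.orderIsoOfSurjective w w.surjective) (OrderIso.refl (Fin n))
  ext x
  have h2 := congrArg (fun f : Fin n ≃o Fin n => f x) h1
  simpa using congrArg Fin.val h2

theorem exists_word {n : ℕ} (w : Equiv.Perm (Fin n)) :
    ∃ l : List (Equiv.Perm (Fin n)), (∀ s ∈ l, s ∈ simples n) ∧ l.prod = w ∧
      l.length = (invSet w).card := by
  induction hk : (invSet w).card generalizing w with
  | zero =>
    refine ⟨[], by simp, ?_, rfl⟩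
    by_contra hw
    obtain ⟨i, j, hij, h⟩ := exists_descent w (fun h => hw (by simp [h]))
    have := card_invSet_mul_swap' w hij h
    omega
  | succ k ih =>
    have hw : w ≠ 1 := by
      rintro rfl
      simp [invSet_one] at hk
    obtain ⟨i, j, hij, h⟩ := exists_descent w hw
    have h1 := card_invSet_mul_swap' w hij h
    obtain ⟨l, hl, hp, hn⟩ := ih (w * Equiv.swap i j) (by omega)
    refine ⟨l ++ [Equiv.swap i j], ?_, by simp [hp, mul_assoc], by simp [hn]⟩
    intro s hs
    rcases List.mem_append.1 hs with hs | hs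
    · exact hl s hs
    · exact ⟨i, j, hij, by simpa using hs⟩

theorem card_invSet_prod_le {n : ℕ} (l : List (Equiv.Perm (Fin n)))
    (hl : ∀ s ∈ l, s ∈ simples n) : (invSet l.prod).card ≤ l.length := by
  induction l using List.reverseRecOn with
  | nil =>
    simp [invSet_one]
  | append_singleton l s ih =>
    have h1 := ih fun s hs => hl s (by simp [hs])
    obtain ⟨i, j, hij, rfl⟩ := hl s (by simp)
    simp only [List.prod_append, List.prod_singleton, List.length_append, List.length_singleton]
    have hne : l.prod i ≠ l.prod j := fun h => by
      have := congrArg Fin.val (l.prod.injective h)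
      omega
    rcases lt_or_gt_of_ne hne with h | h
    · have := card_invSet_mul_swap l.prod hij h
      omega
    · have := card_invSet_mul_swap' l.prod hij h
      omega

theorem len_eq_card_invSet {n : ℕ} (w : Equiv.Perm (Fin n)) : len w = (invSet w).card := by
  apply le_antisymm
  · exact Nat.sInf_le (exists_word w)
  · have hne : {k | ∃ l : List (Equiv.Perm (Fin n)), (∀ s ∈ l, s ∈ simples n) ∧ l.prod = w ∧
        l.length = k}.Nonempty := ⟨_, exists_word w⟩
    obtain ⟨l, hl, hp, hn⟩ := Nat.sInf_mem hne
    rw [len, ← hn, ← hp]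
    exact card_invSet_prod_le l hl

/-- Every element has a reduced expression. -/
theorem exists_reduced {n : ℕ} (w : Equiv.Perm (Fin n)) :
    ∃ l : List (Equiv.Perm (Fin n)), (∀ s ∈ l, s ∈ simples n) ∧ l.prod = w ∧
      l.length = len w := by
  rw [len_eq_card_invSet]
  exact exists_word w

theorem len_prod_le {n : ℕ} (l : List (Equiv.Perm (Fin n)))
    (hl : ∀ s ∈ l, s ∈ simples n) : len l.prod ≤ l.length := by
  rw [len_eq_card_invSet]
  exact card_invSet_prod_le l hl

theorem len_one {n : ℕ} : len (1 : Equiv.Perm (Fin n)) = 0 := by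
  simpa using len_prod_le ([] : List (Equiv.Perm (Fin n))) (by simp)

theorem len_mul_le {n : ℕ} (u w : Equiv.Perm (Fin n)) : len (u * w) ≤ len u + len w := by
  obtain ⟨l, hl, rfl, h1⟩ := exists_reduced u
  obtain ⟨m, hm, rfl, h2⟩ := exists_reduced w
  rw [← h1, ← h2, ← List.prod_append, ← List.length_append]
  refine len_prod_le _ fun s hs => ?_
  rcases List.mem_append.1 hs with hs | hs
  · exact hl s hs
  · exact hm s hs

theorem len_inv {n : ℕ} (w : Equiv.Perm (Fin n)) : len w⁻¹ = len w := by
  have key : ∀ u : Equiv.Perm (Fin n), len u⁻¹ ≤ len u := by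
    intro u
    obtain ⟨l, hl, rfl, h1⟩ := exists_reduced u
    rw [← h1, List.prod_inv_reverse]
    refine (len_prod_le _ fun s hs => ?_).trans (by simp)
    obtain ⟨t, ht, rfl⟩ := List.mem_map.1 (List.mem_reverse.1 hs)
    rw [simple_inv (hl t ht)]
    exact hl t ht
  exact le_antisymm (key w) (by simpa using key w⁻¹)

theorem lt_len_mul_swap {n : ℕ} (w : Equiv.Perm (Fin n)) {i j : Fin n}
    (hij : (i : ℕ) + 1 = j) : len w < len (w * Equiv.swap i j) ↔ w i < w j := by
  simp only [len_eq_card_invSet]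
  have hne : w i ≠ w j := fun h => by
    have := congrArg Fin.val (w.injective h)
    omega
  rcases lt_or_gt_of_ne hne with h | h
  · have := card_invSet_mul_swap w hij h
    simp only [h, iff_true]
    omega
  · have := card_invSet_mul_swap' w hij h
    simp only [h.not_gt, iff_false]
    omega

theorem lt_len_swap_mul {n : ℕ} (w : Equiv.Perm (Fin n)) {i j : Fin n}
    (hij : (i : ℕ) + 1 = j) :
    len w < len (Equiv.swap i j * w) ↔ w⁻¹ i < w⁻¹ j := by
  rw [← lt_len_mul_swap w⁻¹ hij, len_inv, ← len_inv (_ * w), mul_inv_rev, Equiv.swap_inv]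

/-- For simple reflections `s`, `t` with `s w ≠ w t`, multiplication by `t` on the right does not
affect whether `s` increases the length on the left. -/
theorem lt_len_mul_right {n : ℕ} {s t : Equiv.Perm (Fin n)} (hs : s ∈ simples n)
    (ht : t ∈ simples n) (w : Equiv.Perm (Fin n)) (h : s * w ≠ w * t) :
    len (w * t) < len (s * (w * t)) ↔ len w < len (s * w) := by
  obtain ⟨i, j, hij, rfl⟩ := hs
  obtain ⟨k, l, hkl, rfl⟩ := ht
  rw [lt_len_swap_mul _ hij, lt_len_swap_mul _ hij]
  simp only [mul_inv_rev, Equiv.swap_inv, Equiv.Perm.mul_apply]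
  apply swap_lt_swap hkl
  · rintro ⟨rfl, rfl⟩
    apply h
    rw [Equiv.mul_swap_eq_swap_mul]
    simp
  · rintro ⟨rfl, rfl⟩
    apply h
    rw [Equiv.mul_swap_eq_swap_mul]
    simp [Equiv.swap_comm]

theorem lt_len_mul_left {n : ℕ} {s t : Equiv.Perm (Fin n)} (hs : s ∈ simples n)
    (ht : t ∈ simples n) (w : Equiv.Perm (Fin n)) (h : s * w ≠ w * t) :
    len (s * w) < len (s * w * t) ↔ len w < len (w * t) := by
  have h' : t * w⁻¹ ≠ w⁻¹ * s := fun e => h (by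
    have := congrArg (fun x => w * x * w) e
    simpa [mul_assoc] using this.symm)
  have := lt_len_mul_right ht hs w⁻¹ h'
  rw [← len_inv (w⁻¹ * s), ← len_inv (t * (w⁻¹ * s)), len_inv w, ← len_inv (t * w⁻¹)] at this
  simpa [simple_inv hs, simple_inv ht, mul_assoc] using this

/-! ## The Hecke algebra -/

/-- The ring `ℤ[q^{1/2}, q^{-1/2}]`; the variable of the Laurent polynomials is `q^{1/2}`. -/
abbrev R : Type := LaurentPolynomial ℤ

/-- `q ^ (k / 2)`. -/
def qhalf (k : ℤ) : R := LaurentPolynomial.T k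

/-- The parameter `q`. -/
def q : R := qhalf 2

/-- The Hecke algebra of the symmetric group, as a module: free on the basis
`T_w`, `w` in the symmetric group. -/
def Hecke (n : ℕ) : Type := Equiv.Perm (Fin n) →₀ R

instance instAddCommGroup (n : ℕ) : AddCommGroup (Hecke n) :=
  inferInstanceAs (AddCommGroup (Equiv.Perm (Fin n) →₀ R))

instance instModule (n : ℕ) : Module R (Hecke n) :=
  inferInstanceAs (Module R (Equiv.Perm (Fin n) →₀ R))

/-- The basis `T_w`. -/
def basisT (n : ℕ) : Module.Basis (Equiv.Perm (Fin n)) R (Hecke n) :=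
  Module.Basis.ofRepr (LinearEquiv.refl R (Equiv.Perm (Fin n) →₀ R))

/-- The basis element `T_w`. -/
def T {n : ℕ} (w : Equiv.Perm (Fin n)) : Hecke n := basisT n w

/-- Left multiplication by `T_s` for a simple reflection `s`. -/
def lop {n : ℕ} (s : Equiv.Perm (Fin n)) : Hecke n →ₗ[R] Hecke n :=
  (basisT n).constr R fun w =>
    if len w < len (s * w) then T (s * w) else (q - 1) • T w + q • T (s * w)

/-- Right multiplication by `T_s` for a simple reflection `s`. -/
def rop {n : ℕ} (s : Equiv.Perm (Fin n)) : Hecke n →ₗ[R] Hecke n :=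
  (basisT n).constr R fun w =>
    if len w < len (w * s) then T (w * s) else (q - 1) • T w + q • T (w * s)

theorem lop_T {n : ℕ} (s w : Equiv.Perm (Fin n)) : lop s (T w) =
    if len w < len (s * w) then T (s * w) else (q - 1) • T w + q • T (s * w) :=
  (basisT n).constr_basis R _ w

theorem rop_T {n : ℕ} (s w : Equiv.Perm (Fin n)) : rop s (T w) =
    if len w < len (w * s) then T (w * s) else (q - 1) • T w + q • T (w * s) :=
  (basisT n).constr_basis R _ w

/-- Left multiplication by `T_w`: the product of the operators `T_s` along a reduced expression
of `w`. It does not depend on the expression. -/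
def lopW {n : ℕ} (w : Equiv.Perm (Fin n)) : Module.End R (Hecke n) :=
  ((exists_reduced w).choose.map lop).prod

/-- Left multiplication in the Hecke algebra. -/
def lmul (n : ℕ) : Hecke n →ₗ[R] Module.End R (Hecke n) :=
  (basisT n).constr R lopW

instance instMul (n : ℕ) : Mul (Hecke n) := ⟨fun x y => lmul n x y⟩

instance instOne (n : ℕ) : One (Hecke n) := ⟨T 1⟩

theorem mul_def {n : ℕ} (x y : Hecke n) : x * y = lmul n x y := rfl

theorem one_def {n : ℕ} : (1 : Hecke n) = T 1 := rfl

theorem lmul_T {n : ℕ} (w : Equiv.Perm (Fin n)) : lmul n (T w) = lopW w :=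
  (basisT n).constr_basis R _ w

theorem lop_rop_comm {n : ℕ} {s t : Equiv.Perm (Fin n)} (hs : s ∈ simples n)
    (ht : t ∈ simples n) (x : Hecke n) : lop s (rop t x) = rop t (lop s x) := by
  have key : (lop s : Hecke n →ₗ[R] Hecke n) ∘ₗ rop t = rop t ∘ₗ lop s := by
    refine (basisT n).ext fun w => ?_
    change lop s (rop t (T w)) = rop t (lop s (T w))
    by_cases h : s * w = w * t
    · have hw : w * t * t = w := by rw [mul_assoc, simple_mul_self ht, mul_one]
      have hw' : s * (w * t) = w := by rw [← h, ← mul_assoc, simple_mul_self hs, one_mul]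
      rw [rop_T, lop_T, h]
      split_ifs with h1
      · rw [lop_T, rop_T, hw, hw']
      · simp only [map_add, map_smul, lop_T, rop_T, h, hw, hw', if_neg h1]
    · have h1 := lt_len_mul_right hs ht w h
      have h2 := lt_len_mul_left hs ht w h
      have ha : s * (w * t) = s * w * t := (mul_assoc s w t).symm
      rw [rop_T, lop_T]
      rw [ha] at h1
      by_cases c1 : len w < len (s * w) <;> by_cases c2 : len w < len (w * t) <;>
        simp only [c1, c2, if_true, if_false, map_add, map_smul, lop_T, rop_T, ha, h1, h2,
          smul_add, smul_smul, mul_comm (q - 1) q] <;> abel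
  exact LinearMap.congr_fun key x

theorem prod_lop_rop_comm {n : ℕ} (l : List (Equiv.Perm (Fin n)))
    (hl : ∀ s ∈ l, s ∈ simples n) {t : Equiv.Perm (Fin n)} (ht : t ∈ simples n) (x : Hecke n) :
    (l.map lop).prod (rop t x) = rop t ((l.map lop).prod x) := by
  induction l with
  | nil => simp
  | cons s l ih =>
    simp only [List.map_cons, List.prod_cons, Module.End.mul_apply]
    rw [ih fun s hs => hl s (by simp [hs]), lop_rop_comm (hl s (by simp)) ht]

theorem lmul_rop_comm {n : ℕ} {t : Equiv.Perm (Fin n)} (ht : t ∈ simples n) (x y : Hecke n) :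
    lmul n x (rop t y) = rop t (lmul n x y) := by
  have key : (lmul n).flip (rop t y) = rop t ∘ₗ (lmul n).flip y := by
    refine (basisT n).ext fun w => ?_
    change lmul n (T w) (rop t y) = rop t (lmul n (T w) y)
    rw [lmul_T]
    exact prod_lop_rop_comm _ (exists_reduced w).choose_spec.1 ht y
  exact LinearMap.congr_fun key x

/-- Two operators that commute with all right multiplications agree if they agree at `T_1`. -/
theorem ext_of_comm {n : ℕ} (f g : Hecke n →ₗ[R] Hecke n)
    (hf : ∀ t ∈ simples n, ∀ x, f (rop t x) = rop t (f x))
    (hg : ∀ t ∈ simples n, ∀ x, g (rop t x) = rop t (g x))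
    (h : f (T 1) = g (T 1)) : f = g := by
  refine (basisT n).ext fun w => ?_
  change f (T w) = g (T w)
  have key : ∀ l : List (Equiv.Perm (Fin n)), (∀ s ∈ l, s ∈ simples n) →
      l.length = len l.prod → f (T l.prod) = g (T l.prod) := by
    intro l
    induction l using List.reverseRecOn with
    | nil => intro _ _; simpa using h
    | append_singleton l s ih =>
      intro hl hn
      have hl' : ∀ s ∈ l, s ∈ simples n := fun s hs => hl s (by simp [hs])
      simp only [List.prod_append, List.prod_singleton, List.length_append,
        List.length_singleton] at hn ⊢
      have h0 : len s ≤ 1 := by simpa using len_prod_le [s] (by simpa using hl s (by simp))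
      have h1 := len_prod_le l hl'
      have h2 := len_mul_le l.prod s
      have h3 := ih hl' (by omega)
      have h4 : T (l.prod * s) = rop s (T l.prod) := by
        rw [rop_T, if_pos (by omega)]
      rw [h4, hf s (hl s (by simp)), hg s (hl s (by simp)), h3]
  obtain ⟨l, hl, rfl, hn⟩ := exists_reduced w
  exact key l hl hn

theorem prod_lop_T {n : ℕ} (l : List (Equiv.Perm (Fin n))) (hl : ∀ s ∈ l, s ∈ simples n)
    (w : Equiv.Perm (Fin n)) (h : l.length + len w = len (l.prod * w)) :
    (l.map lop).prod (T w) = T (l.prod * w) := by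
  induction l with
  | nil => simp
  | cons s l ih =>
    have hl' : ∀ s ∈ l, s ∈ simples n := fun s hs => hl s (by simp [hs])
    simp only [List.map_cons, List.prod_cons, Module.End.mul_apply, List.length_cons] at h ⊢
    have h0 : len s ≤ 1 := by simpa using len_prod_le [s] (by simpa using hl s (by simp))
    have h1 := len_prod_le l hl'
    have h2 := len_mul_le l.prod w
    have h3 := len_mul_le s (l.prod * w)
    rw [← mul_assoc] at h3
    rw [ih hl' (by omega), lop_T, if_pos (by rw [← mul_assoc]; omega), mul_assoc]

/-- `T_y T_w = T_{y w}` if `ℓ(y) + ℓ(w) = ℓ(y w)`. -/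
theorem T_mul_T {n : ℕ} (y w : Equiv.Perm (Fin n)) (h : len y + len w = len (y * w)) :
    T y * T w = T (y * w) := by
  obtain ⟨h1, h2, h3⟩ := (exists_reduced y).choose_spec
  rw [mul_def, lmul_T, lopW, prod_lop_T _ h1 w (by rw [h2, h3, h]), h2]

theorem lmul_T_one {n : ℕ} (x : Hecke n) : lmul n x (T 1) = x := by
  have key : (lmul n).flip (T 1) = LinearMap.id := by
    refine (basisT n).ext fun w => ?_
    change T w * T 1 = T w
    rw [T_mul_T w 1 (by simp [len_one]), mul_one]
  exact LinearMap.congr_fun key x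

theorem lmul_one_apply {n : ℕ} : lmul n (T 1) = LinearMap.id :=
  ext_of_comm _ _ (fun _ ht x => lmul_rop_comm ht _ x) (fun _ _ _ => rfl) (lmul_T_one _)

instance instRing (n : ℕ) : Ring (Hecke n) :=
  { instAddCommGroup n, instMul n, instOne n with
    left_distrib := fun x y z => map_add (lmul n x) y z
    right_distrib := fun x y z => by simp only [mul_def, map_add, LinearMap.add_apply]
    zero_mul := fun x => by simp only [mul_def, map_zero, LinearMap.zero_apply]
    mul_zero := fun x => map_zero (lmul n x)
    one_mul := fun x => by rw [one_def, mul_def, lmul_one_apply, LinearMap.id_apply]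
    mul_one := fun x => lmul_T_one x
    mul_assoc := fun x y z => by
      have key : lmul n (lmul n x y) = lmul n x ∘ₗ lmul n y := by
        refine ext_of_comm _ _ (fun _ ht x => lmul_rop_comm ht _ x) (fun t ht z => ?_) ?_
        · simp only [LinearMap.comp_apply, lmul_rop_comm ht]
        · simp only [LinearMap.comp_apply, lmul_T_one]
      exact LinearMap.congr_fun key z }

instance instAlgebra (n : ℕ) : Algebra R (Hecke n) :=
  Algebra.ofModule
    (fun r x y => by simp only [mul_def, map_smul, LinearMap.smul_apply])
    (fun r x y => map_smul (lmul n x) r y)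

/-- The quadratic relation `(T_s + 1)(T_s - q) = 0`. -/
theorem T_quadratic {n : ℕ} {s : Equiv.Perm (Fin n)} (hs : s ∈ simples n) :
    (T s + 1) * (T s - q • (1 : Hecke n)) = 0 := by
  have hlt : len (1 : Equiv.Perm (Fin n)) < len (s * 1) := by
    obtain ⟨i, j, hij, rfl⟩ := hs
    rw [lt_len_swap_mul _ hij]
    simp only [inv_one, Equiv.Perm.one_apply, Fin.lt_def]
    omega
  have h1 : lmul n (T s) = lop s := by
    refine ext_of_comm _ _ (fun _ ht x => lmul_rop_comm ht _ x)
      (fun t ht x => lop_rop_comm hs ht x) ?_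
    rw [lmul_T_one, lop_T, if_pos hlt, mul_one]
  have h2 : T s * T s = (q - 1) • T s + q • (1 : Hecke n) := by
    rw [mul_def, h1, lop_T, simple_mul_self hs, if_neg, one_def]
    rw [mul_one] at hlt
    exact hlt.not_gt
  rw [mul_sub, add_mul, h2, mul_smul_comm, mul_one, one_mul, smul_add, sub_smul, one_smul]
  abel

theorem isUnit_T {n : ℕ} (w : Equiv.Perm (Fin n)) : IsUnit (T w) := by
  have hq : qhalf (-2) * q = 1 := by
    rw [q, qhalf, qhalf, ← LaurentPolynomial.T_add]
    simp
  have hsimple : ∀ s ∈ simples n, IsUnit (T s) := by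
    intro s hs
    have h1 := T_quadratic hs
    have h2 : T s * (T s - (q - 1) • (1 : Hecke n)) = q • (1 : Hecke n) := by
      rw [← sub_eq_zero, ← h1]
      simp only [mul_sub, add_mul, mul_smul_comm, mul_one, one_mul, sub_smul, one_smul, smul_add]
      abel
    have h3 : (T s - (q - 1) • (1 : Hecke n)) * T s = q • (1 : Hecke n) := by
      rw [← h2]
      simp only [mul_sub, sub_mul, mul_smul_comm, smul_mul_assoc, mul_one, one_mul]
    refine ⟨⟨T s, qhalf (-2) • (T s - (q - 1) • (1 : Hecke n)), ?_, ?_⟩, rfl⟩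
    · rw [mul_smul_comm, h2, smul_smul, hq, one_smul]
    · rw [smul_mul_assoc, h3, smul_smul, hq, one_smul]
  have key : ∀ l : List (Equiv.Perm (Fin n)), (∀ s ∈ l, s ∈ simples n) →
      l.length = len l.prod → IsUnit (T l.prod) := by
    intro l
    induction l with
    | nil => intro _ _; rw [List.prod_nil, ← one_def]; exact isUnit_one
    | cons s l ih =>
      intro hl hn
      have hl' : ∀ s ∈ l, s ∈ simples n := fun s hs => hl s (by simp [hs])
      simp only [List.prod_cons, List.length_cons] at hn ⊢
      have h0 : len s ≤ 1 := by simpa using len_prod_le [s] (by simpa using hl s (by simp))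
      have h1 := len_prod_le l hl'
      have h2 := len_mul_le s l.prod
      rw [← T_mul_T s l.prod (by omega)]
      exact (hsimple s (hl s (by simp))).mul (ih hl' (by omega))
  obtain ⟨l, hl, rfl, hn⟩ := exists_reduced w
  exact key l hl hn

/-! ## The Kazhdan–Lusztig basis -/

/-- The bar involution: it sends `q^{1/2}` to `q^{-1/2}` and `T_w` to the inverse of
`T_{w⁻¹}` (which is a unit). -/
def bar {n : ℕ} (h : Hecke n) : Hecke n :=
  ∑ w : Equiv.Perm (Fin n),
    LaurentPolynomial.invert ((basisT n).repr h w) • Ring.inverse (T w⁻¹)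

/-- `x` satisfies the defining conditions of the Kazhdan–Lusztig element `C_w`:
`x = ∑_{y ≤ w} P_{y,w}(q) T_y` where `P_{w,w} = 1` and, for `y < w`, `P_{y,w}` is an integral
polynomial of degree at most `(ℓ(w) - ℓ(y) - 1) / 2`; and the bar involution sends `x` to
`q^{-ℓ(w)} x`. -/
def IsKL {n : ℕ} (w : Equiv.Perm (Fin n)) (x : Hecke n) : Prop :=
  (∃ P : Equiv.Perm (Fin n) → Polynomial ℤ,
    P w = 1 ∧
    (∀ y, BruhatLE y w → y ≠ w → 2 * (P y).natDegree + len y + 1 ≤ len w) ∧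
    (∀ y, ¬ BruhatLE y w → P y = 0) ∧
    x = ∑ y : Equiv.Perm (Fin n), Polynomial.aeval q (P y) • T y) ∧
  bar x = qhalf (-2 * (len w : ℤ)) • x

/-- The Kazhdan–Lusztig element `C_w`: the unique element that satisfies `IsKL w`. -/
def C {n : ℕ} (w : Equiv.Perm (Fin n)) : Hecke n := Classical.epsilon (IsKL w)

/-! ## Two-sided cells and their bimodules -/

/-- The enveloping algebra `H ⊗ Hᵒᵖ`. An `H`-bimodule on which the two actions of
`ℤ[q^{1/2}, q^{-1/2}]` agree is the same as a module over it. -/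
def Env (n : ℕ) : Type := Hecke n ⊗[R] (Hecke n)ᵐᵒᵖ

instance instRingEnv (n : ℕ) : Ring (Env n) :=
  inferInstanceAs (Ring (Hecke n ⊗[R] (Hecke n)ᵐᵒᵖ))

/-- The Hecke algebra as a bimodule over itself. -/
instance bimodule (n : ℕ) : Module (Env n) (Hecke n) :=
  (TensorProduct.Algebra.module : Module (Hecke n ⊗[R] (Hecke n)ᵐᵒᵖ) (Hecke n))

/-- The pure tensor `a ⊗ b` in `H ⊗ Hᵒᵖ`. -/
def tens {n : ℕ} (a b : Hecke n) : Env n := a ⊗ₜ[R] MulOpposite.op b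

theorem tens_smul {n : ℕ} (a b x : Hecke n) : tens a b • x = a * x * b := by
  rw [mul_assoc]
  exact TensorProduct.Algebra.smul_def a (MulOpposite.op b) x

/-- Two-sided ideals of the Hecke algebra: its sub-bimodules. -/
abbrev Ideal2 (n : ℕ) : Type := Submodule (Env n) (Hecke n)

/-- The two-sided ideals that contain `C_w` and are spanned over `ℤ[q^{1/2}, q^{-1/2}]` by a
subset of the Kazhdan–Lusztig basis. -/
def klIdeals {n : ℕ} (w : Equiv.Perm (Fin n)) : Set (Ideal2 n) :=
  {I | C w ∈ I ∧ ∃ X : Set (Equiv.Perm (Fin n)), (I : Set (Hecke n)) = Submodule.span R (C '' X)}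

/-- The ideal `I_w`, the intersection of all ideals in `klIdeals w`. -/
def klIdeal {n : ℕ} (w : Equiv.Perm (Fin n)) : Ideal2 n := sInf (klIdeals w)

/-- The preorder `y ≤_{LR} w`. -/
def LeLR {n : ℕ} (y w : Equiv.Perm (Fin n)) : Prop := klIdeal y ≤ klIdeal w

/-- The two-sided cell that contains `w`. -/
def cell {n : ℕ} (w : Equiv.Perm (Fin n)) : Set (Equiv.Perm (Fin n)) :=
  {y | klIdeal y = klIdeal w}

/-- The two-sided ideal `H_{≤ 𝒞} = I_w`, where `𝒞` is the two-sided cell of `w`. -/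
def cellLE {n : ℕ} (w : Equiv.Perm (Fin n)) : Ideal2 n := klIdeal w

/-- The two-sided ideal `H_{< 𝒞}`, the sum of the ideals `I_y` over all `y ≤_{LR} w` outside `𝒞`,
where `𝒞` is the two-sided cell of `w`. -/
def cellLT {n : ℕ} (w : Equiv.Perm (Fin n)) : Ideal2 n :=
  ⨆ y ∈ {y | LeLR y w ∧ y ∉ cell w}, klIdeal y

/-- The bimodule `H_𝒞 = H_{≤ 𝒞} / H_{< 𝒞}`, where `𝒞` is the two-sided cell of `w`. -/
abbrev CellModule {n : ℕ} (w : Equiv.Perm (Fin n)) : Type :=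
  cellLE w ⧸ (cellLT w).submoduleOf (cellLE w)

theorem C_mem_klIdeal {n : ℕ} (w : Equiv.Perm (Fin n)) : C w ∈ klIdeal w :=
  Submodule.mem_sInf.2 fun _ hI => hI.1

theorem cellLT_le {n : ℕ} (w : Equiv.Perm (Fin n)) : cellLT w ≤ cellLE w :=
  iSup₂_le fun _ hy => hy.1

/-- The image of `C_v` in the bimodule `H_𝒞`, for `v` in the two-sided cell `𝒞` of `w`. -/
def cellImage {n : ℕ} {w v : Equiv.Perm (Fin n)} (hv : v ∈ cell w) : CellModule w :=
  Submodule.Quotient.mk ⟨C v, (le_of_eq hv : klIdeal v ≤ klIdeal w) (C_mem_klIdeal v)⟩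

end SymHecke

end

noncomputable section

namespace SymHecke

variable {n : ℕ}

/-! ## Arithmetic of the Hecke algebra -/

/-! A standard parabolic subgroup is the stabilizer of the fibres of a monotone map `b`. Let x_b be
the sum of its T_w, which is the Kazhdan–Lusztig element of its longest element (`parSum_eq_C`), let
J_b = H x_b H, and let N_k be the sum of the J_b with `aval b > k`. The heart of the proof is that
N_k, and also N_k + J_b for `aval b ≥ k`, are spanned by Kazhdan–Lusztig elements
(`isKLSpanned_parFiltration`, `IsCellIdeal.sup_parIdeal`).

Granting this, let C_v = x_b and N = N_k with k = `aval b`. The ideal N + J_b contains C_v and is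
spanned by Kazhdan–Lusztig elements, so it contains I_v; hence every element of I_v is the sum of an
element of J_b = H C_v H and an element of N ∩ I_v. Since C_v ∉ N (`parSum_notMem_parFiltration`),
no C_y with y in the cell of v lies in N, so N ∩ I_v is contained in H_{<𝒞}.

The span property rests on three facts.

(1) Rank one: x_b H x_b ⊆ R x_b + N (`exists_parSum_mul_mul_parSum`). Let y_c be the sign element
for the column filling c = `col b`. Then x_b H y_c is spanned by one element, while x_b H y_{c'} = 0
for the column filling c' of a different type unless that type has larger `aval`. A nonzero scalar
lies in the sum of all H x_β H y_{β'} H, with one β for each type and β' its column filling; this is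
checked at q = 1, where orthogonal central elements, at least as numerous as the conjugacy classes,
span the class functions (`one_mem_span_kap`).

(2) The left ideal H x_b is an eigenspace, and it is spanned by Kazhdan–Lusztig elements
(`exists_mul_parSum`, `isKLSpanned_eigen`).

(3) Almost orthonormality: the form (a, h) ↦ coefficient of a h* at T_1 has a Gram matrix on the
normalized Kazhdan–Lusztig basis that is the identity modulo q^{-1/2}, and this persists for a trace
t on H/N (`IsCellIdeal.exists_trace`).

Let c be the normalized C_v. By (2), J_b is spanned by the products e = h c k* with hc and kc
normalized Kazhdan–Lusztig elements. Such an e is bar invariant, and (1) gives t(ee*) t(cc*) =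
t(hc(hc)*) t(kc(kc)*) when neither factor lies in N. By (3) the integral leading coefficients of e
modulo N then have squares adding up to 1, so e is, up to sign, a single Kazhdan–Lusztig element
modulo N (`IsCellIdeal.exists_mul_sub_nC_mem`). No positivity of structure constants is needed. -/

theorem len_mul_simple {s : Equiv.Perm (Fin n)} (hs : s ∈ simples n) (w : Equiv.Perm (Fin n)) :
    len (w * s) = len w + 1 ∨ len (w * s) + 1 = len w := by
  obtain ⟨i, j, hij, rfl⟩ := hs
  simp only [len_eq_card_invSet]
  have hne : w i ≠ w j := fun h => by
    have := congrArg Fin.val (w.injective h)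
    omega
  rcases lt_or_gt_of_ne hne with h | h
  · exact Or.inl (card_invSet_mul_swap w hij h)
  · exact Or.inr (card_invSet_mul_swap' w hij h)

theorem len_simple_mul {s : Equiv.Perm (Fin n)} (hs : s ∈ simples n) (w : Equiv.Perm (Fin n)) :
    len (s * w) = len w + 1 ∨ len (s * w) + 1 = len w := by
  have := len_mul_simple hs w⁻¹
  rwa [len_inv, ← len_inv (w⁻¹ * s), mul_inv_rev, inv_inv, simple_inv hs] at this

theorem len_simple {s : Equiv.Perm (Fin n)} (hs : s ∈ simples n) : len s = 1 := by
  have := len_mul_simple hs 1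
  rw [one_mul, len_one] at this
  omega

theorem exists_simple_mul_lt {w : Equiv.Perm (Fin n)} (hw : w ≠ 1) :
    ∃ s ∈ simples n, len (w * s) < len w := by
  obtain ⟨i, j, hij, h⟩ := exists_descent w hw
  refine ⟨Equiv.swap i j, ⟨i, j, hij, rfl⟩, ?_⟩
  have h1 := len_mul_simple ⟨i, j, hij, rfl⟩ w
  have h2 := lt_len_mul_swap w hij
  rw [iff_false_right h.not_gt] at h2
  omega

theorem exists_mul_simple_lt {w : Equiv.Perm (Fin n)} (hw : w ≠ 1) :
    ∃ s ∈ simples n, len (s * w) < len w := by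
  obtain ⟨s, hs, h⟩ := exists_simple_mul_lt (w := w⁻¹) (by simpa using hw)
  refine ⟨s, hs, ?_⟩
  rwa [len_inv, ← len_inv (w⁻¹ * s), mul_inv_rev, inv_inv, simple_inv hs] at h

/-- The coefficient at `T_w`. -/
def coef (w : Equiv.Perm (Fin n)) : Hecke n →ₗ[R] R := (basisT n).coord w

theorem coef_def (w : Equiv.Perm (Fin n)) (h : Hecke n) : coef w h = (basisT n).repr h w := rfl

theorem coef_T (y w : Equiv.Perm (Fin n)) : coef y (T w) = if w = y then 1 else 0 := by
  rw [coef_def, T, Module.Basis.repr_self, Finsupp.single_apply]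

theorem sum_coef_T (h : Hecke n) : ∑ w, coef w h • T w = h := (basisT n).sum_repr h

theorem hecke_ext {x y : Hecke n} (h : ∀ w, coef w x = coef w y) : x = y :=
  (basisT n).ext_elem h

theorem hecke_induction {motive : Hecke n → Prop} (h : Hecke n) (zero : motive 0)
    (add : ∀ x y, motive x → motive y → motive (x + y))
    (smul : ∀ (r : R) (w : Equiv.Perm (Fin n)), motive (r • T w)) : motive h := by
  rw [← sum_coef_T h]
  exact Finset.sum_induction _ _ add zero fun w _ => smul _ w

theorem hecke_linear_ext {M : Type*} [AddCommMonoid M] [Module R M] {f g : Hecke n →ₗ[R] M}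
    (h : ∀ w, f (T w) = g (T w)) : f = g := (basisT n).ext h

theorem mul_T_simple {s : Equiv.Perm (Fin n)} (hs : s ∈ simples n) (h : Hecke n) :
    h * T s = rop s h := by
  have h1 : (T s : Hecke n) = rop s (T 1) := by
    rw [rop_T, one_mul, if_pos]
    rw [len_one, len_simple hs]
    exact one_pos
  rw [h1, mul_def, lmul_rop_comm hs, lmul_T_one]

theorem T_simple_mul {s : Equiv.Perm (Fin n)} (hs : s ∈ simples n) (h : Hecke n) :
    T s * h = lop s h := by
  have h1 : lmul n (T s) = lop s := by
    refine ext_of_comm _ _ (fun _ ht x => lmul_rop_comm ht _ x)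
      (fun t ht x => lop_rop_comm hs ht x) ?_
    rw [lmul_T_one, lop_T, mul_one, if_pos]
    rw [len_one, len_simple hs]
    exact one_pos
  exact LinearMap.congr_fun h1 h

theorem T_mul_T_simple {s : Equiv.Perm (Fin n)} (hs : s ∈ simples n) (w : Equiv.Perm (Fin n)) :
    T w * T s = if len w < len (w * s) then T (w * s) else (q - 1) • T w + q • T (w * s) := by
  rw [mul_T_simple hs, rop_T]

theorem T_simple_mul_T {s : Equiv.Perm (Fin n)} (hs : s ∈ simples n) (w : Equiv.Perm (Fin n)) :
    T s * T w = if len w < len (s * w) then T (s * w) else (q - 1) • T w + q • T (s * w) := by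
  rw [T_simple_mul hs, lop_T]

theorem mul_simple_mul_simple {s : Equiv.Perm (Fin n)} (hs : s ∈ simples n)
    (w : Equiv.Perm (Fin n)) : w * s * s = w := by
  rw [mul_assoc, simple_mul_self hs, mul_one]

theorem simple_mul_simple_mul {s : Equiv.Perm (Fin n)} (hs : s ∈ simples n)
    (w : Equiv.Perm (Fin n)) : s * (s * w) = w := by
  rw [← mul_assoc, simple_mul_self hs, one_mul]

/-- Only the basis elements of `y` and `y * s` contribute at `y`. This form of the multiplication
rule turns eigenvector equations into equalities of coefficients. -/
theorem coef_mul_T_simple {s : Equiv.Perm (Fin n)} (hs : s ∈ simples n) (y : Equiv.Perm (Fin n))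
    (h : Hecke n) : coef y (h * T s) = if len y < len (y * s) then q * coef (y * s) h
      else coef (y * s) h + (q - 1) * coef y h := by
  induction h using hecke_induction with
  | zero => simp
  | add a b ha hb =>
    rw [add_mul, map_add, ha, hb, map_add, map_add]
    split_ifs <;> ring
  | smul r w =>
    rw [smul_mul_assoc, map_smul, map_smul, map_smul, T_mul_T_simple hs]
    simp only [smul_eq_mul]
    have e : w * s = y ↔ w = y * s := by
      constructor
      · rintro rfl
        rw [mul_simple_mul_simple hs]
      · rintro rfl
        rw [mul_simple_mul_simple hs]
    have hn : y * s ≠ y := fun h => by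
      have := len_mul_simple hs y
      rw [h] at this
      omega
    by_cases h1 : w = y
    · subst h1
      split_ifs <;> simp [coef_T, hn, hn.symm, mul_comm]
    · by_cases h2 : w = y * s
      · subst h2
        have h3 := len_mul_simple hs y
        rw [mul_simple_mul_simple hs]
        by_cases h4 : len y < len (y * s)
        · rw [if_pos h4, if_neg (by omega)]
          simp only [map_add, map_smul, coef_T, if_true, if_neg h1, smul_eq_mul]
          ring
        · rw [if_neg h4, if_pos (by omega)]
          simp only [coef_T, if_true, if_neg h1]
          ring
      · have h3 : w * s ≠ y := fun h => h2 (e.1 h)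
        split_ifs <;> simp [coef_T, h1, h2, h3]

theorem q_def : q = (LaurentPolynomial.T 2 : R) := rfl

theorem isUnit_q : IsUnit q := LaurentPolynomial.isUnit_T 2

theorem q_ne_zero : q ≠ 0 := isUnit_q.ne_zero

/-- The right `q`-eigenspace of `T_s`. -/
theorem mul_T_simple_eq_iff {s : Equiv.Perm (Fin n)} (hs : s ∈ simples n) (h : Hecke n) :
    h * T s = q • h ↔ ∀ y, coef (y * s) h = coef y h := by
  constructor
  · intro he
    have key : ∀ y, len y < len (y * s) → coef (y * s) h = coef y h := by
      intro y hy
      have h1 := congrArg (coef y) he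
      rw [coef_mul_T_simple hs, if_pos hy, map_smul, smul_eq_mul] at h1
      exact mul_left_cancel₀ q_ne_zero h1
    intro y
    by_cases hy : len y < len (y * s)
    · exact key y hy
    · have h1 := len_mul_simple hs y
      have h2 := key (y * s) (by rw [mul_simple_mul_simple hs]; omega)
      rw [mul_simple_mul_simple hs] at h2
      exact h2.symm
  · intro he
    refine hecke_ext fun y => ?_
    rw [coef_mul_T_simple hs, he, map_smul, smul_eq_mul]
    split_ifs <;> ring

/-! ### The anti-involution -/

/-- The anti-involution `T_w ↦ T_{w⁻¹}`. -/
def star : Hecke n →ₗ[R] Hecke n := (basisT n).constr R fun w => T w⁻¹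

theorem star_T (w : Equiv.Perm (Fin n)) : star (T w) = T w⁻¹ := (basisT n).constr_basis R _ w

theorem star_star (h : Hecke n) : star (star h) = h := by
  have : (star ∘ₗ star : Hecke n →ₗ[R] Hecke n) = LinearMap.id :=
    hecke_linear_ext fun w => by simp [star_T]
  exact LinearMap.congr_fun this h

theorem coef_star (w : Equiv.Perm (Fin n)) (h : Hecke n) : coef w (star h) = coef w⁻¹ h := by
  have : (coef w ∘ₗ star : Hecke n →ₗ[R] R) = coef w⁻¹ :=
    hecke_linear_ext fun y => by simp [star_T, coef_T, inv_eq_iff_eq_inv]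
  exact LinearMap.congr_fun this h

theorem star_T_simple_mul {s : Equiv.Perm (Fin n)} (hs : s ∈ simples n) (h : Hecke n) :
    star (T s * h) = star h * T s := by
  induction h using hecke_induction with
  | zero => simp
  | add a b ha hb => rw [mul_add, map_add, ha, hb, map_add, add_mul]
  | smul r w =>
    rw [mul_smul_comm, map_smul, map_smul, smul_mul_assoc, T_simple_mul_T hs, star_T,
      T_mul_T_simple hs]
    have h1 : len (w⁻¹ * s) = len (s * w) := by
      rw [← len_inv, mul_inv_rev, inv_inv, simple_inv hs]
    rw [h1, len_inv]
    split_ifs <;> simp [star_T, simple_inv hs]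

/-- Induction on the length, with simple reflections multiplied on the left. -/
theorem left_induction {motive : Equiv.Perm (Fin n) → Prop} (w : Equiv.Perm (Fin n))
    (one : motive 1)
    (mul : ∀ s ∈ simples n, ∀ w, len w < len (s * w) → motive w → motive (s * w)) :
    motive w := by
  induction hk : len w using Nat.strong_induction_on generalizing w with
  | _ k ih =>
    by_cases hw : w = 1
    · rw [hw]
      exact one
    · obtain ⟨s, hs, h⟩ := exists_mul_simple_lt hw
      have := mul s hs (s * w) (by rwa [simple_mul_simple_mul hs])
        (ih _ (hk ▸ h) (s * w) rfl)
      rwa [simple_mul_simple_mul hs] at this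

theorem T_simple_mul_of_lt {s : Equiv.Perm (Fin n)} (hs : s ∈ simples n)
    {w : Equiv.Perm (Fin n)} (h : len w < len (s * w)) : T (s * w) = T s * T w := by
  rw [T_simple_mul_T hs, if_pos h]

theorem T_mul_simple_of_lt {s : Equiv.Perm (Fin n)} (hs : s ∈ simples n)
    {w : Equiv.Perm (Fin n)} (h : len w < len (w * s)) : T (w * s) = T w * T s := by
  rw [T_mul_T_simple hs, if_pos h]

theorem star_mul (a b : Hecke n) : star (a * b) = star b * star a := by
  induction a using hecke_induction with
  | zero => simp
  | add x y hx hy => rw [add_mul, map_add, hx, hy, map_add, mul_add]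
  | smul r w =>
    rw [smul_mul_assoc, map_smul, map_smul, mul_smul_comm]
    congr 1
    induction w using left_induction generalizing b with
    | one => rw [← one_def, one_mul, one_def, star_T, inv_one, ← one_def, mul_one]
    | mul s hs w h ih =>
      rw [T_simple_mul_of_lt hs h, mul_assoc, star_T_simple_mul hs, ih, star_T_simple_mul hs,
        mul_assoc]

/-! ### The bar involution -/

theorem bar_eq (h : Hecke n) : bar h =
    ∑ w : Equiv.Perm (Fin n), LaurentPolynomial.invert (coef w h) • Ring.inverse (T w⁻¹) := rfl

theorem bar_zero : bar (0 : Hecke n) = 0 := by simp [bar_eq]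

theorem bar_add (a b : Hecke n) : bar (a + b) = bar a + bar b := by
  simp [bar_eq, add_smul, Finset.sum_add_distrib]

theorem bar_smul (r : R) (h : Hecke n) : bar (r • h) = LaurentPolynomial.invert r • bar h := by
  simp [bar_eq, mul_smul, Finset.smul_sum]

theorem bar_sum {ι : Type*} (s : Finset ι) (f : ι → Hecke n) :
    bar (∑ i ∈ s, f i) = ∑ i ∈ s, bar (f i) :=
  map_sum (⟨⟨bar, bar_zero⟩, bar_add⟩ : Hecke n →+ Hecke n) f s

theorem bar_sub (a b : Hecke n) : bar (a - b) = bar a - bar b :=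
  map_sub (⟨⟨bar, bar_zero⟩, bar_add⟩ : Hecke n →+ Hecke n) a b

theorem bar_T (w : Equiv.Perm (Fin n)) : bar (T w) = Ring.inverse (T w⁻¹) := by
  rw [bar_eq, Finset.sum_eq_single w]
  · simp [coef_T]
  · intro y _ hy
    simp [coef_T, hy.symm]
  · simp

theorem bar_one : bar (1 : Hecke n) = 1 := by
  rw [one_def, bar_T, inv_one, ← one_def, Ring.inverse_one]

theorem bar_T_simple_mul {s : Equiv.Perm (Fin n)} (hs : s ∈ simples n) {w : Equiv.Perm (Fin n)}
    (h : len w < len (s * w)) : bar (T (s * w)) = bar (T s) * bar (T w) := by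
  obtain ⟨a, ha⟩ := isUnit_T w⁻¹
  obtain ⟨b, hb⟩ := isUnit_T s
  have h1 : T (s * w)⁻¹ = ((a * b : (Hecke n)ˣ) : Hecke n) := by
    rw [mul_inv_rev, simple_inv hs, T_mul_simple_of_lt hs, Units.val_mul, ha, hb]
    rwa [len_inv, ← len_inv (w⁻¹ * s), mul_inv_rev, inv_inv, simple_inv hs]
  rw [bar_T, bar_T, bar_T, simple_inv hs, h1, ← ha, ← hb, Ring.inverse_unit, Ring.inverse_unit,
    Ring.inverse_unit, mul_inv_rev, Units.val_mul]

theorem invert_q : LaurentPolynomial.invert q = qhalf (-2) := by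
  simp [q, qhalf]

theorem qhalf_mul (a b : ℤ) : qhalf a * qhalf b = qhalf (a + b) :=
  (LaurentPolynomial.T_add a b).symm

theorem qhalf_zero : qhalf 0 = 1 := LaurentPolynomial.T_zero

theorem invert_qhalf (a : ℤ) : LaurentPolynomial.invert (qhalf a) = qhalf (-a) := by
  simp [qhalf]

theorem bar_T_simple {s : Equiv.Perm (Fin n)} (hs : s ∈ simples n) :
    bar (T s) = qhalf (-2) • (T s - (q - 1) • (1 : Hecke n)) := by
  have h1 := T_quadratic hs
  have h2 : T s * (T s - (q - 1) • (1 : Hecke n)) = q • (1 : Hecke n) := by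
    rw [← sub_eq_zero, ← h1]
    simp only [mul_sub, add_mul, mul_smul_comm, mul_one, one_mul, sub_smul, one_smul, smul_add]
    abel
  have h3 : T s * (qhalf (-2) • (T s - (q - 1) • (1 : Hecke n))) = 1 := by
    rw [mul_smul_comm, h2, smul_smul, q, qhalf_mul]
    simp [qhalf_zero]
  rw [bar_T, simple_inv hs]
  generalize qhalf (-2) • (T s - (q - 1) • (1 : Hecke n)) = y at h3 ⊢
  obtain ⟨u, hu⟩ := isUnit_T s
  rw [← hu] at h3 ⊢
  rw [Ring.inverse_unit, Units.inv_eq_of_mul_eq_one_right h3]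

theorem bar_T_simple_mul_T_simple {s : Equiv.Perm (Fin n)} (hs : s ∈ simples n) :
    bar (T s) * T s = 1 := by
  rw [bar_T, simple_inv hs, Ring.inverse_mul_cancel _ (isUnit_T s)]

theorem T_simple_mul_self {s : Equiv.Perm (Fin n)} (hs : s ∈ simples n) :
    T s * T s = (q - 1) • T s + q • (1 : Hecke n) := by
  rw [T_simple_mul_T hs, simple_mul_self hs, if_neg, one_def]
  rw [len_one, len_simple hs]
  exact not_lt_of_gt one_pos

/-- Multiplying the quadratic relation of T_s twice by T_s⁻¹ gives the quadratic relation of T_s⁻¹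
with parameter q⁻¹. -/
theorem bar_T_simple_mul_self {s : Equiv.Perm (Fin n)} (hs : s ∈ simples n) :
    bar (T s) * bar (T s) =
      LaurentPolynomial.invert (q - 1) • bar (T s) + LaurentPolynomial.invert q • 1 := by
  have h1 := bar_T_simple_mul_T_simple hs
  have h2 := congrArg (fun x => bar (T s) * (bar (T s) * x)) (T_simple_mul_self hs)
  simp only [mul_add, mul_smul_comm, mul_one, h1] at h2
  rw [← mul_assoc (bar (T s)) (T s), h1, one_mul, h1] at h2
  have hq : qhalf (-2) * q = 1 := by rw [q, qhalf_mul]; simp [qhalf_zero]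
  have h3 := congrArg (fun x => qhalf (-2) • x) h2
  simp only [smul_add, smul_smul, hq, one_smul, mul_sub, mul_one] at h3
  rw [map_sub, map_one, invert_q, h3, sub_smul, sub_smul, one_smul]
  abel

theorem bar_mul (a b : Hecke n) : bar (a * b) = bar a * bar b := by
  have simple : ∀ s ∈ simples n, ∀ h : Hecke n, bar (T s * h) = bar (T s) * bar h := by
    intro s hs h
    induction h using hecke_induction with
    | zero => simp [bar_zero]
    | add x y hx hy => rw [mul_add, bar_add, hx, hy, bar_add, mul_add]
    | smul r w =>
      rw [mul_smul_comm, bar_smul, bar_smul, mul_smul_comm]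
      congr 1
      by_cases h : len w < len (s * w)
      · rw [← T_simple_mul_of_lt hs h, bar_T_simple_mul hs h]
      -- Here w = s(sw) with lengths adding, so the claim reduces to the quadratic relation of `bar
      -- (T s)`.
      · have h1 := len_simple_mul hs w
        have h2 : len (s * w) < len (s * (s * w)) := by
          rw [simple_mul_simple_mul hs]
          omega
        have h3 := bar_T_simple_mul hs h2
        rw [simple_mul_simple_mul hs] at h3
        rw [T_simple_mul_T hs, if_neg h, bar_add, bar_smul, bar_smul, h3, ← mul_assoc,
          bar_T_simple_mul_self hs, add_mul, smul_mul_assoc, smul_mul_assoc, one_mul]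
  induction a using hecke_induction with
  | zero => simp [bar_zero]
  | add x y hx hy => rw [add_mul, bar_add, hx, hy, bar_add, add_mul]
  | smul r w =>
    rw [smul_mul_assoc, bar_smul, bar_smul, smul_mul_assoc]
    congr 1
    induction w using left_induction generalizing b with
    | one => rw [← one_def, one_mul, bar_one, one_mul]
    | mul s hs w h ih =>
      rw [T_simple_mul_of_lt hs h, mul_assoc, simple s hs, ih, simple s hs, mul_assoc]

/-! ## Bruhat order -/

theorem right_induction {motive : Equiv.Perm (Fin n) → Prop} (w : Equiv.Perm (Fin n))
    (one : motive 1)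
    (mul : ∀ s ∈ simples n, ∀ w, len w < len (w * s) → motive w → motive (w * s)) :
    motive w := by
  have := left_induction (motive := fun w => motive w⁻¹) w⁻¹ (by simpa using one)
    fun s hs w hw h => by
      have := mul s hs w⁻¹ (by
        rwa [len_inv, ← len_inv (w⁻¹ * s), mul_inv_rev, inv_inv, simple_inv hs]) h
      rwa [mul_inv_rev, simple_inv hs]
  simpa using this

/-- Induction on `b - a`: for c = b - 1, the transposition (a b) is (a c) conjugated by the simple
reflection (c b). The middle factor increases the length by induction, and at least one of the two
outer factors does so too. -/
theorem len_lt_mul_swap {a b : Fin n} (hab : a < b) (w : Equiv.Perm (Fin n)) (h : w a < w b) :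
    len w < len (w * Equiv.swap a b) := by
  obtain ⟨d, hd⟩ : ∃ d : ℕ, (a : ℕ) + d + 1 = b := ⟨b - a - 1, by rw [Fin.lt_def] at hab; omega⟩
  induction d generalizing b w with
  | zero => exact (lt_len_mul_swap w hd).2 h
  | succ d ih =>
    obtain ⟨c, hc⟩ : ∃ c : Fin n, (c : ℕ) + 1 = b := ⟨⟨b - 1, by omega⟩, by simp; omega⟩
    have hac : a < c := by rw [Fin.lt_def]; omega
    have hcb : c ≠ b := fun h => by rw [h] at hc; omega
    have hs : Equiv.swap c b ∈ simples n := ⟨c, b, hc, rfl⟩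
    have e : w * Equiv.swap a b = w * Equiv.swap c b * Equiv.swap a c * Equiv.swap c b := by
      have e0 : Equiv.swap c b * Equiv.swap a c * Equiv.swap c b = Equiv.swap a b := by
        rw [Equiv.mul_swap_eq_swap_mul (Equiv.swap c b) a c,
          Equiv.swap_apply_of_ne_of_ne hac.ne hab.ne,
          Equiv.swap_apply_left, mul_assoc, Equiv.swap_mul_self, mul_one]
      rw [← e0]
      simp only [mul_assoc]
    have h1 := lt_len_mul_swap w hc
    have h2 := ih hac (w * Equiv.swap c b) (by
      simpa [Equiv.swap_apply_of_ne_of_ne hac.ne hab.ne] using h) (by omega)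
    have h3 := lt_len_mul_swap (w * Equiv.swap c b * Equiv.swap a c) hc
    simp only [Equiv.Perm.mul_apply, Equiv.swap_apply_right,
      Equiv.swap_apply_of_ne_of_ne hac.ne hab.ne, Equiv.swap_apply_of_ne_of_ne hab.ne' hcb.symm]
      at h3
    rw [← e] at h3
    have h4 := len_mul_simple hs w
    have h5 := len_mul_simple hs (w * Equiv.swap c b * Equiv.swap a c)
    rw [← e] at h5
    by_cases h6 : w c < w b
    · have := h1.2 h6
      omega
    · have h7 : w a < w c := h.trans_le (not_lt.1 h6)
      have := h3.2 h7
      have := fun h => h6 (h1.1 h)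
      omega

theorem lt_len_mul_transposition {a b : Fin n} (hab : a < b) (w : Equiv.Perm (Fin n)) :
    len w < len (w * Equiv.swap a b) ↔ w a < w b := by
  refine ⟨fun h => ?_, len_lt_mul_swap hab w⟩
  by_contra hcon
  have h1 : w b < w a :=
    lt_of_le_of_ne (not_lt.1 hcon) fun e => hab.ne' (w.injective e)
  have h2 := len_lt_mul_swap hab (w * Equiv.swap a b) (by simpa using h1)
  rw [mul_assoc, Equiv.swap_mul_self, mul_one] at h2
  omega

theorem lt_len_transposition_mul {a b : Fin n} (hab : a < b) (w : Equiv.Perm (Fin n)) :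
    len w < len (Equiv.swap a b * w) ↔ w⁻¹ a < w⁻¹ b := by
  rw [← lt_len_mul_transposition hab w⁻¹, len_inv, ← len_inv (_ * w), mul_inv_rev,
    Equiv.swap_inv]

theorem IsRefl.exists_swap {t : Equiv.Perm (Fin n)} (ht : IsRefl t) :
    ∃ a b : Fin n, a < b ∧ t = Equiv.swap a b := by
  obtain ⟨s, ⟨i, j, hij, rfl⟩, g, rfl⟩ := ht
  have e : g * Equiv.swap i j * g⁻¹ = Equiv.swap (g i) (g j) := by
    rw [Equiv.mul_swap_eq_swap_mul, mul_assoc, mul_inv_cancel, mul_one]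
  rw [e]
  have hne : g i ≠ g j := fun h => by
    have := congrArg Fin.val (g.injective h)
    omega
  rcases lt_or_gt_of_ne hne with h | h
  · exact ⟨_, _, h, rfl⟩
  · exact ⟨_, _, h, Equiv.swap_comm _ _⟩

theorem bruhat_mul_simple {s : Equiv.Perm (Fin n)} (hs : s ∈ simples n)
    {w : Equiv.Perm (Fin n)} (h : len w < len (w * s)) : BruhatLE w (w * s) := by
  refine Relation.ReflTransGen.single ⟨w * s * w⁻¹, ⟨s, hs, w, rfl⟩, ?_, h⟩
  rw [mul_assoc, inv_mul_cancel, mul_one]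

theorem BruhatLE.len_le {y w : Equiv.Perm (Fin n)} (h : BruhatLE y w) : len y ≤ len w := by
  induction h with
  | refl => exact le_rfl
  | tail _ h ih =>
    obtain ⟨t, -, -, h⟩ := h
    omega

theorem BruhatLE.len_lt {y w : Equiv.Perm (Fin n)} (h : BruhatLE y w) (hne : y ≠ w) :
    len y < len w := by
  rcases Relation.ReflTransGen.cases_tail h with rfl | ⟨z, hyz, t, -, -, hz⟩
  · exact absurd rfl hne
  · exact lt_of_le_of_lt (BruhatLE.len_le hyz) hz

theorem BruhatLE.trans {x y z : Equiv.Perm (Fin n)} (h : BruhatLE x y) (h' : BruhatLE y z) :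
    BruhatLE x z := Relation.ReflTransGen.trans h h'

/-- The lifting property of the Bruhat order. -/
theorem BruhatLE.mul_simple {s : Equiv.Perm (Fin n)} (hs : s ∈ simples n)
    {y u : Equiv.Perm (Fin n)} (h : BruhatLE y u) (hu : len u < len (u * s)) :
    BruhatLE (y * s) (u * s) := by
  -- A step y < ty of a chain survives right multiplication by s unless ty = ys, and in that case ys
  -- ≤ u already.
  have key : BruhatLE (y * s) u ∨ BruhatLE (y * s) (u * s) := by
    induction h using Relation.ReflTransGen.head_induction_on with
    | refl => exact Or.inr Relation.ReflTransGen.refl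
    | head h1 h2 ih =>
      rename_i y z
      obtain ⟨t, ht, rfl, hl⟩ := h1
      by_cases e : t * y = y * s
      · left
        rwa [← e]
      · have step : BruhatLE (y * s) (t * y * s) := by
          refine Relation.ReflTransGen.single ⟨t, ht, mul_assoc _ _ _, ?_⟩
          obtain ⟨a, b, hab, rfl⟩ := ht.exists_swap
          obtain ⟨i, j, hij, rfl⟩ := hs
          rw [mul_assoc, lt_len_transposition_mul hab]
          rw [lt_len_transposition_mul hab] at hl
          simp only [mul_inv_rev, Equiv.swap_inv, Equiv.Perm.mul_apply]
          rwa [swap_lt_swap hij]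
          · rintro ⟨rfl, rfl⟩
            apply e
            rw [Equiv.mul_swap_eq_swap_mul]
            simp
          · rintro ⟨rfl, rfl⟩
            apply e
            rw [Equiv.mul_swap_eq_swap_mul]
            simp [Equiv.swap_comm]
        exact ih.imp step.trans step.trans
  rcases key with h1 | h1
  · exact h1.trans (bruhat_mul_simple hs hu)
  · exact h1

/-! ## The Kazhdan–Lusztig basis -/

/-- Each factor `bar (T s)` raises the maximal length in the support by at most one, so `bar` is
triangular with diagonal entries q^{-ℓ(w)}. -/
theorem coef_bar_T {y w : Equiv.Perm (Fin n)} (h : len w ≤ len y) :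
    coef y (bar (T w)) = if w = y then qhalf (-2 * (len w : ℤ)) else 0 := by
  induction w using right_induction generalizing y with
  | one =>
    rw [← one_def, bar_one, one_def, coef_T, len_one]
    simp [qhalf_zero]
  | mul s hs w hw ih =>
    have h1 := len_mul_simple hs w
    have h2 := len_mul_simple hs y
    rw [T_mul_simple_of_lt hs hw, bar_mul, bar_T_simple hs, mul_smul_comm, map_smul, mul_sub,
      map_sub, mul_smul_comm, mul_one, map_smul, ih (by omega), if_neg, smul_zero, sub_zero,
      coef_mul_T_simple hs]
    · split_ifs with h3 h4 h4
      · subst h4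
        rw [mul_simple_mul_simple hs] at h3
        omega
      · rw [ih (by omega), if_neg]
        · simp
        · rintro rfl
          omega
      · subst h4
        rw [mul_simple_mul_simple hs, ih le_rfl, if_pos rfl, ih (by omega), if_neg, mul_zero,
          add_zero, smul_eq_mul, qhalf_mul]
        · congr 1
          push_cast [show len (w * s) = len w + 1 by omega]
          ring
        · intro h
          rw [← h] at hw
          omega
      · rw [ih (by omega), if_neg, ih (by omega), if_neg]
        · simp
        · rintro rfl
          omega
        · rintro rfl
          rw [mul_simple_mul_simple hs] at h4
          exact h4 rfl
    · rintro rfl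
      omega

theorem coeff_mul_qhalf (f : R) (k e : ℤ) : (f * qhalf k).coeff e = f.coeff (e - k) := by
  rw [qhalf, LaurentPolynomial.T, AddMonoidAlgebra.coeff_mul_single_eq_coeff_mul (e - k), mul_one]
  intro a _
  constructor <;> intro h <;> linarith

theorem coeff_aeval_q (p : Polynomial ℤ) (e : ℤ) :
    (Polynomial.aeval q p).coeff e =
      ∑ i ∈ Finset.range (p.natDegree + 1), if (2 * i : ℤ) = e then p.coeff i else 0 := by
  rw [Polynomial.aeval_eq_sum_range, AddMonoidAlgebra.coeff_sum, Finset.sum_apply']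
  refine Finset.sum_congr rfl fun i _ => ?_
  rw [q_def, LaurentPolynomial.T_pow, AddMonoidAlgebra.coeff_smul_apply, LaurentPolynomial.T_apply,
    mul_comm]
  simp

theorem exists_of_coeff_aeval_q_ne_zero {p : Polynomial ℤ} {e : ℤ}
    (h : (Polynomial.aeval q p).coeff e ≠ 0) : ∃ i : ℕ, e = 2 * i ∧ p.coeff i ≠ 0 := by
  rw [coeff_aeval_q] at h
  obtain ⟨i, -, hi⟩ := Finset.exists_ne_zero_of_sum_ne_zero h
  split_ifs at hi with h1
  · exact ⟨i, h1.symm, hi⟩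
  · exact absurd rfl hi

/-- The conditions on the polynomials `P_{y,w}` in a form convenient for calculations. -/
structure KLPoly (w : Equiv.Perm (Fin n)) (P : Equiv.Perm (Fin n) → Polynomial ℤ)
    (x : Hecke n) : Prop where
  self : P w = 1
  degree : ∀ y i, y ≠ w → (P y).coeff i ≠ 0 → 2 * i + len y + 1 ≤ len w
  bruhat : ∀ y, P y ≠ 0 → BruhatLE y w
  coef_eq : ∀ y, coef y x = Polynomial.aeval q (P y)
  bar_eq : bar x = qhalf (-2 * (len w : ℤ)) • x

theorem isKL_iff {w : Equiv.Perm (Fin n)} {x : Hecke n} : IsKL w x ↔ ∃ P, KLPoly w P x := by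
  constructor
  · rintro ⟨⟨P, h1, h2, h3, h4⟩, h5⟩
    have h3' : ∀ y, P y ≠ 0 → BruhatLE y w := fun y => not_imp_comm.1 (h3 y)
    refine ⟨P, h1, fun y i hy hi => ?_, h3', fun y => ?_, h5⟩
    · have := h2 y (h3' y fun h => hi (by simp [h])) hy
      have := Polynomial.le_natDegree_of_ne_zero hi
      omega
    · rw [h4, map_sum, Finset.sum_eq_single y]
      · simp [coef_T]
      · intro z _ hz
        simp [coef_T, hz]
      · simp
  · rintro ⟨P, h⟩
    refine ⟨⟨P, h.self, fun y hy hne => ?_, fun y => not_imp_comm.1 (h.bruhat y), ?_⟩, h.bar_eq⟩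
    · by_cases h0 : P y = 0
      · have := hy.len_lt hne
        simp [h0]
        omega
      · exact h.degree y _ hne (by simpa using h0)
    · rw [← sum_coef_T x]
      exact Finset.sum_congr rfl fun y _ => by rw [h.coef_eq]

/-- The Kazhdan–Lusztig element is unique. -/
theorem KLPoly.unique {w : Equiv.Perm (Fin n)} {P P' : Equiv.Perm (Fin n) → Polynomial ℤ}
    {x x' : Hecke n} (h : KLPoly w P x) (h' : KLPoly w P' x') : x = x' := by
  by_contra hne
  have hex : ∃ y ∈ (Finset.univ : Finset (Equiv.Perm (Fin n))).filter
      (fun y => coef y (x - x') ≠ 0), ∀ z ∈ (Finset.univ : Finset (Equiv.Perm (Fin n))).filter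
      (fun y => coef y (x - x') ≠ 0), len z ≤ len y := by
    apply Finset.exists_max_image
    by_contra hcon
    rw [Finset.not_nonempty_iff_eq_empty, Finset.filter_eq_empty_iff] at hcon
    apply hne
    rw [← sub_eq_zero]
    refine hecke_ext fun y => ?_
    simpa using hcon (Finset.mem_univ y)
  obtain ⟨y, hy, hmax⟩ := hex
  simp only [Finset.mem_filter, Finset.mem_univ, true_and] at hy hmax
  set d := x - x' with hd
  have hcoef : ∀ z, coef z d = Polynomial.aeval q (P z - P' z) := fun z => by
    rw [hd, map_sub, h.coef_eq, h'.coef_eq, map_sub]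
  have hyw : y ≠ w := by
    rintro rfl
    apply hy
    rw [hcoef, h.self, h'.self, sub_self, map_zero]
  have hdeg : ∀ i, (P y - P' y).coeff i ≠ 0 → 2 * i + len y + 1 ≤ len w := by
    intro i hi
    by_cases h1 : (P y).coeff i = 0
    · refine h'.degree y i hyw fun h2 => hi ?_
      rw [Polynomial.coeff_sub, h1, h2, sub_zero]
    · exact h.degree y i hyw h1
  have hbar : bar d = qhalf (-2 * (len w : ℤ)) • d := by
    rw [hd, bar_sub, h.bar_eq, h'.bar_eq, smul_sub]
  -- Since `y` is a longest element of the support of `d`, only T_y contributes here. Bar invariance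
  -- makes the exponents of this coefficient symmetric about ℓ(w) - ℓ(y), while the degree bound
  -- keeps all of them below that centre.
  have h1 : coef y (bar d) = LaurentPolynomial.invert (coef y d) * qhalf (-2 * (len y : ℤ)) := by
    conv_lhs => rw [← sum_coef_T d, bar_sum, map_sum]
    rw [Finset.sum_eq_single y]
    · rw [bar_smul, map_smul, coef_bar_T le_rfl, if_pos rfl, smul_eq_mul]
    · intro z _ hz
      rw [bar_smul, map_smul]
      by_cases h2 : coef z d = 0
      · rw [h2, map_zero, zero_smul]
      · rw [coef_bar_T (hmax z h2), if_neg hz, smul_zero]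
    · simp
  rw [hbar, map_smul, smul_eq_mul, mul_comm] at h1
  obtain ⟨e, he⟩ : ∃ e, (coef y d).coeff e ≠ 0 := by
    by_contra hcon
    push Not at hcon
    exact hy (LaurentPolynomial.ext fun e => by rw [hcon e]; rfl)
  have h2 : (coef y d * qhalf (-2 * (len w : ℤ))).coeff (e - 2 * len w) ≠ 0 := by
    rw [coeff_mul_qhalf]
    convert! he using 2
    ring
  rw [h1] at h2
  have h3 : (coef y d).coeff (2 * len w - 2 * len y - e) ≠ 0 := by
    rw [coeff_mul_qhalf, LaurentPolynomial.invert_apply] at h2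
    convert! h2 using 2
    ring
  rw [hcoef] at he h3
  obtain ⟨i, hi, hi'⟩ := exists_of_coeff_aeval_q_ne_zero he
  obtain ⟨j, hj, hj'⟩ := exists_of_coeff_aeval_q_ne_zero h3
  have := hdeg i hi'
  have := hdeg j hj'
  omega

theorem qhalf_two_mul (k : ℕ) : q ^ k = qhalf (2 * k) := by
  rw [q_def, LaurentPolynomial.T_pow, mul_comm, qhalf]

theorem bar_T_simple_add_one {s : Equiv.Perm (Fin n)} (hs : s ∈ simples n) :
    bar (T s + 1) = qhalf (-2) • (T s + 1) := by
  have hq : qhalf (-2) * q = 1 := by rw [q, qhalf_mul]; simp [qhalf_zero]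
  rw [bar_add, bar_one, bar_T_simple hs, smul_sub, smul_smul, mul_sub, hq, smul_add, sub_smul,
    mul_one, one_smul]
  abel

theorem T_simple_add_one_mul {s : Equiv.Perm (Fin n)} (hs : s ∈ simples n) :
    (T s + 1) * T s = q • (T s + 1) := by
  rw [add_mul, T_simple_mul_self hs, one_mul, smul_add, sub_smul, one_smul]
  abel

/-- The induction step in the construction of the Kazhdan–Lusztig elements. -/
theorem exists_klPoly_mul_simple {s : Equiv.Perm (Fin n)} (hs : s ∈ simples n)
    {u : Equiv.Perm (Fin n)} (hu : len u < len (u * s))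
    (P : Equiv.Perm (Fin n) → Equiv.Perm (Fin n) → Polynomial ℤ) (x : Equiv.Perm (Fin n) → Hecke n)
    (h : ∀ z, len z ≤ len u → KLPoly z (P z) (x z))
    (h' : ∀ z, len z ≤ len u → len (z * s) < len z → x z * T s = q • x z) :
    ∃ P' x', KLPoly (u * s) P' x' ∧ x' * T s = q • x' := by
  classical
  have hw : len (u * s) = len u + 1 := by
    have := len_mul_simple hs u
    omega
  have hP := h u le_rfl
  let k : Equiv.Perm (Fin n) → ℕ := fun z => (len (u * s) - len z) / 2
  -- The coefficient of P_{z,u} in the extreme degree (ℓ(u) - ℓ(z) - 1)/2 = `k z - 1`, for those `z`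
  -- with zs < z. Subtracting μ(z) q^{k(z)} C_z from C_u (T_s + 1) restores the degree bound.
  let μ : Equiv.Perm (Fin n) → ℤ := fun z =>
    if len (z * s) < len z ∧ len z + 2 * k z = len (u * s) ∧ 0 < k z then (P u z).coeff (k z - 1)
    else 0
  have hμ : ∀ z, μ z ≠ 0 → len (z * s) < len z ∧ len z + 2 * k z = len (u * s) ∧ 0 < k z ∧
      BruhatLE z u := by
    intro z hz
    simp only [μ] at hz
    split_ifs at hz with hc
    · exact ⟨hc.1, hc.2.1, hc.2.2, hP.bruhat z fun h => hz (by simp [h])⟩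
    · exact absurd rfl hz
  -- The coefficients of C_u (T_s + 1).
  let Q : Equiv.Perm (Fin n) → Polynomial ℤ := fun y =>
    if len y < len (y * s) then P u y + Polynomial.X * P u (y * s)
    else P u (y * s) + Polynomial.X * P u y
  have hle : BruhatLE u (u * s) := bruhat_mul_simple hs hu
  refine ⟨fun y => Q y - ∑ z, Polynomial.C (μ z) * Polynomial.X ^ k z * P z y,
    x u * (T s + 1) - ∑ z, Polynomial.aeval q (Polynomial.C (μ z) * Polynomial.X ^ k z) • x z,
    ⟨?_, ?_, ?_, ?_, ?_⟩, ?_⟩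
  · have h1 : P u (u * s) = 0 := by
      by_contra hne
      have := (hP.bruhat _ hne).len_le
      omega
    rw [Finset.sum_eq_zero, sub_zero]
    · simp only [Q]
      rw [mul_simple_mul_simple hs, if_neg (by omega), hP.self, h1, mul_zero, add_zero]
    · intro z _
      by_cases hz : μ z = 0
      · simp [hz]
      · obtain ⟨-, h2, h3, h4⟩ := hμ z hz
        have h5 : P z (u * s) = 0 := by
          by_contra hne
          have := ((h z h4.len_le).bruhat _ hne).len_le
          omega
        rw [h5, mul_zero]
  · intro y i hy hi
    by_contra hcon
    apply hi
    -- In a degree `i` beyond the bound, a correction term with z ≠ y has coefficient zero by the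
    -- bound on `P z y`.
    have hsum : (∑ z, Polynomial.C (μ z) * Polynomial.X ^ k z * P z y).coeff i =
        if k y = i then μ y else 0 := by
      rw [Polynomial.finsetSum_coeff, Finset.sum_eq_single y]
      · by_cases hz : μ y = 0
        · simp [hz]
        · obtain ⟨-, -, -, h4⟩ := hμ y hz
          rw [(h y h4.len_le).self, mul_one, Polynomial.coeff_C_mul_X_pow]
          simp only [eq_comm]
      · intro z _ hz
        by_cases hz0 : μ z = 0
        · simp [hz0]
        · obtain ⟨-, h2, -, h4⟩ := hμ z hz0
          rw [mul_assoc, Polynomial.coeff_C_mul, Polynomial.coeff_X_pow_mul']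
          split_ifs with h5
          · by_contra h6
            have := (h z h4.len_le).degree y (i - k z) hz.symm fun h7 => h6 (by rw [h7, mul_zero])
            omega
          · rw [mul_zero]
      · simp
    rw [Polynomial.coeff_sub, hsum]
    have hys := len_mul_simple hs y
    have hysu : y * s ≠ u := by
      rintro rfl
      rw [mul_simple_mul_simple hs] at hy
      exact hy rfl
    by_cases h1 : len y < len (y * s)
    · have h2 : μ y = 0 := by
        by_contra hne
        have := (hμ y hne).1
        omega
      have h3 : (P u y).coeff i = 0 := by
        by_cases hyu : y = u
        · rw [hyu, hP.self, Polynomial.coeff_one, if_neg]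
          rw [hyu] at hcon
          omega
        · by_contra hne
          have := hP.degree y i hyu hne
          omega
      have h4 : (Polynomial.X * P u (y * s)).coeff i = 0 := by
        cases i with
        | zero => simp
        | succ i =>
          rw [Polynomial.coeff_X_mul]
          by_contra hne
          have := hP.degree (y * s) i hysu hne
          omega
      simp [Q, h1, h2, h3, h4]
    · have hyu : y ≠ u := by
        rintro rfl
        exact h1 hu
      have h3 : (P u (y * s)).coeff i = 0 := by
        by_contra hne
        have := hP.degree (y * s) i hysu hne
        omega
      -- The only possible violation of the bound is the shifted extreme coefficient of `P u y`,
      -- exactly the one recorded in `μ y`.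
      have h4 : (Polynomial.X * P u y).coeff i = if k y = i then μ y else 0 := by
        cases i with
        | zero =>
          rw [Polynomial.coeff_X_mul_zero]
          split_ifs with hk
          · by_contra hne
            have := (hμ y (Ne.symm hne)).2.2.1
            omega
          · rfl
        | succ i =>
          rw [Polynomial.coeff_X_mul]
          by_cases h5 : (P u y).coeff i = 0
          · rw [h5]
            split_ifs with hk
            · simp only [μ]
              split_ifs
              · rw [hk, Nat.add_sub_cancel, h5]
              · rfl
            · rfl
          · have h6 := hP.degree y i hyu h5
            have h7 : k y = i + 1 := by
              simp only [k]
              omega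
            simp only [μ]
            rw [if_pos h7, if_pos, h7, Nat.add_sub_cancel]
            refine ⟨by omega, by omega, by omega⟩
      simp only [Q, if_neg h1, Polynomial.coeff_add, h3, h4]
      ring
  · intro y hy
    by_cases h1 : Q y = 0
    · rw [h1, zero_sub, neg_ne_zero] at hy
      obtain ⟨z, -, hz⟩ := Finset.exists_ne_zero_of_sum_ne_zero hy
      have hz1 : μ z ≠ 0 := fun h => hz (by simp [h])
      have hz2 : P z y ≠ 0 := fun h => hz (by simp [h])
      have h4 := (hμ z hz1).2.2.2
      exact (((h z h4.len_le).bruhat y hz2).trans h4).trans hle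
    · have h2 : P u y ≠ 0 ∨ P u (y * s) ≠ 0 := by
        by_contra! hcon
        exact h1 (by simp [Q, hcon])
      rcases h2 with h2 | h2
      · exact (hP.bruhat y h2).trans hle
      · have := (hP.bruhat _ h2).mul_simple hs hu
        rwa [mul_simple_mul_simple hs] at this
  · intro y
    rw [map_sub, map_sub, map_sum, map_sum]
    congr 1
    · rw [mul_add, mul_one, map_add, coef_mul_T_simple hs, hP.coef_eq, hP.coef_eq]
      simp only [Q]
      split_ifs <;> simp only [map_add, map_mul, Polynomial.aeval_X] <;> ring
    · refine Finset.sum_congr rfl fun z _ => ?_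
      by_cases hz : μ z = 0
      · simp [hz]
      · rw [map_smul, (h z (hμ z hz).2.2.2.len_le).coef_eq, map_mul _ _ (P z y), smul_eq_mul]
  · rw [bar_sub, bar_sum, bar_mul, hP.bar_eq, bar_T_simple_add_one hs, smul_sub, Finset.smul_sum]
    congr 1
    · rw [smul_mul_smul_comm, qhalf_mul, hw]
      congr 2
      push_cast
      ring
    · refine Finset.sum_congr rfl fun z _ => ?_
      by_cases hz : μ z = 0
      · simp [hz, bar_zero]
      · obtain ⟨-, h2, -, h4⟩ := hμ z hz
        rw [bar_smul, (h z h4.len_le).bar_eq, smul_smul, smul_smul]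
        congr 1
        rw [map_mul, map_mul, map_pow, Polynomial.aeval_X, qhalf_two_mul, invert_qhalf, ← h2,
          Polynomial.aeval_C, mul_left_comm, qhalf_mul, mul_assoc, qhalf_mul]
        congr 1
        · simp
        · congr 1
          push_cast
          ring
  · rw [sub_mul, mul_assoc, T_simple_add_one_mul hs, mul_smul_comm, smul_sub, Finset.sum_mul,
      Finset.smul_sum]
    congr 1
    refine Finset.sum_congr rfl fun z _ => ?_
    by_cases hz : μ z = 0
    · simp [hz]
    · obtain ⟨h1, -, -, h4⟩ := hμ z hz
      rw [smul_mul_assoc, h' z h4.len_le h1, smul_comm]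

theorem klPoly_one : KLPoly (1 : Equiv.Perm (Fin n)) (fun y => if y = 1 then 1 else 0) (T 1) := by
  refine ⟨by simp, ?_, ?_, ?_, ?_⟩
  · intro y i hy
    simp [hy]
  · intro y hy
    have : y = 1 := by
      by_contra hne
      simp [hne] at hy
    rw [this]
    exact Relation.ReflTransGen.refl
  · intro y
    rw [coef_T]
    simp only [eq_comm (a := y)]
    split_ifs <;> simp
  · rw [← one_def, bar_one, len_one]
    simp [qhalf_zero]

theorem exists_klPoly (w : Equiv.Perm (Fin n)) : ∃ P x, KLPoly w P x ∧
    ∀ s ∈ simples n, len (w * s) < len w → x * T s = q • x := by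
  induction hk : len w using Nat.strong_induction_on generalizing w with
  | _ k ih =>
    subst hk
    have step : ∀ s ∈ simples n, len (w * s) < len w →
        ∃ P x, KLPoly w P x ∧ x * T s = q • x := by
      intro s hs h
      -- The length condition sits under the existential so that `choose` gives total functions; the
      -- zero values at other `z` are never used.
      have ih' : ∀ z : Equiv.Perm (Fin n), ∃ P x, len z < len w → (KLPoly z P x ∧
          ∀ s ∈ simples n, len (z * s) < len z → x * T s = q • x) := fun z => by
        by_cases hz : len z < len w
        · obtain ⟨P, x, h⟩ := ih _ hz z rfl
          exact ⟨P, x, fun _ => h⟩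
        · exact ⟨0, 0, fun h => absurd h hz⟩
      choose P x hx using ih'
      have := exists_klPoly_mul_simple hs (u := w * s) (by rwa [mul_simple_mul_simple hs]) P x
        (fun z hz => (hx z (by omega)).1) fun z hz => (hx z (by omega)).2 s hs
      rwa [mul_simple_mul_simple hs] at this
    by_cases hw : w = 1
    · subst hw
      refine ⟨_, _, klPoly_one, fun s _ h => ?_⟩
      rw [len_one] at h
      omega
    · obtain ⟨s, hs, h⟩ := exists_simple_mul_lt hw
      obtain ⟨P, x, h1, h2⟩ := step s hs h
      refine ⟨P, x, h1, fun t ht h3 => ?_⟩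
      -- The construction along another descent `t` yields the same element by uniqueness, so a
      -- single element is an eigenvector for all descents.
      obtain ⟨P', x', h4, h5⟩ := step t ht h3
      rwa [h1.unique h4]

theorem exists_klPoly_C (w : Equiv.Perm (Fin n)) : ∃ P, KLPoly w P (C w) := by
  have h : ∃ x, IsKL w x := by
    obtain ⟨P, x, h, -⟩ := exists_klPoly w
    exact ⟨x, isKL_iff.2 ⟨P, h⟩⟩
  exact isKL_iff.1 (Classical.epsilon_spec h)

theorem KLPoly.eq_C {w : Equiv.Perm (Fin n)} {P : Equiv.Perm (Fin n) → Polynomial ℤ}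
    {x : Hecke n} (h : KLPoly w P x) : x = C w := by
  obtain ⟨P', h'⟩ := exists_klPoly_C w
  exact h.unique h'

theorem C_mul_T_simple {s : Equiv.Perm (Fin n)} (hs : s ∈ simples n) {w : Equiv.Perm (Fin n)}
    (h : len (w * s) < len w) : C w * T s = q • C w := by
  obtain ⟨P, x, h1, h2⟩ := exists_klPoly w
  rw [← h1.eq_C]
  exact h2 s hs h

theorem BruhatLE.inv {y w : Equiv.Perm (Fin n)} (h : BruhatLE y w) : BruhatLE y⁻¹ w⁻¹ := by
  refine Relation.ReflTransGen.lift (fun u : Equiv.Perm (Fin n) => u⁻¹) ?_ _ _ h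
  rintro u _ ⟨t, ⟨s, hs, g, rfl⟩, rfl, hl⟩
  refine ⟨u⁻¹ * (g * s * g⁻¹) * u, ⟨s, hs, u⁻¹ * g, by group⟩, ?_, ?_⟩
  · simp [simple_inv hs, mul_assoc]
  · rwa [len_inv, len_inv]

theorem star_one : star (1 : Hecke n) = 1 := by
  rw [one_def, star_T, inv_one]

theorem bar_star (h : Hecke n) : bar (star h) = star (bar h) := by
  induction h using hecke_induction with
  | zero => simp [bar_zero]
  | add a b ha hb => rw [map_add, bar_add, ha, hb, bar_add, map_add]
  | smul r w =>
    rw [map_smul, bar_smul, bar_smul, map_smul, star_T, bar_T, bar_T, inv_inv]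
    congr 1
    obtain ⟨u, hu⟩ := isUnit_T w
    have h1 : star (Ring.inverse (T w⁻¹)) * T w = 1 := by
      have := congrArg star (Ring.mul_inverse_cancel _ (isUnit_T w⁻¹))
      rwa [star_mul, star_T, inv_inv, star_one] at this
    rw [← hu] at h1 ⊢
    rw [Ring.inverse_unit, Units.inv_eq_of_mul_eq_one_left h1]

/-- All defining conditions pass from w to w⁻¹ under `star`, so uniqueness applies. -/
theorem star_C (w : Equiv.Perm (Fin n)) : star (C w) = C w⁻¹ := by
  obtain ⟨P, h⟩ := exists_klPoly_C w
  refine KLPoly.eq_C (P := fun y => P y⁻¹) ⟨?_, ?_, ?_, ?_, ?_⟩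
  · rw [inv_inv, h.self]
  · intro y i hy hi
    rw [len_inv, ← len_inv y]
    exact h.degree _ i (fun e => hy (by rw [← e, inv_inv])) hi
  · intro y hy
    simpa using (h.bruhat _ hy).inv
  · intro y
    rw [coef_star, h.coef_eq]
  · rw [bar_star, h.bar_eq, map_smul, len_inv]

theorem coef_C_self (w : Equiv.Perm (Fin n)) : coef w (C w) = 1 := by
  obtain ⟨P, h⟩ := exists_klPoly_C w
  rw [h.coef_eq, h.self, map_one]

theorem coef_C_eq_zero {y w : Equiv.Perm (Fin n)} (hl : len w ≤ len y) (hne : y ≠ w) :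
    coef y (C w) = 0 := by
  obtain ⟨P, h⟩ := exists_klPoly_C w
  rw [h.coef_eq]
  have : P y = 0 := by
    by_contra h0
    have := (h.bruhat y h0).len_lt hne
    omega
  rw [this, map_zero]

/-! ### Polynomials in `q^{-1/2}` -/

/-- The embedding of `ℤ[X]` in the ring of Laurent polynomials that sends `X` to `q^{-1/2}`. -/
def psi : Polynomial ℤ →+* R :=
  (RingHomClass.toRingHom (LaurentPolynomial.invert : R ≃ₐ[ℤ] R)).comp Polynomial.toLaurent

theorem psi_apply (p : Polynomial ℤ) : psi p = LaurentPolynomial.invert p.toLaurent := rfl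

theorem psi_injective : Function.Injective psi := fun _ _ h =>
  Polynomial.toLaurent_injective (LaurentPolynomial.invert.injective h)

theorem psi_X_pow (k : ℕ) : psi (Polynomial.X ^ k) = qhalf (-k) := by
  rw [psi_apply, Polynomial.toLaurent_X_pow, LaurentPolynomial.invert_T, qhalf]

theorem psi_C (a : ℤ) : psi (Polynomial.C a) = LaurentPolynomial.C a := by
  rw [psi_apply, Polynomial.toLaurent_C, LaurentPolynomial.invert_C]

theorem invert_invert (f : R) : LaurentPolynomial.invert (LaurentPolynomial.invert f) = f :=
  LaurentPolynomial.involutive_invert f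

theorem exists_qhalf_mul_eq_psi (f : R) : ∃ (k : ℕ) (p : Polynomial ℤ), qhalf (-k) * f = psi p := by
  obtain ⟨k, p, h⟩ := LaurentPolynomial.exists_T_pow (LaurentPolynomial.invert f)
  refine ⟨k, p, ?_⟩
  rw [psi_apply, h, map_mul, invert_invert, LaurentPolynomial.invert_T, mul_comm, qhalf]

/-! ### The normalized Kazhdan–Lusztig basis -/

/-- The bar invariant Kazhdan–Lusztig element `q^{-ℓ(w)/2} C_w`. -/
def nC (w : Equiv.Perm (Fin n)) : Hecke n := qhalf (-(len w : ℤ)) • C w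

theorem C_eq_smul_nC (w : Equiv.Perm (Fin n)) : C w = qhalf (len w : ℤ) • nC w := by
  rw [nC, smul_smul, qhalf_mul, add_neg_cancel, qhalf_zero, one_smul]

theorem bar_nC (w : Equiv.Perm (Fin n)) : bar (nC w) = nC w := by
  obtain ⟨P, h⟩ := exists_klPoly_C w
  rw [nC, bar_smul, h.bar_eq, smul_smul, invert_qhalf, qhalf_mul]
  congr 2
  ring

theorem star_nC (w : Equiv.Perm (Fin n)) : star (nC w) = nC w⁻¹ := by
  rw [nC, map_smul, star_C, nC, len_inv]

theorem coef_nC_self (w : Equiv.Perm (Fin n)) : coef w (nC w) = qhalf (-(len w : ℤ)) := by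
  rw [nC, map_smul, coef_C_self, smul_eq_mul, mul_one]

theorem coef_nC_eq_zero {y w : Equiv.Perm (Fin n)} (hl : len w ≤ len y) (hne : y ≠ w) :
    coef y (nC w) = 0 := by
  rw [nC, map_smul, coef_C_eq_zero hl hne, smul_zero]

theorem qhalf_ne_zero (k : ℤ) : qhalf k ≠ 0 := (LaurentPolynomial.isUnit_T k).ne_zero

/-- The coefficients of the normalized Kazhdan–Lusztig elements at the normalized standard basis
are polynomials in `q^{-1/2}` whose constant term is `1` on the diagonal and `0` off it. -/
theorem exists_coef_nC (y w : Equiv.Perm (Fin n)) : ∃ p : Polynomial ℤ,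
    coef y (nC w) = qhalf (-(len y : ℤ)) * psi p ∧ p.coeff 0 = if y = w then 1 else 0 := by
  by_cases hyw : y = w
  · subst hyw
    exact ⟨1, by rw [coef_nC_self, map_one, mul_one], by simp⟩
  · obtain ⟨P, h⟩ := exists_klPoly_C w
    -- The degree bound makes the exponent ℓ(w) - ℓ(y) - 2i at least 1 wherever the coefficient is
    -- nonzero, so the truncated subtraction is exact there and the constant term vanishes.
    refine ⟨∑ i ∈ Finset.range ((P y).natDegree + 1),
      Polynomial.C ((P y).coeff i) * Polynomial.X ^ (len w - len y - 2 * i), ?_, ?_⟩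
    · rw [nC, map_smul, h.coef_eq, Polynomial.aeval_eq_sum_range, smul_eq_mul, Finset.mul_sum,
        map_sum, Finset.mul_sum]
      refine Finset.sum_congr rfl fun i _ => ?_
      by_cases h0 : (P y).coeff i = 0
      · simp [h0]
      · have := h.degree y i hyw h0
        rw [map_mul, psi_C, psi_X_pow, LaurentPolynomial.smul_eq_C_mul, qhalf_two_mul,
          mul_left_comm, qhalf_mul, mul_left_comm, qhalf_mul]
        congr 2
        omega
    · rw [if_neg hyw, Polynomial.finsetSum_coeff]
      refine Finset.sum_eq_zero fun i _ => ?_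
      by_cases h0 : (P y).coeff i = 0
      · simp [h0]
      · have := h.degree y i hyw h0
        rw [Polynomial.coeff_C_mul_X_pow, if_neg]
        omega

theorem exists_max_len {p : Equiv.Perm (Fin n) → Prop} (h : ∃ w, p w) :
    ∃ w, p w ∧ ∀ z, p z → len z ≤ len w := by
  classical
  obtain ⟨w, hw, hmax⟩ := Finset.exists_max_image (Finset.univ.filter p) len (by
    obtain ⟨w, hw⟩ := h
    exact ⟨w, by simpa using hw⟩)
  exact ⟨w, by simpa using hw, fun z hz => hmax z (by simpa using hz)⟩

theorem coef_sum_nC {a : Equiv.Perm (Fin n) → R} {w : Equiv.Perm (Fin n)}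
    (hmax : ∀ z, a z ≠ 0 → len z ≤ len w) {y : Equiv.Perm (Fin n)} (hy : len w ≤ len y) :
    coef y (∑ z, a z • nC z) = a y * qhalf (-(len y : ℤ)) := by
  rw [map_sum, Finset.sum_eq_single y]
  · rw [map_smul, coef_nC_self, smul_eq_mul]
  · intro z _ hz
    by_cases h0 : a z = 0
    · simp [h0]
    · rw [map_smul, coef_nC_eq_zero ((hmax z h0).trans hy) hz.symm, smul_zero]
  · simp

theorem linearIndependent_nC : LinearIndependent R (nC : Equiv.Perm (Fin n) → Hecke n) := by
  rw [Fintype.linearIndependent_iff]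
  intro a ha
  by_contra! hcon
  obtain ⟨w, hw, hmax⟩ := exists_max_len hcon
  have := coef_sum_nC hmax le_rfl
  rw [ha, map_zero, eq_comm, mul_eq_zero] at this
  exact this.elim hw (qhalf_ne_zero _)

theorem span_nC : ⊤ ≤ Submodule.span R (Set.range (nC : Equiv.Perm (Fin n) → Hecke n)) := by
  have key : ∀ w : Equiv.Perm (Fin n), T w ∈ Submodule.span R (Set.range (nC (n := n))) := by
    intro w
    induction hk : len w using Nat.strong_induction_on generalizing w with
    | _ k ih =>
      have h1 : C w ∈ Submodule.span R (Set.range (nC (n := n))) := by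
        rw [C_eq_smul_nC]
        exact Submodule.smul_mem _ _ (Submodule.subset_span ⟨w, rfl⟩)
      have h2 : T w = C w - ∑ y ∈ Finset.univ.erase w, coef y (C w) • T y := by
        rw [eq_sub_iff_add_eq]
        conv_rhs => rw [← sum_coef_T (C w)]
        rw [← Finset.add_sum_erase _ _ (Finset.mem_univ w), coef_C_self, one_smul]
      rw [h2]
      refine Submodule.sub_mem _ h1 (Submodule.sum_mem _ fun y hy => ?_)
      by_cases hl : len w ≤ len y
      · rw [coef_C_eq_zero hl (Finset.ne_of_mem_erase hy), zero_smul]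
        exact Submodule.zero_mem _
      · exact Submodule.smul_mem _ _ (ih (len y) (by omega) y rfl)
  intro h _
  rw [← sum_coef_T h]
  exact Submodule.sum_mem _ fun w _ => Submodule.smul_mem _ _ (key w)

/-- The basis of normalized Kazhdan–Lusztig elements. -/
def basisC (n : ℕ) : Module.Basis (Equiv.Perm (Fin n)) R (Hecke n) :=
  Module.Basis.mk linearIndependent_nC span_nC

theorem basisC_apply (w : Equiv.Perm (Fin n)) : basisC n w = nC w :=
  Module.Basis.mk_apply _ _ w

/-- The coefficient at the normalized Kazhdan–Lusztig element of `w`. -/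
def coefC (w : Equiv.Perm (Fin n)) : Hecke n →ₗ[R] R := (basisC n).coord w

theorem sum_coefC (h : Hecke n) : ∑ w, coefC w h • nC w = h := by
  have := (basisC n).sum_repr h
  simp only [basisC_apply] at this
  exact this

theorem coefC_nC (y w : Equiv.Perm (Fin n)) : coefC y (nC w) = if w = y then 1 else 0 := by
  rw [← basisC_apply, coefC, Module.Basis.coord_apply, Module.Basis.repr_self,
    Finsupp.single_apply]

theorem coefC_sum (a : Equiv.Perm (Fin n) → R) (y : Equiv.Perm (Fin n)) :
    coefC y (∑ w, a w • nC w) = a y := by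
  simp [coefC_nC]

/-! ### Spans of Kazhdan–Lusztig elements -/

/-- The submodules spanned by a part of the Kazhdan–Lusztig basis. -/
def IsKLSpanned (N : Submodule R (Hecke n)) : Prop :=
  ∀ h ∈ N, ∀ w, coefC w h ≠ 0 → nC w ∈ N

theorem isKLSpanned_iSup {ι : Sort*} {N : ι → Submodule R (Hecke n)}
    (h : ∀ i, IsKLSpanned (N i)) : IsKLSpanned (⨆ i, N i) := by
  intro x hx
  induction hx using Submodule.iSup_induction' with
  | mem i x hx => exact fun w hw => Submodule.mem_iSup_of_mem i (h i x hx w hw)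
  | zero => intro w hw; simp at hw
  | add x y _ _ hx hy =>
    intro w hw
    by_cases h0 : coefC w x = 0
    · refine hy w ?_
      rwa [map_add, h0, zero_add] at hw
    · exact hx w h0

theorem IsKLSpanned.eq_span {N : Submodule R (Hecke n)} (h : IsKLSpanned N) :
    N = Submodule.span R (C '' {w | nC w ∈ N}) := by
  apply le_antisymm
  · intro x hx
    rw [← sum_coefC x]
    refine Submodule.sum_mem _ fun w _ => ?_
    by_cases h0 : coefC w x = 0
    · rw [h0, zero_smul]
      exact Submodule.zero_mem _
    · rw [nC]
      exact Submodule.smul_mem _ _ (Submodule.smul_mem _ _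
        (Submodule.subset_span ⟨w, h x hx w h0, rfl⟩))
  · rw [Submodule.span_le]
    rintro _ ⟨w, hw, rfl⟩
    rw [C_eq_smul_nC]
    exact N.smul_mem _ hw

theorem isKLSpanned_span (X : Set (Equiv.Perm (Fin n))) :
    IsKLSpanned (Submodule.span R (C '' X)) := by
  intro x hx
  induction hx using Submodule.span_induction with
  | mem x hx =>
    obtain ⟨y, hy, rfl⟩ := hx
    intro w hw
    rw [C_eq_smul_nC, map_smul, coefC_nC] at hw
    have : y = w := by
      by_contra hne
      simp [hne] at hw
    rw [nC, ← this]
    exact Submodule.smul_mem _ _ (Submodule.subset_span ⟨y, hy, rfl⟩)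
  | zero => intro w hw; simp at hw
  | add x y _ _ hx hy =>
    intro w hw
    by_cases h0 : coefC w x = 0
    · refine hy w ?_
      rwa [map_add, h0, zero_add] at hw
    · exact hx w h0
  | smul r x _ hx =>
    intro w hw
    refine hx w fun h0 => hw ?_
    rw [map_smul, h0, smul_zero]

/-- The quotient by the span of a part of a basis is free, hence torsion-free over the domain `R`.
This permits cancelling scalars that are merely nonzero, without passing to the fraction field. -/
theorem IsKLSpanned.mem_of_smul_mem {N : Submodule R (Hecke n)} (h : IsKLSpanned N) {r : R}
    (hr : r ≠ 0) {x : Hecke n} (hx : r • x ∈ N) : x ∈ N := by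
  rw [← sum_coefC x]
  refine Submodule.sum_mem _ fun w _ => ?_
  by_cases h0 : coefC w x = 0
  · rw [h0, zero_smul]
    exact N.zero_mem
  · refine N.smul_mem _ (h _ hx w ?_)
    rw [map_smul, smul_eq_mul]
    exact mul_ne_zero hr h0

/-! ## Parabolic subgroups -/

/-- `w` preserves the fibres of `b`. For monotone `b`, these elements form a standard parabolic
subgroup. -/
def Fixes (b : Fin n → Fin n) (w : Equiv.Perm (Fin n)) : Prop := ∀ i, b (w i) = b i

theorem Fixes.one (b : Fin n → Fin n) : Fixes b 1 := fun _ => rfl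

theorem Fixes.mul {b : Fin n → Fin n} {u w : Equiv.Perm (Fin n)} (hu : Fixes b u)
    (hw : Fixes b w) : Fixes b (u * w) := fun i => (hu (w i)).trans (hw i)

theorem Fixes.inv {b : Fin n → Fin n} {w : Equiv.Perm (Fin n)} (hw : Fixes b w) :
    Fixes b w⁻¹ := fun i => by simpa using (hw (w⁻¹ i)).symm

theorem fixes_swap {b : Fin n → Fin n} {i j : Fin n} (h : b i = b j) :
    Fixes b (Equiv.swap i j) := by
  intro k
  rw [Equiv.swap_apply_def]
  split_ifs with h1 h2
  · rw [h1, h]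
  · rw [h2, h]
  · rfl

theorem fixes_mul_swap_iff {b : Fin n → Fin n} {i j : Fin n} (h : b i = b j)
    (w : Equiv.Perm (Fin n)) : Fixes b (w * Equiv.swap i j) ↔ Fixes b w := by
  refine ⟨fun hw => ?_, fun hw => hw.mul (fixes_swap h)⟩
  have := hw.mul (fixes_swap h)
  rwa [mul_assoc, Equiv.swap_mul_self, mul_one] at this

/-- The fibres of a monotone map are intervals, so comparisons of neighbours within a fibre chain
together. -/
theorem fiber_chain {α : Type*} [Preorder α] {b : Fin n → Fin n} (hb : Monotone b)
    {f : Fin n → α} (h : ∀ i j : Fin n, (i : ℕ) + 1 = j → b i = b j → f i < f j)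
    {i j : Fin n} (hij : i < j) (hbij : b i = b j) : f i < f j := by
  obtain ⟨d, hd⟩ : ∃ d : ℕ, (i : ℕ) + d + 1 = j := ⟨j - i - 1, by rw [Fin.lt_def] at hij; omega⟩
  induction d generalizing j with
  | zero => exact h i j hd hbij
  | succ d ih =>
    obtain ⟨k, hk⟩ : ∃ k : Fin n, (k : ℕ) + 1 = j := ⟨⟨j - 1, by omega⟩, by simp; omega⟩
    have h1 : i < k := by rw [Fin.lt_def]; omega
    have h2 : k < j := by rw [Fin.lt_def]; omega
    have h3 : b i = b k := le_antisymm (hb h1.le) ((hb h2.le).trans hbij.ge)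
    exact (ih h1 h3 (by omega)).trans (h k j hk (h3.symm.trans hbij))

/-- Every descent of `w` lies inside a fibre: `w j < w i` gives b(j) ≤ b(i) because `w` preserves
`b`. Inductions on the length therefore stay inside the subgroup. -/
theorem Fixes.exists_descent {b : Fin n → Fin n} (hb : Monotone b) {w : Equiv.Perm (Fin n)}
    (hw : Fixes b w) (h1 : w ≠ 1) :
    ∃ i j : Fin n, (i : ℕ) + 1 = j ∧ b i = b j ∧ w j < w i := by
  obtain ⟨i, j, hij, h⟩ := SymHecke.exists_descent w h1
  refine ⟨i, j, hij, le_antisymm (hb ?_) ?_, h⟩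
  · rw [Fin.le_def]
    omega
  · rw [← hw i, ← hw j]
    exact hb h.le

@[elab_as_elim]
theorem fixes_induction {b : Fin n → Fin n} (hb : Monotone b)
    {motive : ∀ w : Equiv.Perm (Fin n), Fixes b w → Prop} {w : Equiv.Perm (Fin n)}
    (hw : Fixes b w) (one : motive 1 (Fixes.one b))
    (mul : ∀ (i j : Fin n) (_ : (i : ℕ) + 1 = j) (hbij : b i = b j) (u : Equiv.Perm (Fin n))
      (hu : Fixes b u), u i < u j → motive u hu →
      motive (u * Equiv.swap i j) (hu.mul (fixes_swap hbij))) : motive w hw := by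
  induction hk : len w using Nat.strong_induction_on generalizing w with
  | _ k ih =>
    by_cases h1 : w = 1
    · subst h1
      exact one
    · obtain ⟨i, j, hij, hbij, h⟩ := hw.exists_descent hb h1
      have h2 : Fixes b (w * Equiv.swap i j) := hw.mul (fixes_swap hbij)
      have h3 : len (w * Equiv.swap i j) < len w := by
        have := (lt_len_mul_swap (w * Equiv.swap i j) hij).2 (by simpa using h)
        rwa [mul_assoc, Equiv.swap_mul_self, mul_one] at this
      have := mul i j hij hbij _ h2 (by simpa using h) (ih _ (hk ▸ h3) h2 rfl)
      simpa only [mul_assoc, Equiv.swap_mul_self, mul_one] using this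

/-- Standard parabolic subgroups are Young subgroups: `b i` counts the breaks before `i`, that is,
the positions k < i whose adjacent transposition (k k+1) is missing from `A`. -/
theorem exists_monotone_of_subset_simples {A : Set (Equiv.Perm (Fin n))} (hA : A ⊆ simples n) :
    ∃ b : Fin n → Fin n, Monotone b ∧ ∀ w, w ∈ Subgroup.closure A ↔ Fixes b w := by
  classical
  let F : Fin n → Finset (Fin n) := fun i => Finset.univ.filter fun k =>
    ∃ j : Fin n, (k : ℕ) + 1 = j ∧ j ≤ i ∧ Equiv.swap k j ∉ A
  have hF : ∀ i, (F i).card < n := by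
    intro i
    have : F i ⊆ Finset.univ.erase i := by
      intro k hk
      simp only [F, Finset.mem_filter, Finset.mem_univ, true_and] at hk
      obtain ⟨j, h1, h2, -⟩ := hk
      rw [Fin.le_def] at h2
      refine Finset.mem_erase.2 ⟨?_, Finset.mem_univ k⟩
      rintro rfl
      omega
    have h1 := Finset.card_le_card this
    rw [Finset.card_erase_of_mem (Finset.mem_univ i), Finset.card_univ, Fintype.card_fin] at h1
    have := i.isLt
    omega
  have hmono : ∀ i i', i ≤ i' → F i ⊆ F i' := by
    intro i i' h k hk
    simp only [F, Finset.mem_filter, Finset.mem_univ, true_and] at hk ⊢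
    obtain ⟨j, h1, h2, h3⟩ := hk
    exact ⟨j, h1, h2.trans h, h3⟩
  let b : Fin n → Fin n := fun i => ⟨(F i).card, hF i⟩
  have hb : Monotone b := fun i i' h => Finset.card_le_card (hmono i i' h)
  have hbA : ∀ i j : Fin n, (i : ℕ) + 1 = j → (Equiv.swap i j ∈ A ↔ b i = b j) := by
    intro i j hij
    have hle : i ≤ j := by rw [Fin.le_def]; omega
    have h1 : b i = b j ↔ F i = F j := by
      rw [Fin.ext_iff]
      exact ⟨fun h => Finset.eq_of_subset_of_card_le (hmono i j hle) h.ge, fun h => by simp [b, h]⟩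
    rw [h1]
    constructor
    · intro h
      refine Finset.Subset.antisymm (hmono i j hle) fun k hk => ?_
      simp only [F, Finset.mem_filter, Finset.mem_univ, true_and] at hk ⊢
      obtain ⟨l, h2, h3, h4⟩ := hk
      refine ⟨l, h2, ?_, h4⟩
      by_contra h5
      have h6 : l = j := by
        rw [Fin.ext_iff]
        rw [Fin.le_def] at h3 h5
        omega
      subst h6
      have h7 : k = i := by
        rw [Fin.ext_iff]
        omega
      exact h4 (h7 ▸ h)
    · intro h
      by_contra h2
      have h3 : i ∈ F j := by
        simp only [F, Finset.mem_filter, Finset.mem_univ, true_and]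
        exact ⟨j, hij, le_rfl, h2⟩
      rw [← h] at h3
      simp only [F, Finset.mem_filter, Finset.mem_univ, true_and] at h3
      obtain ⟨l, h4, h5, -⟩ := h3
      rw [Fin.le_def] at h5
      omega
  refine ⟨b, hb, fun w => ⟨fun h => ?_, fun h => ?_⟩⟩
  · induction h using Subgroup.closure_induction with
    | mem x hx =>
      obtain ⟨i, j, hij, rfl⟩ := hA hx
      exact fixes_swap ((hbA i j hij).1 hx)
    | one => exact Fixes.one b
    | mul x y _ _ hx hy => exact hx.mul hy
    | inv x _ hx => exact hx.inv
  · induction w, h using fixes_induction hb with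
    | one => exact Subgroup.one_mem _
    | mul i j hij hbij u _ _ ih =>
      exact Subgroup.mul_mem _ ih (Subgroup.subset_closure ((hbA i j hij).2 hbij))

/-! ### Eigenvectors for a parabolic subgroup -/

open Classical in
/-- The sum of the `T_w` over the parabolic subgroup of `b`. -/
def parSum (b : Fin n → Fin n) : Hecke n := ∑ w with Fixes b w, T w

open Classical in
theorem coef_parSum (b : Fin n → Fin n) (y : Equiv.Perm (Fin n)) :
    coef y (parSum b) = if Fixes b y then 1 else 0 := by
  rw [parSum, map_sum]
  simp [coef_T]

/-- The elements `h` with `h T_s = q h` for all simple reflections `s` in the parabolic subgroup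
of `b`. -/
def eigen (b : Fin n → Fin n) : Submodule R (Hecke n) where
  carrier := {h | ∀ i j : Fin n, (i : ℕ) + 1 = j → b i = b j → h * T (Equiv.swap i j) = q • h}
  add_mem' hx hy i j hij hb := by rw [add_mul, hx i j hij hb, hy i j hij hb, smul_add]
  zero_mem' i j _ _ := by simp
  smul_mem' r x hx i j hij hb := by rw [smul_mul_assoc, hx i j hij hb, smul_comm]

theorem mem_eigen_iff {b : Fin n → Fin n} {h : Hecke n} : h ∈ eigen b ↔
    ∀ i j : Fin n, (i : ℕ) + 1 = j → b i = b j → ∀ y, coef (y * Equiv.swap i j) h = coef y h := by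
  refine forall₄_congr fun i j hij _ => ?_
  exact mul_T_simple_eq_iff ⟨i, j, hij, rfl⟩ h

theorem mul_mem_eigen {b : Fin n → Fin n} {h : Hecke n} (hh : h ∈ eigen b) (a : Hecke n) :
    a * h ∈ eigen b := fun i j hij hb => by rw [mul_assoc, hh i j hij hb, mul_smul_comm]

theorem parSum_mem_eigen (b : Fin n → Fin n) : parSum b ∈ eigen b := by
  rw [mem_eigen_iff]
  intro i j _ hb y
  rw [coef_parSum, coef_parSum]
  classical exact if_congr (fixes_mul_swap_iff hb y) rfl rfl

theorem coef_mul_fixes {b : Fin n → Fin n} (hb : Monotone b) {h : Hecke n} (hh : h ∈ eigen b)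
    {w : Equiv.Perm (Fin n)} (hw : Fixes b w) (y : Equiv.Perm (Fin n)) :
    coef (y * w) h = coef y h := by
  rw [mem_eigen_iff] at hh
  induction w, hw using fixes_induction hb with
  | one => rw [mul_one]
  | mul i j hij hbij u _ _ ih => rw [← mul_assoc, hh i j hij hbij, ih]

/-- Removing descents inside the fibres shortens `w` and ends at the shortest representative of its
coset. -/
theorem exists_mul_increasing {b : Fin n → Fin n} (w : Equiv.Perm (Fin n)) :
    ∃ u, Fixes b u ∧ ∀ i j : Fin n, (i : ℕ) + 1 = j → b i = b j → (w * u) i < (w * u) j := by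
  induction hk : len w using Nat.strong_induction_on generalizing w with
  | _ k ih =>
    by_cases h : ∀ i j : Fin n, (i : ℕ) + 1 = j → b i = b j → w i < w j
    · exact ⟨1, Fixes.one b, by simpa using h⟩
    · push Not at h
      obtain ⟨i, j, hij, hb, h⟩ := h
      have h1 : w j < w i := lt_of_le_of_ne h fun h => by
        have := congrArg Fin.val (w.injective h)
        omega
      have h3 : len (w * Equiv.swap i j) < len w := by
        have := (lt_len_mul_swap (w * Equiv.swap i j) hij).2 (by simpa using h1)
        rwa [mul_assoc, Equiv.swap_mul_self, mul_one] at this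
      obtain ⟨u, hu, hu'⟩ := ih _ (hk ▸ h3) (w * Equiv.swap i j) rfl
      refine ⟨Equiv.swap i j * u, (fixes_swap hb).mul hu, ?_⟩
      rwa [← mul_assoc]

theorem eq_one_of_increasing {b : Fin n → Fin n} (hb : Monotone b) {d u : Equiv.Perm (Fin n)}
    (hd : ∀ i j : Fin n, (i : ℕ) + 1 = j → b i = b j → d i < d j) (hu : Fixes b u)
    (hdu : ∀ i j : Fin n, (i : ℕ) + 1 = j → b i = b j → (d * u) i < (d * u) j) : u = 1 := by
  by_contra h1
  obtain ⟨i, j, hij, hbij, h⟩ := hu.exists_descent hb h1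
  have h2 := fiber_chain hb hd h (by rw [hu i, hu j, hbij])
  exact (hdu i j hij hbij).not_gt h2

/-- Lengths add when `d` is shortest in its coset: since `d` increases along fibres, an ascent of
`u` inside a fibre is an ascent of `d * u`. -/
theorem T_mul_T_fixes {b : Fin n → Fin n} (hb : Monotone b) {d u : Equiv.Perm (Fin n)}
    (hd : ∀ i j : Fin n, (i : ℕ) + 1 = j → b i = b j → d i < d j) (hu : Fixes b u) :
    T d * T u = T (d * u) := by
  induction u, hu using fixes_induction hb with
  | one => rw [← one_def, mul_one, mul_one]
  | mul i j hij hbij u hu h ih =>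
    have hs : Equiv.swap i j ∈ simples n := ⟨i, j, hij, rfl⟩
    rw [T_mul_simple_of_lt hs ((lt_len_mul_swap u hij).2 h), ← mul_assoc, ih, ← mul_assoc,
      T_mul_simple_of_lt hs ((lt_len_mul_swap _ hij).2 _)]
    exact fiber_chain hb hd h (by rw [hu i, hu j, hbij])

/-- The eigenspace is the left ideal generated by `parSum b`. -/
theorem exists_mul_parSum {b : Fin n → Fin n} (hb : Monotone b) {h : Hecke n}
    (hh : h ∈ eigen b) : ∃ g : Hecke n, h = g * parSum b := by
  classical
  -- The shortest coset representatives. An eigenvector is constant on cosets, so its coefficients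
  -- on `D` determine it.
  let D : Finset (Equiv.Perm (Fin n)) := Finset.univ.filter fun d =>
    ∀ i j : Fin n, (i : ℕ) + 1 = j → b i = b j → d i < d j
  refine ⟨∑ d ∈ D, coef d h • T d, hecke_ext fun w => ?_⟩
  have hg := mul_mem_eigen (parSum_mem_eigen b) (∑ d ∈ D, coef d h • T d)
  obtain ⟨u, hu, hwu⟩ := exists_mul_increasing (b := b) w
  rw [← coef_mul_fixes hb hh hu, ← coef_mul_fixes hb hg hu, Finset.sum_mul, map_sum,
    Finset.sum_eq_single (w * u)]
  · rw [smul_mul_assoc, map_smul, parSum, Finset.mul_sum, map_sum, Finset.sum_eq_single 1]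
    · rw [← one_def, mul_one, coef_T, if_pos rfl, smul_eq_mul, mul_one]
    · intro x hx hx1
      rw [Finset.mem_filter] at hx
      rw [T_mul_T_fixes hb hwu hx.2, coef_T, if_neg]
      simpa using hx1
    · intro h1
      exact absurd (Finset.mem_filter.2 ⟨Finset.mem_univ _, Fixes.one b⟩) h1
  · intro d hd hne
    have hd' := (Finset.mem_filter.1 hd).2
    rw [smul_mul_assoc, map_smul, parSum, Finset.mul_sum, map_sum, Finset.sum_eq_zero, smul_zero]
    intro x hx
    have hx' := (Finset.mem_filter.1 hx).2
    rw [T_mul_T_fixes hb hd' hx', coef_T, if_neg]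
    intro he
    have := eq_one_of_increasing hb hd' hx' (by rwa [he])
    rw [this, mul_one] at he
    exact hne he
  · intro h1
    exact absurd (Finset.mem_filter.2 ⟨Finset.mem_univ _, hwu⟩) h1

/-- The eigenspace is spanned by a part of the Kazhdan–Lusztig basis. -/
theorem isKLSpanned_eigen (b : Fin n → Fin n) : IsKLSpanned (eigen b) := by
  classical
  intro h hh w hw
  by_contra hcon
  -- Discard the terms whose Kazhdan–Lusztig element already lies in the eigenspace. At a longest
  -- remaining `z` the coefficients at z and zs agree, which forces zs < z for every simple s of the
  -- subgroup; but then C_z is itself an eigenvector.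
  let a : Equiv.Perm (Fin n) → R := fun z => if nC z ∈ eigen b then 0 else coefC z h
  have ha : ∑ z, a z • nC z ∈ eigen b := by
    have : ∑ z, a z • nC z = h - ∑ z with nC z ∈ eigen b, coefC z h • nC z := by
      conv_rhs => rw [← sum_coefC h]
      rw [Finset.sum_filter, ← Finset.sum_sub_distrib]
      refine Finset.sum_congr rfl fun z _ => ?_
      simp only [a, coefC_sum]
      split_ifs <;> simp
    rw [this]
    refine Submodule.sub_mem _ hh (Submodule.sum_mem _ fun z hz => ?_)
    exact Submodule.smul_mem _ _ (Finset.mem_filter.1 hz).2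
  obtain ⟨z, hz, hmax⟩ := exists_max_len (p := fun z => a z ≠ 0) ⟨w, by simp [a, hcon, hw]⟩
  have hz' : nC z ∉ eigen b := fun h => hz (by simp [a, h])
  apply hz'
  intro i j hij hbij
  rw [mem_eigen_iff] at ha
  have h1 := ha i j hij hbij z
  have hs : Equiv.swap i j ∈ simples n := ⟨i, j, hij, rfl⟩
  have h2 : len (z * Equiv.swap i j) < len z := by
    by_contra h2
    have h3 := len_mul_simple hs z
    rw [coef_sum_nC hmax (by omega), coef_sum_nC hmax le_rfl] at h1
    have h4 : a (z * Equiv.swap i j) = 0 := by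
      by_contra h4
      have := hmax _ h4
      omega
    rw [h4, zero_mul, eq_comm, mul_eq_zero] at h1
    exact h1.elim hz (qhalf_ne_zero _)
  rw [nC, smul_mul_assoc, C_mul_T_simple hs h2, smul_comm]

/-! ### The longest element of a parabolic subgroup -/

/-- By maximality `v` reverses the order of every fibre. If `y` did so too, a descent of `v⁻¹ * y`
would be contradictory, whence y = v. -/
theorem exists_ascent {b : Fin n → Fin n} (hb : Monotone b) {v y : Equiv.Perm (Fin n)}
    (hv : Fixes b v) (hmax : ∀ u, Fixes b u → len u ≤ len v) (hy : Fixes b y) (hne : y ≠ v) :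
    ∃ i j : Fin n, (i : ℕ) + 1 = j ∧ b i = b j ∧ y i < y j := by
  by_contra! hcon
  have hlt : ∀ i j : Fin n, (i : ℕ) + 1 = j → b i = b j → y j < y i := fun i j hij h =>
    lt_of_le_of_ne (hcon i j hij h) fun e => by
      have := congrArg Fin.val (y.injective e)
      omega
  have hvlt : ∀ i j : Fin n, (i : ℕ) + 1 = j → b i = b j →
      (OrderDual.toDual (v i) : (Fin n)ᵒᵈ) < OrderDual.toDual (v j) := by
    intro i j hij h
    rw [OrderDual.toDual_lt_toDual]
    by_contra h1
    have h2 : v i < v j := lt_of_le_of_ne (not_lt.1 h1) fun e => by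
      have := congrArg Fin.val (v.injective e)
      omega
    have := hmax _ (hv.mul (fixes_swap h))
    have := (lt_len_mul_swap v hij).2 h2
    omega
  have hw : Fixes b (v⁻¹ * y) := hv.inv.mul hy
  obtain ⟨i, j, hij, hbij, h⟩ := hw.exists_descent hb fun e => hne (by
    rw [inv_mul_eq_one] at e
    exact e.symm)
  have h2 := fiber_chain hb hvlt h (by rw [hw i, hw j, hbij])
  rw [OrderDual.toDual_lt_toDual] at h2
  simp only [← Equiv.Perm.mul_apply, mul_inv_cancel_left] at h2
  exact (hlt i j hij hbij).not_gt h2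

theorem bruhatLE_of_fixes {b : Fin n → Fin n} (hb : Monotone b) {v y : Equiv.Perm (Fin n)}
    (hv : Fixes b v) (hmax : ∀ u, Fixes b u → len u ≤ len v) (hy : Fixes b y) :
    BruhatLE y v := by
  induction hk : len v - len y using Nat.strong_induction_on generalizing y with
  | _ k ih =>
    by_cases hne : y = v
    · rw [hne]
      exact Relation.ReflTransGen.refl
    · obtain ⟨i, j, hij, hbij, h⟩ := exists_ascent hb hv hmax hy hne
      have h1 := (lt_len_mul_swap y hij).2 h
      have h2 : Fixes b (y * Equiv.swap i j) := hy.mul (fixes_swap hbij)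
      have h3 := hmax _ h2
      exact (bruhat_mul_simple ⟨i, j, hij, rfl⟩ h1).trans (ih _ (by omega) h2 rfl)

theorem coef_bar_T_fixes {b : Fin n → Fin n} (hb : Monotone b) {w : Equiv.Perm (Fin n)}
    (hw : Fixes b w) {y : Equiv.Perm (Fin n)} (hy : ¬ Fixes b y) : coef y (bar (T w)) = 0 := by
  induction w, hw using fixes_induction hb generalizing y with
  | one =>
    rw [← one_def, bar_one, one_def, coef_T, if_neg]
    rintro rfl
    exact hy (Fixes.one b)
  | mul i j hij hbij u hu h ih =>
    have hs : Equiv.swap i j ∈ simples n := ⟨i, j, hij, rfl⟩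
    have h1 : coef (y * Equiv.swap i j) (bar (T u)) = 0 :=
      ih (by rwa [fixes_mul_swap_iff hbij])
    rw [T_mul_simple_of_lt hs ((lt_len_mul_swap u hij).2 h), bar_mul, bar_T_simple hs,
      mul_smul_comm, map_smul, mul_sub, map_sub, mul_smul_comm, mul_one, map_smul, ih hy,
      coef_mul_T_simple hs, h1, ih hy]
    simp

/-- Apply `bar` to x T_s = q x and multiply by T_s on the right: the eigenvalue returns to q. -/
theorem bar_parSum_mem_eigen (b : Fin n → Fin n) : bar (parSum b) ∈ eigen b := by
  intro i j hij hbij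
  have hs : Equiv.swap i j ∈ simples n := ⟨i, j, hij, rfl⟩
  have h1 := congrArg bar (parSum_mem_eigen b i j hij hbij)
  rw [bar_mul, bar_smul, invert_q] at h1
  have h2 := congrArg (fun x => q • (x * T (Equiv.swap i j))) h1
  simp only [mul_assoc, bar_T_simple_mul_T_simple hs, mul_one, smul_mul_assoc, smul_smul] at h2
  rw [h2, q, qhalf_mul]
  simp [qhalf_zero]

/-- The Kazhdan–Lusztig element of the longest element of a parabolic subgroup. -/
theorem parSum_eq_C {b : Fin n → Fin n} (hb : Monotone b) {v : Equiv.Perm (Fin n)}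
    (hv : Fixes b v) (hmax : ∀ u, Fixes b u → len u ≤ len v) : parSum b = C v := by
  classical
  refine KLPoly.eq_C (P := fun y => if Fixes b y then 1 else 0) ⟨?_, ?_, ?_, ?_, ?_⟩
  · simp [hv]
  · intro y i hne hi
    split_ifs at hi with hy
    · have h1 := (bruhatLE_of_fixes hb hv hmax hy).len_lt hne
      rw [Polynomial.coeff_one] at hi
      split_ifs at hi with h2
      · omega
      · exact absurd rfl hi
    · simp at hi
  · intro y hy
    split_ifs at hy with h1
    · exact bruhatLE_of_fixes hb hv hmax h1
    · exact absurd rfl hy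
  · intro y
    rw [coef_parSum]
    split_ifs <;> simp
  -- `bar (parSum b)` is an eigenvector supported on the subgroup, hence a multiple of `parSum b`;
  -- the factor is read off at `v`.
  · have h1 : coef v (bar (parSum b)) = qhalf (-2 * (len v : ℤ)) := by
      rw [parSum, bar_sum, map_sum, Finset.sum_eq_single v]
      · rw [coef_bar_T le_rfl, if_pos rfl]
      · intro y hy hne
        rw [coef_bar_T (hmax y (Finset.mem_filter.1 hy).2), if_neg hne]
      · intro h
        exact absurd (Finset.mem_filter.2 ⟨Finset.mem_univ v, hv⟩) h
    refine hecke_ext fun y => ?_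
    rw [map_smul, coef_parSum, smul_eq_mul]
    split_ifs with hy
    · rw [← h1, mul_one, ← coef_mul_fixes hb (bar_parSum_mem_eigen b) (hv.inv.mul hy) v]
      simp
    · rw [parSum, bar_sum, map_sum, mul_zero]
      exact Finset.sum_eq_zero fun w hw => coef_bar_T_fixes hb (Finset.mem_filter.1 hw).2 hy

theorem exists_longest (b : Fin n → Fin n) :
    ∃ v, Fixes b v ∧ ∀ u, Fixes b u → len u ≤ len v := exists_max_len ⟨1, Fixes.one b⟩

/-! ## Row and column fillings -/

/-- The sizes of the fibres. -/
def fib (b : Fin n → Fin n) (i : Fin n) : ℕ := (Finset.univ.filter fun x => b x = i).card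

/-- The number of fibres with more than `j` elements; as a function of `j`, this is the partition
conjugate to the one formed by the sizes of the fibres. -/
def ptype (b : Fin n → Fin n) (j : Fin n) : ℕ :=
  (Finset.univ.filter fun i => (j : ℕ) < fib b i).card

/-- The length of the longest element that preserves the fibres. -/
def aval (b : Fin n → Fin n) : ℕ := ∑ i, ∑ j ∈ Finset.range (fib b i), j

/-- `x ↦ (c x, b (w x))` is injective. -/
def Transversal (b c : Fin n → Fin n) (w : Equiv.Perm (Fin n)) : Prop :=
  ∀ x y, c x = c y → b (w x) = b (w y) → x = y

/-- The maximum `m` of a set is at least the number of the remaining elements, with equality only if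
nothing is skipped. Applied to the column labels in one row, equality means that the row occupies
the first columns. -/
theorem sum_range_card_le (s : Finset ℕ) : ∑ j ∈ Finset.range s.card, j ≤ ∑ j ∈ s, j ∧
    (∑ j ∈ Finset.range s.card, j = ∑ j ∈ s, j → s = Finset.range s.card) := by
  induction s using Finset.induction_on_max with
  | empty => simp
  | insert m s hm ih =>
    have hms : m ∉ s := fun h => (hm m h).false
    have h1 : s.card ≤ m := by
      have : s ⊆ Finset.range m := fun x hx => Finset.mem_range.2 (hm x hx)
      simpa using Finset.card_le_card this
    rw [Finset.card_insert_of_notMem hms, Finset.sum_range_succ, Finset.sum_insert hms]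
    refine ⟨by omega, fun h => ?_⟩
    have h2 : s.card = m := by omega
    have h3 := ih.2 (by omega)
    rw [Finset.range_add_one, ← h3, h2]

theorem card_fiber_comp (b : Fin n → Fin n) (w : Equiv.Perm (Fin n)) (i : Fin n) :
    (Finset.univ.filter fun x => b (w x) = i).card = fib b i := by
  rw [fib]
  refine Finset.card_bij' (fun x _ => w x) (fun x _ => w⁻¹ x) ?_ ?_ ?_ ?_ <;> simp

theorem fib_comp (b : Fin n → Fin n) (w : Equiv.Perm (Fin n)) : fib (b ∘ w) = fib b :=
  funext fun i => card_fiber_comp b w i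

theorem Transversal.injOn {b c : Fin n → Fin n} {w : Equiv.Perm (Fin n)}
    (h : Transversal b c w) (i : Fin n) :
    Set.InjOn (fun x => (c x : ℕ)) (Finset.univ.filter fun x => b (w x) = i : Finset (Fin n)) := by
  intro x hx y hy hxy
  simp only [Finset.coe_filter, Finset.mem_univ, true_and, Set.mem_ofPred_eq] at hx hy
  exact h x y (Fin.ext hxy) (hx.trans hy.symm)

theorem Transversal.row_sum_le {b c : Fin n → Fin n} {w : Equiv.Perm (Fin n)}
    (h : Transversal b c w) (i : Fin n) : ∑ j ∈ Finset.range (fib b i), j ≤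
      ∑ x with b (w x) = i, (c x : ℕ) := by
  have h1 := (sum_range_card_le ((Finset.univ.filter fun x => b (w x) = i).image
    fun x => (c x : ℕ))).1
  rwa [Finset.card_image_of_injOn (h.injOn i), Finset.sum_image (h.injOn i),
    card_fiber_comp] at h1

theorem sum_rows (b c : Fin n → Fin n) (w : Equiv.Perm (Fin n)) :
    ∑ i, ∑ x with b (w x) = i, (c x : ℕ) = ∑ x, (c x : ℕ) :=
  Finset.sum_fiberwise _ _ _

/-- The column labels within a row are distinct, so they sum to at least 0 + 1 + ... . This single
inequality takes the place of the dominance order on partitions. -/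
theorem Transversal.aval_le {b c : Fin n → Fin n} {w : Equiv.Perm (Fin n)}
    (h : Transversal b c w) : aval b ≤ ∑ x, (c x : ℕ) := by
  rw [← sum_rows b c w]
  exact Finset.sum_le_sum fun i _ => h.row_sum_le i

/-- Equality of the totals forces equality in every row, so each row is an initial segment of
columns and the occupied cells form a left-justified diagram. -/
theorem Transversal.exists_iff {b c : Fin n → Fin n} {w : Equiv.Perm (Fin n)}
    (h : Transversal b c w) (he : aval b = ∑ x, (c x : ℕ)) (i j : Fin n) :
    (∃ x, c x = j ∧ b (w x) = i) ↔ (j : ℕ) < fib b i := by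
  rw [← sum_rows b c w, aval, Finset.sum_eq_sum_iff_of_le fun i _ => h.row_sum_le i] at he
  have h1 := he i (Finset.mem_univ i)
  have h2 := (sum_range_card_le ((Finset.univ.filter fun x => b (w x) = i).image
    fun x => (c x : ℕ))).2
  rw [Finset.card_image_of_injOn (h.injOn i), Finset.sum_image (h.injOn i),
    card_fiber_comp] at h2
  have h3 := congrArg (fun s => (j : ℕ) ∈ s) (h2 h1)
  simp only [Finset.mem_image, Finset.mem_filter, Finset.mem_univ, true_and, Finset.mem_range,
    eq_iff_iff] at h3
  rw [← h3]
  exact exists_congr fun x => by rw [Fin.ext_iff, and_comm]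

theorem Transversal.card_column {b c : Fin n → Fin n} {w : Equiv.Perm (Fin n)}
    (h : Transversal b c w) (he : aval b = ∑ x, (c x : ℕ)) (j : Fin n) : fib c j = ptype b j := by
  refine Finset.card_bij (fun x _ => b (w x)) ?_ ?_ ?_
  · intro x hx
    simp only [Finset.mem_filter, Finset.mem_univ, true_and] at hx ⊢
    exact (h.exists_iff he _ _).1 ⟨x, hx, rfl⟩
  · intro x hx y hy hxy
    simp only [Finset.mem_filter, Finset.mem_univ, true_and] at hx hy
    exact h x y (hx.trans hy.symm) hxy
  · intro i hi
    simp only [Finset.mem_filter, Finset.mem_univ, true_and] at hi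
    obtain ⟨x, hx, hx'⟩ := (h.exists_iff he _ _).2 hi
    exact ⟨x, by simpa using hx, hx'⟩

/-- The position of `x` in its fibre. -/
def rank (b : Fin n → Fin n) (x : Fin n) : Fin n :=
  ⟨(Finset.univ.filter fun y => y < x ∧ b y = b x).card, by
    have : (Finset.univ.filter fun y => y < x ∧ b y = b x) ⊆ Finset.univ.erase x := by
      intro y hy
      simp only [Finset.mem_filter, Finset.mem_univ, true_and] at hy
      exact Finset.mem_erase.2 ⟨hy.1.ne, Finset.mem_univ y⟩
    have h1 := Finset.card_le_card this
    rw [Finset.card_erase_of_mem (Finset.mem_univ x), Finset.card_univ, Fintype.card_fin] at h1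
    have := x.isLt
    omega⟩

theorem rank_val (b : Fin n → Fin n) (x : Fin n) :
    (rank b x : ℕ) = (Finset.univ.filter fun y => y < x ∧ b y = b x).card := rfl

theorem rank_lt {b : Fin n → Fin n} {x y : Fin n} (h : x < y) (hb : b x = b y) :
    rank b x < rank b y := by
  rw [Fin.lt_def, rank_val, rank_val]
  refine Finset.card_lt_card ((Finset.ssubset_iff_of_subset ?_).2 ⟨x, ?_, ?_⟩)
  · intro z hz
    simp only [Finset.mem_filter, Finset.mem_univ, true_and] at hz ⊢
    exact ⟨hz.1.trans h, hz.2.trans hb⟩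
  · simpa using ⟨h, hb⟩
  · simp

theorem rank_transversal (b : Fin n → Fin n) : Transversal b (rank b) 1 := by
  intro x y h hb
  rcases lt_trichotomy x y with h1 | h1 | h1
  · exact absurd h (rank_lt h1 hb).ne
  · exact h1
  · exact absurd h.symm (rank_lt h1 hb.symm).ne

theorem rank_lt_fib (b : Fin n → Fin n) (x : Fin n) : (rank b x : ℕ) < fib b (b x) := by
  rw [rank_val, fib]
  refine Finset.card_lt_card ((Finset.ssubset_iff_of_subset ?_).2 ⟨x, ?_, ?_⟩)
  · intro z hz
    simp only [Finset.mem_filter, Finset.mem_univ, true_and] at hz ⊢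
    exact hz.2
  · simp
  · simp

theorem sum_rank (b : Fin n → Fin n) : ∑ x, (rank b x : ℕ) = aval b := by
  rw [← sum_rows b (rank b) 1, aval]
  refine Finset.sum_congr rfl fun i _ => ?_
  have h1 := (rank_transversal b).injOn i
  have h2 : (Finset.univ.filter fun x => b ((1 : Equiv.Perm (Fin n)) x) = i).image
      (fun x => (rank b x : ℕ)) = Finset.range (fib b i) := by
    refine Finset.eq_of_subset_of_card_le ?_ ?_
    · intro j hj
      obtain ⟨x, hx, rfl⟩ := Finset.mem_image.1 hj
      rw [← (Finset.mem_filter.1 hx).2]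
      exact Finset.mem_range.2 (rank_lt_fib b x)
    · rw [Finset.card_range, Finset.card_image_of_injOn h1, card_fiber_comp]
  rw [← h2, Finset.sum_image h1]

/-- The column filling that goes with the row filling `b`. -/
def col (b : Fin n → Fin n) : Fin n → Fin n := rank b ∘ Tuple.sort (rank b)

theorem col_monotone (b : Fin n → Fin n) : Monotone (col b) := Tuple.monotone_sort _

theorem col_transversal (b : Fin n → Fin n) : Transversal b (col b) (Tuple.sort (rank b)) := by
  intro x y h hb
  exact (Tuple.sort (rank b)).injective (rank_transversal b _ _ h hb)

theorem sum_col (b : Fin n → Fin n) : ∑ x, (col b x : ℕ) = aval b := by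
  rw [← sum_rank b]
  exact Equiv.sum_comp (Tuple.sort (rank b)) fun x => (rank b x : ℕ)

theorem fib_col (b : Fin n → Fin n) : fib (col b) = ptype b :=
  funext fun j => (col_transversal b).card_column (sum_col b).symm j

/-- Equality would make the column sizes `ptype b'` of `col b'` equal to `ptype b`. So for two
fillings of different types, transversals cannot exist in both directions. -/
theorem Transversal.aval_lt {b b' : Fin n → Fin n} {w : Equiv.Perm (Fin n)}
    (h : Transversal b (col b') w) (hne : ptype b ≠ ptype b') : aval b < aval b' := by
  have h1 := h.aval_le
  rw [sum_col] at h1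
  refine lt_of_le_of_ne h1 fun he => hne ?_
  rw [← fib_col b', ← funext fun j => h.card_column (by rw [he, sum_col]) j]

/-! ### Existence of fillings for all partitions -/

theorem sum_ite_get (l : List ℕ) (p : ℕ → Bool) :
    ∑ i : Fin l.length, (if p (l.get i) then 1 else 0) = l.countP p := by
  induction l with
  | nil => simp
  | cons a l ih =>
    rw [List.countP_cons, ← ih, add_comm]
    exact Fin.sum_univ_succ _

/-- Enumerate the cells of a diagram with row lengths `l`, label each cell by its row, and sort the
labels; sorting preserves the fibre sizes. -/
theorem exists_filling (l : List ℕ) (hl : l.sum = n) (hpos : ∀ k ∈ l, 0 < k) :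
    ∃ b : Fin n → Fin n, Monotone b ∧ ∀ j : Fin n, ptype b j = l.countP fun k => (j : ℕ) < k := by
  have hlen : l.length ≤ n := by
    rw [← hl]
    exact List.length_le_sum_of_one_le l hpos
  have hcard : Fintype.card (Fin n) = Fintype.card (Σ i : Fin l.length, Fin (l.get i)) := by
    simp [← hl]
  let e := Fintype.equivOfCardEq hcard
  let f : Fin n → Fin n := fun x => Fin.castLE hlen (e x).1
  refine ⟨f ∘ Tuple.sort f, Tuple.monotone_sort f, fun j => ?_⟩
  have hfib : ∀ i : Fin l.length, fib f (Fin.castLE hlen i) = l.get i := by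
    intro i
    rw [fib, ← Fintype.card_fin (l.get i), ← Finset.card_univ]
    refine (Finset.card_bij (fun x _ => e.symm ⟨i, x⟩) ?_ ?_ ?_).symm
    · intro x _
      simp [f]
    · intro x _ y _ h
      simpa using h
    · intro y hy
      simp only [f, Finset.mem_filter, Finset.mem_univ, true_and, Fin.castLE_inj] at hy
      subst hy
      exact ⟨(e y).2, Finset.mem_univ _, by simp⟩
  have hfib0 : ∀ i : Fin n, (j : ℕ) < fib f i → ∃ k : Fin l.length, Fin.castLE hlen k = i := by
    intro i hi
    obtain ⟨x, hx⟩ := Finset.card_pos.1 (Nat.zero_lt_of_lt hi)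
    exact ⟨(e x).1, (Finset.mem_filter.1 hx).2⟩
  rw [ptype, fib_comp, ← sum_ite_get, ← Finset.sum_filter, ← Finset.card_eq_sum_ones]
  refine (Finset.card_bij (fun i _ => Fin.castLE hlen i) ?_ ?_ ?_).symm
  · intro i hi
    simpa [hfib] using hi
  · intro i _ k _ h
    exact (Fin.castLE_inj).1 h
  · intro i hi
    rw [Finset.mem_filter] at hi
    obtain ⟨k, rfl⟩ := hfib0 i hi.2
    refine ⟨k, ?_, rfl⟩
    simpa [hfib] using hi

theorem countP_succ (s : Multiset ℕ) (k : ℕ) :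
    s.countP (fun x => k < x) = s.countP (fun x => k + 1 < x) + s.count (k + 1) := by
  induction s using Multiset.induction_on with
  | empty => simp
  | cons a s ih =>
    rw [Multiset.countP_cons, Multiset.countP_cons, Multiset.count_cons, ih]
    split_ifs <;> omega

/-- A partition is recovered from its conjugate by taking differences of successive columns, and
conjugacy classes correspond to cycle types. -/
theorem isConj_of_ptype {g h : Equiv.Perm (Fin n)} {b b' : Fin n → Fin n}
    (hb : ∀ j : Fin n, ptype b j = g.partition.parts.countP fun k => (j : ℕ) < k)
    (hb' : ∀ j : Fin n, ptype b' j = h.partition.parts.countP fun k => (j : ℕ) < k)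
    (he : ptype b = ptype b') : IsConj g h := by
  have key : ∀ j : ℕ, g.partition.parts.countP (fun k => j < k) =
      h.partition.parts.countP fun k => j < k := by
    intro j
    by_cases hj : j < n
    · have := hb ⟨j, hj⟩
      rw [he, hb'] at this
      exact this.symm
    · have hz : ∀ p : (Fintype.card (Fin n)).Partition, p.parts.countP (fun k => j < k) = 0 := by
        intro p
        rw [Multiset.countP_eq_zero]
        intro k hk hjk
        have := Multiset.le_sum_of_mem hk
        rw [p.parts_sum, Fintype.card_fin] at this
        omega
      rw [hz, hz]
  rw [Equiv.Perm.partition_eq_of_isConj]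
  refine Nat.Partition.ext (Multiset.ext.2 fun k => ?_)
  cases k with
  | zero =>
    have hz : ∀ p : (Fintype.card (Fin n)).Partition, p.parts.count 0 = 0 := fun p =>
      Multiset.count_eq_zero.2 fun h => (p.parts_pos h).false
    rw [hz, hz]
  | succ k =>
    have h1 := countP_succ g.partition.parts k
    have h2 := countP_succ h.partition.parts k
    have h3 := key k
    have h4 := key (k + 1)
    omega

/-- There are at least as many types of fillings as conjugacy classes. -/
theorem card_conjClasses_le : Nat.card (ConjClasses (Equiv.Perm (Fin n))) ≤
    Nat.card (Set.range fun b : {b : Fin n → Fin n // Monotone b} => ptype b.1) := by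
  have h : ∀ g : Equiv.Perm (Fin n), ∃ b : Fin n → Fin n, Monotone b ∧
      ∀ j : Fin n, ptype b j = g.partition.parts.countP fun k => (j : ℕ) < k := by
    intro g
    obtain ⟨b, hb, h⟩ := exists_filling (n := n) g.partition.parts.toList (by
      rw [Multiset.sum_toList, g.partition.parts_sum, Fintype.card_fin])
      fun k hk => g.partition.parts_pos (Multiset.mem_toList.1 hk)
    refine ⟨b, hb, fun j => ?_⟩
    rw [h, ← Multiset.coe_countP, Multiset.coe_toList]
  choose b hb hb' using h
  refine Nat.card_le_card_of_injective
    (fun x => ⟨ptype (b (Quotient.out x)), ⟨⟨_, hb _⟩, rfl⟩⟩) fun x y hxy => ?_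
  have h1 := isConj_of_ptype (hb' _) (hb' _) (congrArg Subtype.val hxy)
  rw [← Quotient.out_eq x, ← Quotient.out_eq y]
  exact Quotient.sound h1

/-! ## Sign elements -/

/-- The element that affords the sign character of the parabolic subgroup of `c`. -/
def sgnSum (c : Fin n → Fin n) : Hecke n := by
  classical
  exact ∑ w with Fixes c w, ((-1) ^ len w * qhalf (-2 * (len w : ℤ))) • T w

open scoped Classical in
theorem coef_sgnSum (c : Fin n → Fin n) (w : Equiv.Perm (Fin n)) :
    coef w (sgnSum c) = if Fixes c w then (-1) ^ len w * qhalf (-2 * (len w : ℤ)) else 0 := by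
  rw [sgnSum, map_sum]
  simp only [map_smul, coef_T, smul_eq_mul, mul_ite, mul_one, mul_zero]
  rw [Finset.sum_ite_eq']
  simp

theorem coef_sgnSum_mul_simple (c : Fin n → Fin n) {i j : Fin n} (hij : (i : ℕ) + 1 = j)
    (hc : c i = c j) {w : Equiv.Perm (Fin n)} (h : len w < len (w * Equiv.swap i j)) :
    coef w (sgnSum c) = -(q * coef (w * Equiv.swap i j) (sgnSum c)) := by
  have h1 := len_mul_simple ⟨i, j, hij, rfl⟩ w
  have h2 : len (w * Equiv.swap i j) = len w + 1 := by omega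
  rw [coef_sgnSum, coef_sgnSum, fixes_mul_swap_iff hc, h2]
  split_ifs
  · have h3 : qhalf (-2 * (len w : ℤ)) = q * qhalf (-2 * ((len w + 1 : ℕ) : ℤ)) := by
      rw [q, qhalf_mul]
      congr 1
      push_cast
      ring
    rw [h3]
    ring
  · simp

theorem sgnSum_mul_T (c : Fin n → Fin n) {i j : Fin n} (hij : (i : ℕ) + 1 = j)
    (hc : c i = c j) : sgnSum c * T (Equiv.swap i j) = -sgnSum c := by
  have hs : Equiv.swap i j ∈ simples n := ⟨i, j, hij, rfl⟩
  refine hecke_ext fun w => ?_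
  rw [coef_mul_T_simple hs, map_neg]
  split_ifs with h
  · rw [coef_sgnSum_mul_simple c hij hc h]
    ring
  · have h1 := len_mul_simple hs w
    have h2 := coef_sgnSum_mul_simple c hij hc (w := w * Equiv.swap i j) (by
      rw [mul_simple_mul_simple hs]
      omega)
    rw [mul_simple_mul_simple hs] at h2
    rw [h2]
    ring

theorem star_sgnSum (c : Fin n → Fin n) : star (sgnSum c) = sgnSum c := by
  refine hecke_ext fun w => ?_
  have : Fixes c w⁻¹ ↔ Fixes c w := ⟨fun h => by simpa using h.inv, Fixes.inv⟩
  rw [coef_star, coef_sgnSum, coef_sgnSum, len_inv, this]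

theorem T_mul_sgnSum (c : Fin n → Fin n) {i j : Fin n} (hij : (i : ℕ) + 1 = j)
    (hc : c i = c j) : T (Equiv.swap i j) * sgnSum c = -sgnSum c := by
  have := congrArg star (sgnSum_mul_T c hij hc)
  rwa [star_mul, map_neg, star_sgnSum, star_T, Equiv.swap_inv] at this

theorem star_parSum (b : Fin n → Fin n) : star (parSum b) = parSum b := by
  refine hecke_ext fun w => ?_
  have : Fixes b w⁻¹ ↔ Fixes b w := ⟨fun h => by simpa using h.inv, Fixes.inv⟩
  rw [coef_star, coef_parSum, coef_parSum, this]

/-! ### Double cosets and the products x_b H y_c -/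

/-- `d` is the shortest element of its double coset for the parabolic subgroups of `b` and `c`. -/
def IsShortest (b c : Fin n → Fin n) (d : Equiv.Perm (Fin n)) : Prop :=
  (∀ i j : Fin n, (i : ℕ) + 1 = j → c i = c j → d i < d j) ∧
    ∀ i j : Fin n, (i : ℕ) + 1 = j → b i = b j → d⁻¹ i < d⁻¹ j

/-- A right descent inside a fibre of `c` is absorbed by `sgnSum c` with factor -1, a left descent
inside a fibre of `b` by `parSum b` with factor q. -/
theorem exists_isShortest (b c : Fin n → Fin n) (w : Equiv.Perm (Fin n)) :
    ∃ d, IsShortest b c d ∧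
      ∃ r : R, parSum b * T w * sgnSum c = r • (parSum b * T d * sgnSum c) := by
  induction hk : len w using Nat.strong_induction_on generalizing w with
  | _ k ih =>
    subst hk
    by_cases h1 : ∃ i j : Fin n, (i : ℕ) + 1 = j ∧ c i = c j ∧ ¬ w i < w j
    · obtain ⟨i, j, hij, hc, h⟩ := h1
      have hs : Equiv.swap i j ∈ simples n := ⟨i, j, hij, rfl⟩
      rw [← lt_len_mul_swap w hij] at h
      have h2 := len_mul_simple hs w
      have h3 : len (w * Equiv.swap i j) < len (w * Equiv.swap i j * Equiv.swap i j) := by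
        rw [mul_simple_mul_simple hs]
        omega
      have h4 := T_mul_simple_of_lt hs h3
      rw [mul_simple_mul_simple hs] at h3 h4
      obtain ⟨d, hd, r, hr⟩ := ih _ h3 _ rfl
      refine ⟨d, hd, -r, ?_⟩
      rw [h4, mul_assoc, mul_assoc (T _), T_mul_sgnSum c hij hc, mul_neg, mul_neg, ← mul_assoc, hr,
        neg_smul]
    · by_cases h2 : ∃ i j : Fin n, (i : ℕ) + 1 = j ∧ b i = b j ∧ ¬ w⁻¹ i < w⁻¹ j
      · obtain ⟨i, j, hij, hb, h⟩ := h2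
        have hs : Equiv.swap i j ∈ simples n := ⟨i, j, hij, rfl⟩
        rw [← lt_len_swap_mul w hij] at h
        have h2 := len_simple_mul hs w
        have h3 : len (Equiv.swap i j * w) < len (Equiv.swap i j * (Equiv.swap i j * w)) := by
          rw [simple_mul_simple_mul hs]
          omega
        have h4 := T_simple_mul_of_lt hs h3
        rw [simple_mul_simple_mul hs] at h3 h4
        obtain ⟨d, hd, r, hr⟩ := ih _ h3 _ rfl
        refine ⟨d, hd, q * r, ?_⟩
        rw [h4, ← mul_assoc, parSum_mem_eigen b i j hij hb, smul_mul_assoc, smul_mul_assoc, hr,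
          smul_smul]
      · push Not at h1 h2
        exact ⟨w, ⟨h1, h2⟩, 1, (one_smul _ _).symm⟩

/-- The specialization at `q^{1/2} = 1`. -/
def evalOne : R →+* ℚ := LaurentPolynomial.eval₂ (Int.castRingHom ℚ) 1

theorem evalOne_qhalf (k : ℤ) : evalOne (qhalf k) = 1 := by
  simp [evalOne, qhalf]

theorem q_add_one_ne_zero : q + 1 ≠ 0 := by
  intro h
  have := congrArg evalOne h
  rw [map_add, map_one, map_zero, q, evalOne_qhalf] at this
  norm_num at this

theorem smul_eq_zero_of_ne {r : R} (hr : r ≠ 0) {h : Hecke n} (e : r • h = 0) : h = 0 := by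
  refine hecke_ext fun w => ?_
  have := congrArg (coef w) e
  rw [map_smul, map_zero, smul_eq_mul] at this
  rw [map_zero]
  exact (mul_eq_zero.1 this).resolve_left hr

/-- Suppose x < y violate transversality. Monotonicity of `d` and `d⁻¹` along fibres squeezes d(x+1)
= d(x)+1, so `d` intertwines a simple reflection s' of the `c`-subgroup with one s of the
`b`-subgroup. From T_s T_d = T_d T_{s'} the product π satisfies qπ = -π, hence π = 0. -/
theorem IsShortest.transversal {b c : Fin n → Fin n} (hb : Monotone b) (hc : Monotone c)
    {d : Equiv.Perm (Fin n)} (hd : IsShortest b c d) (h : parSum b * T d * sgnSum c ≠ 0) :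
    Transversal b c d := by
  have key : ∀ x y, x < y → c x = c y → b (d x) ≠ b (d y) := by
    intro x y hxy hcxy hbxy
    apply h
    have h1 : d x < d y := fiber_chain hc hd.1 hxy hcxy
    obtain ⟨k, hk⟩ : ∃ k : Fin n, (d x : ℕ) + 1 = k := ⟨⟨d x + 1, by omega⟩, rfl⟩
    obtain ⟨x', hx'⟩ : ∃ x' : Fin n, (x : ℕ) + 1 = x' := ⟨⟨x + 1, by omega⟩, rfl⟩
    have h2 : d x < k := by rw [Fin.lt_def]; omega
    have h3 : k ≤ d y := by rw [Fin.lt_def] at h1; rw [Fin.le_def]; omega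
    have hbk : b (d x) = b k := le_antisymm (hb h2.le) ((hb h3).trans hbxy.ge)
    have h4 : x < d⁻¹ k := by simpa using fiber_chain hb hd.2 h2 hbk
    have h5 : d⁻¹ k ≤ y := by
      rcases h3.lt_or_eq with h3 | h3
      · simpa using (fiber_chain hb hd.2 h3 (hbk.symm.trans hbxy)).le
      · simp [h3]
    have h6 : x < x' := by rw [Fin.lt_def]; omega
    have h7 : x' ≤ d⁻¹ k := by rw [Fin.lt_def] at h4; rw [Fin.le_def]; omega
    have hcx : c x = c x' := le_antisymm (hc h6.le) ((hc (h7.trans h5)).trans hcxy.ge)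
    have hck : c x = c (d⁻¹ k) := le_antisymm (hc h4.le) ((hc h5).trans hcxy.ge)
    have h8 : d x < d x' := hd.1 x x' hx' hcx
    have h9 : d x' ≤ k := by
      rcases h7.lt_or_eq with h7 | h7
      · simpa using (fiber_chain hc hd.1 h7 (hcx.symm.trans hck)).le
      · simp [h7]
    have h10 : k = d x' := by
      rw [Fin.lt_def] at h8
      rw [Fin.le_def] at h9
      exact Fin.ext (by omega)
    subst h10
    have hs : Equiv.swap (d x) (d x') ∈ simples n := ⟨_, _, hk, rfl⟩
    have hs' : Equiv.swap x x' ∈ simples n := ⟨_, _, hx', rfl⟩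
    have e : d * Equiv.swap x x' = Equiv.swap (d x) (d x') * d := Equiv.mul_swap_eq_swap_mul _ _ _
    have e1 := T_mul_simple_of_lt hs' ((lt_len_mul_swap d hx').2 h8)
    have e2 := T_simple_mul_of_lt hs (w := d) (by rw [← e]; exact (lt_len_mul_swap d hx').2 h8)
    have e3 : parSum b * (T (Equiv.swap (d x) (d x')) * T d) * sgnSum c =
        parSum b * (T d * T (Equiv.swap x x')) * sgnSum c := by rw [← e1, ← e2, e]
    rw [← mul_assoc, parSum_mem_eigen b _ _ hk hbk, mul_assoc _ (T d * _), mul_assoc (T d) (T _),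
      T_mul_sgnSum c hx' hcx, mul_neg, mul_neg, smul_mul_assoc, smul_mul_assoc,
      ← mul_assoc (parSum b)] at e3
    refine smul_eq_zero_of_ne q_add_one_ne_zero ?_
    rw [add_smul, one_smul, e3, neg_add_cancel]
  intro x y hcxy hbxy
  rcases lt_trichotomy x y with h1 | h1 | h1
  · exact absurd hbxy (key x y h1 hcxy)
  · exact h1
  · exact absurd hbxy.symm (key y x h1 hcxy.symm)

theorem parSum_mul_mul_sgnSum_eq_zero {b c : Fin n → Fin n} (hb : Monotone b) (hc : Monotone c)
    (h : ∀ w, ¬ Transversal b c w) (a : Hecke n) : parSum b * a * sgnSum c = 0 := by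
  induction a using hecke_induction with
  | zero => simp
  | add x y hx hy => rw [mul_add, add_mul, hx, hy, add_zero]
  | smul r w =>
    obtain ⟨d, hd, r', hr'⟩ := exists_isShortest b c w
    rw [mul_smul_comm, smul_mul_assoc, hr']
    by_cases h0 : parSum b * T d * sgnSum c = 0
    · rw [h0, smul_zero, smul_zero]
    · exact absurd (hd.transversal hb hc h0) (h d)

theorem eq_of_image_eq {s : Set (Fin n)} {f g : Fin n → Fin n} (hf : StrictMonoOn f s)
    (hg : StrictMonoOn g s) (h : f '' s = g '' s) {x : Fin n} (hx : x ∈ s) : f x = g x := by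
  have h1 : StrictMono (s.domRestrict f) := fun a b hab => hf a.2 b.2 hab
  have h2 : StrictMono (s.domRestrict g) := fun a b hab => hg a.2 b.2 hab
  have h3 := (StrictMono.range_inj h1 h2).1 (by
    rw [Set.range_domRestrict, Set.range_domRestrict, h])
  exact congrFun h3 ⟨x, hx⟩

/-- In the extremal case the set of rows met by each column, and of columns met by each row, is
prescribed by the diagram. Shortness makes `b ∘ d` and `c ∘ d⁻¹` strictly increasing on fibres, so
both maps are determined; transversality then recovers `d` from them. -/
theorem IsShortest.eq {b c : Fin n → Fin n} (hb : Monotone b) (hc : Monotone c)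
    (he : aval b = ∑ x, (c x : ℕ)) {d d' : Equiv.Perm (Fin n)} (hd : IsShortest b c d)
    (hd' : IsShortest b c d') (h : Transversal b c d) (h' : Transversal b c d') : d = d' := by
  have mono1 : ∀ d, IsShortest b c d → Transversal b c d → ∀ j,
      StrictMonoOn (b ∘ d) {x | c x = j} := by
    intro d hd h j x hx y hy hxy
    have hcxy : c x = c y := Eq.trans hx (Eq.symm hy)
    refine lt_of_le_of_ne (hb (fiber_chain hc hd.1 hxy hcxy).le) fun e => hxy.ne (h x y hcxy e)
  have mono2 : ∀ d, IsShortest b c d → Transversal b c d → ∀ i,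
      StrictMonoOn (c ∘ ⇑d⁻¹) {x | b x = i} := by
    intro d hd h i x hx y hy hxy
    have hbxy : b x = b y := Eq.trans hx (Eq.symm hy)
    refine lt_of_le_of_ne (hc (fiber_chain hb hd.2 hxy hbxy).le) fun e =>
      hxy.ne (d⁻¹.injective (h _ _ e (by simpa using hbxy)))
  have im1 : ∀ d, Transversal b c d → ∀ j : Fin n,
      (b ∘ d) '' {x | c x = j} = {i | (j : ℕ) < fib b i} := by
    intro d h j
    ext i
    exact h.exists_iff he i j
  have im2 : ∀ d, Transversal b c d → ∀ i : Fin n,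
      (c ∘ ⇑d⁻¹) '' {x | b x = i} = {j : Fin n | (j : ℕ) < fib b i} := by
    intro d h i
    ext j
    refine Iff.trans ?_ (h.exists_iff he i j)
    constructor
    · rintro ⟨x, hx, hx'⟩
      exact ⟨d⁻¹ x, hx', by simpa using hx⟩
    · rintro ⟨x, hx, hx'⟩
      exact ⟨d x, hx', by simpa using hx⟩
  have e1 : ∀ x, b (d x) = b (d' x) := fun x =>
    eq_of_image_eq (mono1 d hd h _) (mono1 d' hd' h' _) ((im1 d h _).trans (im1 d' h' _).symm)
      (x := x) rfl
  have e2 : ∀ x, c (d⁻¹ x) = c (d'⁻¹ x) := fun x =>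
    eq_of_image_eq (mono2 d hd h _) (mono2 d' hd' h' _) ((im2 d h _).trans (im2 d' h' _).symm)
      (x := x) rfl
  ext1 x
  have h1 : x = d'⁻¹ (d x) := h' _ _ (by simpa using e2 (d x)) (by simpa using (e1 x).symm)
  nth_rw 2 [h1]
  simp

/-- `x_b H y_c` is spanned by one element if `c` is the transposed filling of `b`. -/
theorem exists_parSum_mul_mul_sgnSum {b : Fin n → Fin n} (hb : Monotone b) :
    ∃ z, ∀ a, ∃ r : R, parSum b * a * sgnSum (col b) = r • (parSum b * z * sgnSum (col b)) := by
  have hc := col_monotone b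
  obtain ⟨z, hz⟩ : ∃ z, ∀ d, IsShortest b (col b) d →
      ∃ r : R, parSum b * T d * sgnSum (col b) = r • (parSum b * z * sgnSum (col b)) := by
    by_cases h : ∃ d, IsShortest b (col b) d ∧ Transversal b (col b) d
    · obtain ⟨d, hd, hd'⟩ := h
      refine ⟨T d, fun d' h' => ?_⟩
      by_cases h0 : parSum b * T d' * sgnSum (col b) = 0
      · exact ⟨0, by rw [h0, zero_smul]⟩
      · rw [hd.eq hb hc (sum_col b).symm h' hd' (h'.transversal hb hc h0)]
        exact ⟨1, (one_smul _ _).symm⟩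
    -- Without such a `d` every product vanishes, so any `z` serves.
    · refine ⟨0, fun d hd => ⟨0, ?_⟩⟩
      by_contra h0
      exact h ⟨d, hd, hd.transversal hb hc (by simpa using h0)⟩
  refine ⟨z, fun a => ?_⟩
  induction a using hecke_induction with
  | zero => exact ⟨0, by simp⟩
  | add x y hx hy =>
    obtain ⟨r, hr⟩ := hx
    obtain ⟨r', hr'⟩ := hy
    exact ⟨r + r', by rw [mul_add, add_mul, hr, hr', add_smul]⟩
  | smul r w =>
    obtain ⟨d, hd, r', hr'⟩ := exists_isShortest b (col b) w
    obtain ⟨r'', hr''⟩ := hz d hd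
    exact ⟨r * (r' * r''), by
      rw [mul_smul_comm, smul_mul_assoc, hr', hr'', smul_smul, smul_smul, mul_assoc]⟩

/-! ## The group algebra of the symmetric group -/

/-- The rational group algebra of the symmetric group. -/
abbrev QS (n : ℕ) : Type := MonoidAlgebra ℚ (Equiv.Perm (Fin n))

/-- A group element as an element of the group algebra. -/
def ga (w : Equiv.Perm (Fin n)) : QS n := MonoidAlgebra.single w 1

theorem ga_mul (u w : Equiv.Perm (Fin n)) : ga u * ga w = ga (u * w) := by
  simp [ga, MonoidAlgebra.single_mul_single]

theorem ga_one : ga (1 : Equiv.Perm (Fin n)) = 1 := rfl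

/-- The coefficient of a group element. -/
def cf (w : Equiv.Perm (Fin n)) : QS n →ₗ[ℚ] ℚ where
  toFun x := x.coeff w
  map_add' x y := by simp
  map_smul' r x := by simp

theorem cf_ga (w u : Equiv.Perm (Fin n)) : cf w (ga u) = if u = w then 1 else 0 := by
  change (MonoidAlgebra.single u (1 : ℚ)).coeff w = _
  rw [MonoidAlgebra.coeff_single, Finsupp.single_apply]

theorem qs_ext {x y : QS n} (h : ∀ w, cf w x = cf w y) : x = y :=
  MonoidAlgebra.coeff_injective (Finsupp.ext h)

theorem sum_cf_ga (x : QS n) : ∑ w, cf w x • ga w = x := by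
  refine qs_ext fun w => ?_
  simp [cf_ga]

theorem cf_mul_ga (w g : Equiv.Perm (Fin n)) (x : QS n) : cf w (x * ga g) = cf (w * g⁻¹) x := by
  change (x * MonoidAlgebra.single g (1 : ℚ)).coeff w = x.coeff (w * g⁻¹)
  simp

theorem cf_ga_mul (w g : Equiv.Perm (Fin n)) (x : QS n) : cf w (ga g * x) = cf (g⁻¹ * w) x := by
  change (MonoidAlgebra.single g (1 : ℚ) * x).coeff w = x.coeff (g⁻¹ * w)
  simp

theorem cf_one_mul (x y : QS n) : cf 1 (x * y) = ∑ g, cf g x * cf g⁻¹ y := by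
  conv_lhs => rw [← sum_cf_ga x]
  simp [Finset.sum_mul, cf_ga_mul]

open scoped Classical in
/-- The sum of the elements of the parabolic subgroup of `b`. -/
def gpar (b : Fin n → Fin n) : QS n := ∑ w with Fixes b w, ga w

open scoped Classical in
/-- The signed sum of the elements of the parabolic subgroup of `c`. -/
def gsgn (c : Fin n → Fin n) : QS n :=
  ∑ w with Fixes c w, ((Equiv.Perm.sign w : ℤ) : ℚ) • ga w

open scoped Classical in
theorem cf_gpar (b : Fin n → Fin n) (w : Equiv.Perm (Fin n)) :
    cf w (gpar b) = if Fixes b w then 1 else 0 := by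
  simp [gpar, cf_ga]

open scoped Classical in
theorem cf_gsgn (c : Fin n → Fin n) (w : Equiv.Perm (Fin n)) :
    cf w (gsgn c) = if Fixes c w then ((Equiv.Perm.sign w : ℤ) : ℚ) else 0 := by
  rw [gsgn, map_sum]
  simp only [map_smul, cf_ga, smul_eq_mul, mul_ite, mul_one, mul_zero]
  rw [Finset.sum_ite_eq']
  simp

theorem ga_mul_gpar {b : Fin n → Fin n} {i j : Fin n} (h : b i = b j) :
    ga (Equiv.swap i j) * gpar b = gpar b := by
  refine qs_ext fun w => ?_
  have h1 : Fixes b (Equiv.swap i j * w) ↔ Fixes b w := by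
    refine ⟨fun hw => ?_, fun hw => (fixes_swap h).mul hw⟩
    simpa [← mul_assoc] using (fixes_swap h).mul hw
  rw [cf_ga_mul, cf_gpar, cf_gpar, Equiv.swap_inv, h1]

theorem gsgn_mul_ga {c : Fin n → Fin n} {i j : Fin n} (hij : i ≠ j) (h : c i = c j) :
    gsgn c * ga (Equiv.swap i j) = -gsgn c := by
  refine qs_ext fun w => ?_
  rw [cf_mul_ga, map_neg, cf_gsgn, cf_gsgn, Equiv.swap_inv, fixes_mul_swap_iff h]
  split_ifs <;> simp [Equiv.Perm.sign_swap hij]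

/-- A failure of transversality supplies a transposition of the `c`-subgroup that `g⁻¹` conjugates
into the `b`-subgroup. Inserting it leaves the right factor fixed and negates the left one, so the
product equals its own negative. -/
theorem gsgn_mul_ga_mul_gpar {b c : Fin n → Fin n} {g : Equiv.Perm (Fin n)}
    (h : ¬ Transversal b c g⁻¹) : gsgn c * ga g * gpar b = 0 := by
  simp only [Transversal, not_forall] at h
  obtain ⟨x, y, hc, hb, hne⟩ := h
  have e : Equiv.swap x y * g = g * Equiv.swap (g⁻¹ x) (g⁻¹ y) := by
    rw [Equiv.mul_swap_eq_swap_mul]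
    simp
  have h1 : gsgn c * ga g * gpar b = -(gsgn c * ga g * gpar b) := by
    conv_lhs => rw [← ga_mul_gpar hb, ← mul_assoc, mul_assoc (gsgn c), ga_mul, ← e, ← ga_mul,
      ← mul_assoc, gsgn_mul_ga hne hc]
    simp
  refine qs_ext fun w => ?_
  have h2 := congrArg (cf w) h1
  rw [map_neg] at h2
  rw [map_zero]
  linarith

/-- Transversality means that the `b`-subgroup meets the conjugate by `d` of the `c`-subgroup
trivially, so the identity arises from one pair only. -/
theorem cf_one_gpar_mul {b c : Fin n → Fin n} {d : Equiv.Perm (Fin n)} (h : Transversal b c d) :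
    cf 1 (gpar b * ga d * gsgn c * ga d⁻¹) = 1 := by
  rw [mul_assoc, mul_assoc, gpar, Finset.sum_mul, map_sum, Finset.sum_eq_single 1]
  · simp only [cf_ga_mul, cf_mul_ga, cf_gsgn]
    simp [Fixes.one]
  · intro u hu hne
    simp only [cf_ga_mul, cf_mul_ga, cf_gsgn]
    rw [if_neg]
    intro hw
    simp only [Finset.mem_filter, Finset.mem_univ, true_and] at hu
    apply hne
    have h1 : ∀ x, d⁻¹ (u⁻¹ (d x)) = x := fun x =>
      h _ _ (by simpa using hw x) (by simpa using hu.inv (d x))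
    ext x
    have h2 := congrArg (fun z => u (d z)) (h1 (d⁻¹ x))
    simpa using congrArg Fin.val h2.symm
  · intro h1
    exact absurd (Fixes.one b) (by simpa using h1)

/-! ### Orthogonal central elements -/

/-- A central element of the ideal spanned by the products `x_b g y_c`, where `c` is the transposed
filling of `b`. -/
def kap (b : Fin n → Fin n) : QS n :=
  ∑ g, ga g * (gpar b * ga (Tuple.sort (rank b)) * gsgn (col b) *
    ga (Tuple.sort (rank b))⁻¹) * ga g⁻¹

theorem ga_mul_kap (b : Fin n → Fin n) (h : Equiv.Perm (Fin n)) :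
    ga h * kap b = kap b * ga h := by
  rw [kap, Finset.mul_sum, Finset.sum_mul]
  refine Fintype.sum_equiv (Equiv.mulLeft h) _ _ fun g => ?_
  rw [Equiv.coe_mulLeft, ← mul_assoc, ← mul_assoc, ga_mul, mul_assoc _ (ga _) (ga _), ga_mul]
  simp

theorem mul_kap (b : Fin n → Fin n) (x : QS n) : x * kap b = kap b * x := by
  rw [← sum_cf_ga x, Finset.mul_sum, Finset.sum_mul]
  simp only [smul_mul_assoc, mul_smul_comm, ga_mul_kap]

theorem cf_kap_conj (b : Fin n → Fin n) {g h : Equiv.Perm (Fin n)} (hgh : IsConj g h) :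
    cf g (kap b) = cf h (kap b) := by
  obtain ⟨k, rfl⟩ := isConj_iff.1 hgh
  have := congrArg (cf (k * g)) (ga_mul_kap b k)
  rwa [cf_ga_mul, cf_mul_ga, inv_mul_cancel_left] at this

theorem cf_one_kap (b : Fin n → Fin n) : cf 1 (kap b) ≠ 0 := by
  rw [kap, map_sum, Finset.sum_congr rfl (g := fun _ => 1)]
  · simp [Fintype.card_perm, Nat.factorial_ne_zero]
  · intro g _
    rw [cf_mul_ga, cf_ga_mul]
    simpa using cf_one_gpar_mul (col_transversal b)

/-- Every permutation is conjugate to its inverse, so the coefficient at 1 of the square of the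
class function `kap b` is a sum of squares, one of which is nonzero. -/
theorem kap_mul_self_ne_zero (b : Fin n → Fin n) : kap b * kap b ≠ 0 := by
  intro h
  have h1 := congrArg (cf 1) h
  rw [cf_one_mul, map_zero] at h1
  have h2 : ∀ g, cf g (kap b) * cf g⁻¹ (kap b) = cf g (kap b) ^ 2 := by
    intro g
    rw [sq, cf_kap_conj b (g := g⁻¹) (h := g)]
    rw [Equiv.Perm.isConj_iff_cycleType_eq, Equiv.Perm.cycleType_inv]
  rw [Finset.sum_congr rfl fun g _ => h2 g,
    Finset.sum_eq_zero_iff_of_nonneg fun g _ => sq_nonneg _] at h1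
  exact cf_one_kap b (by simpa using h1 1 (Finset.mem_univ 1))

theorem kap_mul_kap_of_not_transversal {b b' : Fin n → Fin n}
    (h : ∀ g, ¬ Transversal b' (col b) g) : kap b * kap b' = 0 := by
  rw [kap, kap, Finset.sum_mul_sum]
  refine Finset.sum_eq_zero fun g _ => Finset.sum_eq_zero fun g' _ => ?_
  have h1 := gsgn_mul_ga_mul_gpar (g := (Tuple.sort (rank b))⁻¹ * g⁻¹ * g') (h _)
  rw [← ga_mul, ← ga_mul] at h1
  have h2 := congrArg (fun x => ga g * gpar b * ga (Tuple.sort (rank b)) * x *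
    (ga (Tuple.sort (rank b')) * gsgn (col b') * ga (Tuple.sort (rank b'))⁻¹ * ga g'⁻¹)) h1
  simpa only [mul_assoc, mul_zero, zero_mul] using h2

/-- By centrality the product may be taken in either order, and if neither order gave zero there
would be transversals in both directions, contradicting `Transversal.aval_lt`. -/
theorem kap_mul_kap {b b' : Fin n → Fin n} (h : ptype b ≠ ptype b') : kap b * kap b' = 0 := by
  by_cases h1 : ∀ g, ¬ Transversal b' (col b) g
  · exact kap_mul_kap_of_not_transversal h1
  · push Not at h1
    obtain ⟨g, hg⟩ := h1
    rw [mul_kap]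
    refine kap_mul_kap_of_not_transversal fun g' hg' => ?_
    exact lt_asymm (hg.aval_lt h.symm) (hg'.aval_lt h)

/-- Pairwise orthogonality with nonzero squares gives linear independence. The types are at least as
numerous as the conjugacy classes, so these elements span all class functions, among them 1. -/
theorem one_mem_span_kap (β : Set.range (fun b : {b : Fin n → Fin n // Monotone b} => ptype b.1) →
    Fin n → Fin n) (hβ : ∀ i, ptype (β i) = i.1) :
    (1 : QS n) ∈ Submodule.span ℚ (Set.range fun i => kap (β i)) := by
  classical
  -- Class functions realized as elements of the group algebra, so that dimensions can be counted by
  -- conjugacy classes.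
  let Φ : (ConjClasses (Equiv.Perm (Fin n)) → ℚ) →ₗ[ℚ] QS n :=
    { toFun := fun f => ∑ g, f (ConjClasses.mk g) • ga g
      map_add' := fun f f' => by simp [add_smul, Finset.sum_add_distrib]
      map_smul' := fun r f => by simp [mul_smul, Finset.smul_sum] }
  have hΦ : ∀ f, Φ f = ∑ g, f (ConjClasses.mk g) • ga g := fun _ => rfl
  let κ : Set.range (fun b : {b : Fin n → Fin n // Monotone b} => ptype b.1) →
      ConjClasses (Equiv.Perm (Fin n)) → ℚ := fun i =>
    Quotient.lift (fun g => cf g (kap (β i))) fun _ _ h => cf_kap_conj _ h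
  have hκ : ∀ i, Φ (κ i) = kap (β i) := fun i => sum_cf_ga _
  have hli : LinearIndependent ℚ κ := by
    refine LinearIndependent.of_comp Φ ?_
    rw [linearIndependent_iff']
    intro s a ha i hi
    have h1 := congrArg (fun x => x * kap (β i)) ha
    simp only [Function.comp, hκ, Finset.sum_mul, smul_mul_assoc, zero_mul] at h1
    rw [Finset.sum_eq_single i] at h1
    · exact (smul_eq_zero.1 h1).resolve_right (kap_mul_self_ne_zero _)
    · intro j _ hj
      rw [kap_mul_kap, smul_zero]
      rw [hβ, hβ]
      exact fun e => hj (Subtype.ext e)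
    · exact fun h => absurd hi h
  have : Fintype (ConjClasses (Equiv.Perm (Fin n))) := Fintype.ofFinite _
  have : Fintype (Set.range (fun b : {b : Fin n → Fin n // Monotone b} => ptype b.1)) :=
    Fintype.ofFinite _
  have hcard : Fintype.card (Set.range fun b : {b : Fin n → Fin n // Monotone b} => ptype b.1) =
      Module.finrank ℚ (ConjClasses (Equiv.Perm (Fin n)) → ℚ) := by
    refine le_antisymm hli.fintype_card_le_finrank ?_
    rw [Module.finrank_pi, ← Nat.card_eq_fintype_card, ← Nat.card_eq_fintype_card]
    exact card_conjClasses_le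
  have hspan := hli.span_eq_top_of_card_eq_finrank' hcard
  have h1 : Φ (Pi.single (ConjClasses.mk 1) 1) = 1 := by
    rw [hΦ, Finset.sum_eq_single 1]
    · simp [ga_one]
    · intro g _ hg
      rw [Pi.single_eq_of_ne, zero_smul]
      intro h
      rw [ConjClasses.mk_eq_mk_iff_isConj] at h
      exact hg (isConj_one_right.1 h.symm)
    · simp
  have h2 := Submodule.mem_map_of_mem (f := Φ)
    (show Pi.single (ConjClasses.mk 1) 1 ∈ Submodule.span ℚ (Set.range κ) by simp [hspan])
  rw [h1, Submodule.map_span, ← Set.range_comp] at h2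
  have h3 : Φ ∘ κ = fun i => kap (β i) := funext hκ
  rwa [h3] at h2

/-! ## Specialization of the Hecke algebra -/

/-- The specialization of the Hecke algebra to the group algebra. -/
def spec : Hecke n →+ QS n where
  toFun h := ∑ w, evalOne (coef w h) • ga w
  map_zero' := by simp
  map_add' x y := by simp [add_smul, Finset.sum_add_distrib]

theorem cf_spec (w : Equiv.Perm (Fin n)) (h : Hecke n) : cf w (spec h) = evalOne (coef w h) := by
  change cf w (∑ w, evalOne (coef w h) • ga w) = _
  simp [cf_ga]

theorem spec_smul (r : R) (h : Hecke n) : spec (r • h) = evalOne r • spec h :=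
  qs_ext fun w => by simp [cf_spec]

theorem spec_T (w : Equiv.Perm (Fin n)) : spec (T w) = ga w := by
  classical
  refine qs_ext fun u => ?_
  rw [cf_spec, coef_T, cf_ga]
  split_ifs <;> simp

theorem spec_T_simple_mul {s : Equiv.Perm (Fin n)} (hs : s ∈ simples n) (h : Hecke n) :
    spec (T s * h) = ga s * spec h := by
  induction h using hecke_induction with
  | zero => simp
  | add x y hx hy => rw [mul_add, map_add, hx, hy, map_add, mul_add]
  | smul r w =>
    rw [mul_smul_comm, spec_smul, spec_smul, mul_smul_comm, spec_T, ga_mul, T_simple_mul_T hs]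
    split_ifs
    · rw [spec_T]
    · rw [map_add, spec_smul, spec_smul, map_sub, q, evalOne_qhalf, spec_T, spec_T]
      simp

theorem spec_mul (a h : Hecke n) : spec (a * h) = spec a * spec h := by
  induction a using hecke_induction with
  | zero => simp
  | add x y hx hy => rw [add_mul, map_add, hx, hy, map_add, add_mul]
  | smul r w =>
    rw [smul_mul_assoc, spec_smul, spec_smul, smul_mul_assoc, spec_T]
    congr 1
    induction w using left_induction with
    | one => rw [← one_def, one_mul, ga_one, one_mul]
    | mul s hs w hw ih =>
      rw [T_simple_mul_of_lt hs hw, mul_assoc, spec_T_simple_mul hs, ih, ← mul_assoc, ga_mul]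

theorem sign_eq (w : Equiv.Perm (Fin n)) : (Equiv.Perm.sign w : ℤ) = (-1) ^ len w := by
  induction w using left_induction with
  | one => simp [len_one]
  | mul s hs w hw ih =>
    have h1 := len_simple_mul hs w
    have h2 : len (s * w) = len w + 1 := by omega
    obtain ⟨i, j, hij, rfl⟩ := hs
    have h3 : i ≠ j := fun h => by
      rw [h] at hij
      omega
    rw [h2, Equiv.Perm.sign_mul, Equiv.Perm.sign_swap h3, pow_succ, ← ih]
    simp

theorem spec_parSum (b : Fin n → Fin n) : spec (parSum b) = gpar b := by
  refine qs_ext fun w => ?_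
  rw [cf_spec, coef_parSum, cf_gpar]
  split_ifs <;> simp

theorem spec_sgnSum (c : Fin n → Fin n) : spec (sgnSum c) = gsgn c := by
  refine qs_ext fun w => ?_
  rw [cf_spec, coef_sgnSum, cf_gsgn]
  split_ifs
  · rw [map_mul, evalOne_qhalf, map_pow, map_neg, map_one, mul_one, sign_eq]
    simp
  · simp

/-- At q = 1, after right multiplication by d⁻¹, the coefficient at the identity is 1. -/
theorem parSum_mul_sgnSum_ne_zero {b c : Fin n → Fin n} {d : Equiv.Perm (Fin n)}
    (h : Transversal b c d) : parSum b * T d * sgnSum c ≠ 0 := by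
  intro h0
  have h1 := congrArg (fun x => cf 1 (spec x * ga d⁻¹)) h0
  simp only [spec_mul, spec_parSum, spec_sgnSum, spec_T, cf_one_gpar_mul h, map_zero, zero_mul]
    at h1
  exact one_ne_zero h1

/-- The matrix over `R` of left multiplication by `m` specializes to `N` times the identity, so its
determinant is nonzero; a column of the adjugate gives `a`. -/
theorem exists_mul_eq_smul_one {m : Hecke n} {N : ℚ} (hN : N ≠ 0) (hm : spec m = N • 1) :
    ∃ (a : Hecke n) (D : R), D ≠ 0 ∧ m * a = D • 1 := by
  classical
  let M : Matrix (Equiv.Perm (Fin n)) (Equiv.Perm (Fin n)) R :=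
    Matrix.of fun w y => coef w (m * T y)
  refine ⟨∑ y, M.adjugate y 1 • T y, M.det, ?_, ?_⟩
  · intro h0
    have h1 : evalOne.mapMatrix M = N • (1 : Matrix _ _ ℚ) := by
      ext w y
      simp only [M, RingHom.mapMatrix_apply, Matrix.map_apply, Matrix.of_apply, Matrix.smul_apply]
      rw [← cf_spec, spec_mul, hm, spec_T, smul_mul_assoc, one_mul, map_smul, cf_ga,
        Matrix.one_apply]
      simp only [eq_comm]
    have h2 := congrArg evalOne h0
    rw [RingHom.map_det, h1, map_zero, Matrix.det_smul, Matrix.det_one, mul_one] at h2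
    exact pow_ne_zero _ hN h2
  · refine hecke_ext fun w => ?_
    have h1 := congrFun (congrFun M.mul_adjugate w) 1
    rw [Matrix.mul_apply, Matrix.smul_apply, Matrix.one_apply] at h1
    rw [Finset.mul_sum, map_sum, map_smul, one_def, coef_T]
    simp only [eq_comm (a := (1 : Equiv.Perm (Fin n)))]
    rw [← h1]
    refine Finset.sum_congr rfl fun y _ => ?_
    rw [mul_smul_comm, map_smul, smul_eq_mul, mul_comm]
    rfl

/-- A nonzero scalar lies in the sum of the ideals `H x_b H y_c H`, where `b` runs over a family of
fillings that contains one filling of each type. -/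
theorem exists_smul_one_mem (β : Set.range (fun b : {b : Fin n → Fin n // Monotone b} =>
    ptype b.1) → Fin n → Fin n) (hβ : ∀ i, ptype (β i) = i.1) :
    ∃ D : R, D ≠ 0 ∧ D • (1 : Hecke n) ∈ Submodule.span R
      {z | ∃ i h h' h'', z = h * parSum (β i) * h' * sgnSum (col (β i)) * h''} := by
  set M := Submodule.span R
      {z : Hecke n | ∃ i h h' h'', z = h * parSum (β i) * h' * sgnSum (col (β i)) * h''} with hM
  have hmul : ∀ m ∈ M, ∀ a, m * a ∈ M := by
    intro m hm a
    induction hm using Submodule.span_induction with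
    | mem x hx =>
      obtain ⟨i, h, h', h'', rfl⟩ := hx
      exact Submodule.subset_span ⟨i, h, h', h'' * a, by rw [mul_assoc _ h'']⟩
    | zero => simp
    | add x y _ _ hx hy => rw [add_mul]; exact M.add_mem hx hy
    | smul r x _ hx => rw [smul_mul_assoc]; exact M.smul_mem r hx
  -- After clearing denominators, every element of the rational span lifts to `M`; applied to 1,
  -- this gives an element of `M` that specializes to a nonzero integer.
  have key : ∀ x ∈ Submodule.span ℚ (Set.range fun i => kap (β i)),
      ∃ m ∈ M, ∃ N : ℤ, N ≠ 0 ∧ spec m = (N : ℚ) • x := by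
    intro x hx
    induction hx using Submodule.span_induction with
    | mem x hx =>
      obtain ⟨i, rfl⟩ := hx
      let d := Tuple.sort (rank (β i))
      refine ⟨∑ g, T g * parSum (β i) * T d * sgnSum (col (β i)) * T (d⁻¹ * g⁻¹),
        M.sum_mem fun g _ => Submodule.subset_span ⟨i, _, _, _, rfl⟩, 1, one_ne_zero, ?_⟩
      change _ = _ • kap (β i)
      rw [map_sum, Int.cast_one, one_smul, kap]
      refine Finset.sum_congr rfl fun g _ => ?_
      simp only [spec_mul, spec_parSum, spec_sgnSum, spec_T, ← ga_mul, mul_assoc, d]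
    | zero => exact ⟨0, M.zero_mem, 1, one_ne_zero, by simp⟩
    | add x y _ _ hx hy =>
      obtain ⟨m, hm, N, hN, e⟩ := hx
      obtain ⟨m', hm', N', hN', e'⟩ := hy
      refine ⟨(N' : R) • m + (N : R) • m', M.add_mem (M.smul_mem _ hm) (M.smul_mem _ hm'), N * N',
        mul_ne_zero hN hN', ?_⟩
      rw [map_add, spec_smul, spec_smul, map_intCast, map_intCast, e, e', smul_smul, smul_smul,
        smul_add]
      push_cast
      rw [mul_comm (N' : ℚ)]
    | smul r x _ hx =>
      obtain ⟨m, hm, N, hN, e⟩ := hx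
      refine ⟨(r.num : R) • m, M.smul_mem _ hm, r.den * N, mul_ne_zero (by simp) hN, ?_⟩
      rw [spec_smul, map_intCast, e, smul_smul, smul_smul]
      congr 1
      push_cast
      nth_rw 3 [← Rat.num_div_den r]
      have : (r.den : ℚ) ≠ 0 := by simp
      field_simp
  obtain ⟨m, hm, N, hN, e⟩ := key 1 (one_mem_span_kap β hβ)
  obtain ⟨a, D, hD, h⟩ := exists_mul_eq_smul_one (Int.cast_ne_zero.2 hN) e
  exact ⟨D, hD, h ▸ hmul m hm a⟩

/-- Modulo the ideals of the larger fillings, `x_b H x_b` is spanned by `x_b`. -/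
theorem exists_parSum_mul_mul_parSum {b : Fin n → Fin n} (hb : Monotone b)
    {N : Submodule R (Hecke n)} (hN : IsKLSpanned N) (hl : ∀ a, ∀ x ∈ N, a * x ∈ N)
    (hr : ∀ a, ∀ x ∈ N, x * a ∈ N)
    (hlt : ∀ b' : Fin n → Fin n, Monotone b' → aval b < aval b' → parSum b' ∈ N) (k : Hecke n) :
    ∃ κ : R, parSum b * k * parSum b - κ • parSum b ∈ N := by
  classical
  let i₀ : Set.range (fun b : {b : Fin n → Fin n // Monotone b} => ptype b.1) :=
    ⟨ptype b, ⟨b, hb⟩, rfl⟩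
  -- One representative of each type, with `b` itself chosen for its own type.
  let β : Set.range (fun b : {b : Fin n → Fin n // Monotone b} => ptype b.1) → Fin n → Fin n :=
    fun i => if i = i₀ then b else i.2.choose.1
  have hβ : ∀ i, ptype (β i) = i.1 := by
    intro i
    by_cases h : i = i₀
    · simp [β, h, i₀]
    · simp only [β, if_neg h]
      exact i.2.choose_spec
  have hβm : ∀ i, Monotone (β i) := by
    intro i
    by_cases h : i = i₀
    · simpa [β, h] using hb
    · simp only [β, if_neg h]
      exact i.2.choose.2
  obtain ⟨z, hz⟩ := exists_parSum_mul_mul_sgnSum hb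
  -- `parSum b * k` preserves x_b H y_{col b}, which is spanned by one element, and acts on it by
  -- the scalar `κ`. Hence x_b k x_b - κ x_b annihilates H y_{col b} from the left.
  obtain ⟨κ, hκ⟩ := hz (k * parSum b * z)
  have hzero : ∀ a, (parSum b * k * parSum b - κ • parSum b) * a * sgnSum (col b) = 0 := by
    intro a
    obtain ⟨r, hr⟩ := hz a
    have h1 : parSum b * k * (parSum b * a * sgnSum (col b)) =
        κ • (parSum b * a * sgnSum (col b)) := by
      rw [hr, mul_smul_comm, smul_comm κ, ← hκ]
      simp only [mul_assoc]
    rw [sub_mul, sub_mul, smul_mul_assoc, smul_mul_assoc, ← h1, sub_eq_zero]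
    simp only [mul_assoc]
  obtain ⟨D, hD, hmem⟩ := exists_smul_one_mem β hβ
  refine ⟨κ, hN.mem_of_smul_mem hD ?_⟩
  set m := parSum b * k * parSum b - κ • parSum b with hm
  -- Three cases for the type of `β i`: that of `b`, where `m` kills the product; larger `aval`,
  -- where the product lies in `N`; otherwise x_b H y = 0 because no transversal exists.
  have key : ∀ x ∈ Submodule.span R
      {z : Hecke n | ∃ i h h' h'', z = h * parSum (β i) * h' * sgnSum (col (β i)) * h''},
      m * x ∈ N := by
    intro x hx
    induction hx using Submodule.span_induction with
    | mem x hx =>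
      obtain ⟨i, h, h', h'', rfl⟩ := hx
      by_cases h1 : i = i₀
      · have e : β i = b := by simp [β, h1]
        have h2 := hzero (h * parSum b * h')
        rw [e, ← mul_assoc, ← mul_assoc, h2, zero_mul]
        exact N.zero_mem
      · by_cases h2 : aval b < aval (β i)
        · exact hl _ _ (hr _ _ (hr _ _ (hr _ _ (hl _ _ (hlt _ (hβm i) h2)))))
        · have hne : ptype b ≠ ptype (β i) := by
            rw [hβ]
            exact fun e => h1 (Subtype.ext e.symm)
          have h3 : ∀ a, parSum b * a * sgnSum (col (β i)) = 0 :=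
            parSum_mul_mul_sgnSum_eq_zero hb (col_monotone _) fun w hw => h2 (hw.aval_lt hne)
          have h4 : m * (h * parSum (β i) * h' * sgnSum (col (β i)) * h'') =
              ((parSum b * (k * parSum b * h * parSum (β i) * h') * sgnSum (col (β i))) -
              κ • (parSum b * (h * parSum (β i) * h') * sgnSum (col (β i)))) * h'' := by
            rw [hm]
            simp only [sub_mul, smul_mul_assoc, mul_assoc]
          rw [h4, h3, h3, smul_zero, sub_zero, zero_mul]
          exact N.zero_mem
    | zero => simp
    | add x y _ _ hx hy => rw [mul_add]; exact N.add_mem hx hy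
    | smul r x _ hx => rw [mul_smul_comm]; exact N.smul_mem r hx
  simpa using key _ hmem

/-! ## The trace form -/

theorem coef_one_mul_T (a : Hecke n) (w : Equiv.Perm (Fin n)) :
    coef 1 (a * T w) = q ^ len w * coef w⁻¹ a := by
  induction w using left_induction generalizing a with
  | one => simp [← one_def, len_one]
  | mul s hs w hw ih =>
    have h1 := len_simple_mul hs w
    have h2 : len (s * w) = len w + 1 := by omega
    have h3 : (s * w)⁻¹ = w⁻¹ * s := by rw [mul_inv_rev, simple_inv hs]
    rw [T_simple_mul_of_lt hs hw, ← mul_assoc, ih, coef_mul_T_simple hs, if_pos, h2, h3, pow_succ,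
      mul_assoc]
    rw [← h3, len_inv, len_inv]
    exact hw

theorem coef_one_mul (a h : Hecke n) :
    coef 1 (a * h) = ∑ w, q ^ len w * (coef w⁻¹ a * coef w h) := by
  conv_lhs => rw [← sum_coef_T h]
  rw [Finset.mul_sum, map_sum]
  refine Finset.sum_congr rfl fun w _ => ?_
  rw [mul_smul_comm, map_smul, coef_one_mul_T, smul_eq_mul]
  ring

theorem coef_one_mul_comm (a h : Hecke n) : coef 1 (a * h) = coef 1 (h * a) := by
  rw [coef_one_mul, coef_one_mul]
  refine Fintype.sum_equiv (Equiv.inv _) _ _ fun w => ?_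
  rw [Equiv.inv_apply, len_inv, inv_inv, mul_comm (coef _ _)]

theorem coef_one_mul_star (a h : Hecke n) :
    coef 1 (a * star h) = ∑ w, q ^ len w * (coef w a * coef w h) := by
  rw [coef_one_mul]
  refine Fintype.sum_equiv (Equiv.inv _) _ _ fun w => ?_
  rw [Equiv.inv_apply, len_inv, coef_star]

/-- The elements q^{-ℓ(w)/2} T_w are orthonormal for this form, and the transition matrix to the
`nC` is the identity modulo q^{-1/2}; therefore so is the Gram matrix. -/
theorem exists_coef_one_nC_mul_star (y z : Equiv.Perm (Fin n)) : ∃ g : Polynomial ℤ,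
    coef 1 (nC y * star (nC z)) = psi g ∧ g.coeff 0 = if y = z then 1 else 0 := by
  choose p hp hp' using exists_coef_nC (n := n)
  refine ⟨∑ w, p w y * p w z, ?_, ?_⟩
  · rw [coef_one_mul_star, map_sum]
    refine Finset.sum_congr rfl fun w _ => ?_
    have h1 : q ^ len w * (qhalf (-(len w : ℤ)) * qhalf (-(len w : ℤ))) = 1 := by
      rw [qhalf_two_mul, qhalf_mul, qhalf_mul, ← qhalf_zero]
      congr 1
      ring
    rw [hp, hp, map_mul, mul_mul_mul_comm, ← mul_assoc, h1, one_mul]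
  · rw [Polynomial.finsetSum_coeff]
    simp only [Polynomial.mul_coeff_zero, hp']
    simp [eq_comm]

/-- The two-sided ideals that are stable under the anti-involution and spanned by Kazhdan–Lusztig
elements. -/
structure IsCellIdeal (N : Submodule R (Hecke n)) : Prop where
  spanned : IsKLSpanned N
  left : ∀ a, ∀ x ∈ N, a * x ∈ N
  right : ∀ a, ∀ x ∈ N, x * a ∈ N
  star : ∀ x ∈ N, star x ∈ N

/-- The scaled orthogonal projection along a cell ideal. -/
theorem IsCellIdeal.exists_projection {N : Submodule R (Hecke n)} (hN : IsCellIdeal N) :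
    ∃ (δ : R) (P : Hecke n →ₗ[R] Hecke n), δ ≠ 0 ∧ (∀ h, δ • h - P h ∈ N) ∧
      (∀ h, ∀ x ∈ N, coef 1 (P h * SymHecke.star x) = 0) ∧ (∀ x ∈ N, P x = 0) ∧
      (∀ h, (∀ x ∈ N, coef 1 (h * SymHecke.star x) = 0) → P h = δ • h) ∧
      ∀ y z, nC y ∉ N → nC z ∉ N → ∃ g : Polynomial ℤ,
        coef 1 (P (nC y) * SymHecke.star (nC z)) = psi g ∧
          g.coeff 0 = if y = z then 1 else 0 := by
  classical
  choose g hg hg' using exists_coef_one_nC_mul_star (n := n)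
  obtain ⟨G, hG⟩ : ∃ G : Matrix {z // nC z ∈ N} {z // nC z ∈ N} (Polynomial ℤ),
      ∀ u w, G u w = g w.1 u.1 := ⟨Matrix.of fun u w => g w.1 u.1, fun _ _ => rfl⟩
  -- `G` is the Gram matrix of the Kazhdan–Lusztig elements in `N`, congruent to the identity modulo
  -- X.
  have hdet : G.det.coeff 0 = 1 := by
    have h1 : Polynomial.constantCoeff.mapMatrix G = 1 := by
      ext u w
      simp only [hG, RingHom.mapMatrix_apply, Matrix.map_apply,
        Polynomial.constantCoeff_apply, hg', Matrix.one_apply, Subtype.ext_iff, eq_comm]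
    rw [← Polynomial.constantCoeff_apply, RingHom.map_det, h1, Matrix.det_one]
  have hdet0 : psi G.det ≠ 0 := fun h => by
    rw [← map_zero psi] at h
    rw [psi_injective h] at hdet
    simp at hdet
  -- Using the adjugate in place of the inverse keeps all entries polynomial, at the price of
  -- scaling the projection by the determinant.
  obtain ⟨A, hGA, hAG⟩ : ∃ A : Matrix {z // nC z ∈ N} {z // nC z ∈ N} (Polynomial ℤ),
      (∀ u v, ∑ w, G u w * A w v = if u = v then G.det else 0) ∧
        ∀ u v, ∑ w, A u w * G w v = if u = v then G.det else 0 := by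
    refine ⟨G.adjugate, fun u v => ?_, fun u v => ?_⟩
    · have := congrFun (congrFun G.mul_adjugate u) v
      rw [Matrix.mul_apply] at this
      rw [this, Matrix.smul_apply, Matrix.one_apply]
      split_ifs <;> simp
    · have := congrFun (congrFun G.adjugate_mul u) v
      rw [Matrix.mul_apply] at this
      rw [this, Matrix.smul_apply, Matrix.one_apply]
      split_ifs <;> simp
  obtain ⟨P, hP⟩ : ∃ P : Hecke n →ₗ[R] Hecke n, ∀ h, P h = psi G.det • h -
      ∑ w : {z // nC z ∈ N}, ∑ u : {z // nC z ∈ N},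
        (psi (A w u) * coef 1 (h * SymHecke.star (nC u.1))) • nC w.1 := by
    refine ⟨psi G.det • LinearMap.id - ∑ w : {z // nC z ∈ N}, ∑ u : {z // nC z ∈ N},
      psi (A w u) • ((coef 1).comp (LinearMap.mulRight R (SymHecke.star (nC u.1)))).smulRight
        (nC w.1), fun h => ?_⟩
    simp [LinearMap.sum_apply, mul_smul]
  have hPmem : ∀ h, psi G.det • h - P h ∈ N := by
    intro h
    rw [hP, sub_sub_cancel]
    exact N.sum_mem fun w _ => N.sum_mem fun u _ => N.smul_mem _ w.2
  have hspan := hN.spanned.eq_span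
  have hPperp : ∀ h, ∀ x ∈ N, coef 1 (P h * SymHecke.star x) = 0 := by
    intro h x hx
    rw [hspan] at hx
    induction hx using Submodule.span_induction with
    | mem x hx =>
      obtain ⟨v, hv, rfl⟩ := hx
      rw [C_eq_smul_nC, map_smul, mul_smul_comm, map_smul]
      have h1 : coef 1 (P h * SymHecke.star (nC v)) =
          psi G.det * coef 1 (h * SymHecke.star (nC v)) - ∑ u : {z // nC z ∈ N},
            psi (∑ w, G ⟨v, hv⟩ w * A w u) * coef 1 (h * SymHecke.star (nC u.1)) := by
        rw [hP, sub_mul, map_sub, smul_mul_assoc, map_smul, smul_eq_mul, Finset.sum_mul, map_sum]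
        simp only [Finset.sum_mul, map_sum, smul_mul_assoc, map_smul, smul_eq_mul,
          RingHom.map_mul, hg]
        rw [Finset.sum_comm]
        refine congrArg _ (Finset.sum_congr rfl fun u _ => Finset.sum_congr rfl fun w _ => ?_)
        simp only [hG]
        ring
      have h2 : ∑ u : {z // nC z ∈ N}, psi (∑ w, G ⟨v, hv⟩ w * A w u) *
          coef 1 (h * SymHecke.star (nC u.1)) =
            psi G.det * coef 1 (h * SymHecke.star (nC v)) := by
        rw [Finset.sum_eq_single ⟨v, hv⟩]
        · rw [hGA, if_pos rfl]
        · intro u _ hu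
          rw [hGA, if_neg hu.symm, RingHom.map_zero, zero_mul]
        · simp
      rw [h1, h2, sub_self, smul_zero]
    | zero => simp
    | add x y _ _ hx hy => rw [map_add, mul_add, map_add, hx, hy, add_zero]
    | smul r x _ hx => rw [map_smul, mul_smul_comm, map_smul, hx, smul_zero]
  have hPzero : ∀ x ∈ N, P x = 0 := by
    intro x hx
    rw [hspan] at hx
    induction hx using Submodule.span_induction with
    | mem x hx =>
      obtain ⟨v, hv, rfl⟩ := hx
      have h1 : P (nC v) = psi G.det • nC v - ∑ w : {z // nC z ∈ N},
          psi (∑ u, A w u * G u ⟨v, hv⟩) • nC w.1 := by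
        rw [hP]
        simp only [map_sum, Finset.sum_smul, RingHom.map_mul, hg, hG]
      rw [C_eq_smul_nC, map_smul, h1]
      simp only [hAG]
      rw [Finset.sum_eq_single ⟨v, hv⟩]
      · simp
      · intro w _ hw
        simp [hw]
      · simp
    | zero => simp
    | add x y _ _ hx hy => rw [map_add, hx, hy, add_zero]
    | smul r x _ hx => rw [map_smul, hx, smul_zero]
  refine ⟨psi G.det, P, hdet0, hPmem, hPperp, hPzero, fun h h1 => ?_, fun y z hy hz => ?_⟩
  · rw [hP, sub_eq_self]
    refine Finset.sum_eq_zero fun w _ => Finset.sum_eq_zero fun u _ => ?_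
    rw [h1 _ u.2, mul_zero, zero_smul]
  -- Each correction term contains the pairing of some `w` in `N` with `z` outside `N`, whose
  -- constant term is zero.
  · refine ⟨G.det * g y z - ∑ w : {z // nC z ∈ N}, ∑ u : {z // nC z ∈ N},
      A w u * g y u.1 * g w.1 z, ?_, ?_⟩
    · rw [hP, sub_mul, map_sub, smul_mul_assoc, map_smul,
        smul_eq_mul, hg, map_sub, RingHom.map_mul]
      simp only [Finset.sum_mul, map_sum, smul_mul_assoc, map_smul, smul_eq_mul,
        RingHom.map_mul, hg]
    · rw [Polynomial.coeff_sub, Polynomial.mul_coeff_zero, hdet, one_mul, hg',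
        Polynomial.finsetSum_coeff, Finset.sum_eq_zero, sub_zero]
      intro w _
      rw [Polynomial.finsetSum_coeff]
      refine Finset.sum_eq_zero fun u _ => ?_
      have : w.1 ≠ z := fun e => hz (e ▸ w.2)
      rw [Polynomial.mul_coeff_zero, hg' w.1 z, if_neg this, mul_zero]

/-- The trace form induces a trace form modulo a cell ideal, for which the Kazhdan–Lusztig basis is
almost orthonormal. -/
theorem IsCellIdeal.exists_trace {N : Submodule R (Hecke n)} (hN : IsCellIdeal N) :
    ∃ t : Hecke n →ₗ[R] R, (∀ x ∈ N, t x = 0) ∧ (∀ a h, t (a * h) = t (h * a)) ∧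
      ∀ y z, nC y ∉ N → nC z ∉ N → ∃ g : Polynomial ℤ,
        t (nC y * SymHecke.star (nC z)) = psi g ∧ g.coeff 0 = if y = z then 1 else 0 := by
  obtain ⟨δ, P, hδ, hPmem, hPperp, hPzero, hPself, hPg⟩ := hN.exists_projection
  -- These two properties characterize the projection. `N` and its orthogonal complement are stable
  -- under multiplication on both sides, so the projection is a bimodule map and the trace property
  -- descends.
  have huniq : ∀ a h, δ • h - a ∈ N → (∀ x ∈ N, coef 1 (a * SymHecke.star x) = 0) →
      a = P h := by
    intro a h h1 h2
    have h3 : a - P h ∈ N := by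
      have := N.sub_mem (hPmem h) h1
      rwa [sub_sub_sub_cancel_left] at this
    have h4 := hPself (a - P h) fun x hx => by
      rw [sub_mul, map_sub, h2 x hx, hPperp h x hx, sub_zero]
    rw [hPzero _ h3] at h4
    exact sub_eq_zero.1 (smul_eq_zero_of_ne hδ h4.symm)
  have hright : ∀ a h, P a * h = P (a * h) := by
    intro a h
    refine huniq _ _ ?_ fun x hx => ?_
    · rw [← smul_mul_assoc, ← sub_mul]
      exact hN.right _ _ (hPmem a)
    · have := hPperp a (x * SymHecke.star h) (hN.right _ _ hx)
      rwa [star_mul, star_star, ← mul_assoc] at this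
  have hleft : ∀ a h, a * P h = P (a * h) := by
    intro a h
    refine huniq _ _ ?_ fun x hx => ?_
    · rw [← mul_smul_comm, ← mul_sub]
      exact hN.left _ _ (hPmem h)
    · have := hPperp h (SymHecke.star a * x) (hN.left _ _ hx)
      rwa [star_mul, star_star, ← mul_assoc, coef_one_mul_comm, ← mul_assoc] at this
  refine ⟨(coef 1).comp P, fun x hx => ?_, fun a h => ?_, fun y z hy hz => ?_⟩
  · rw [LinearMap.comp_apply, hPzero x hx, map_zero]
  · rw [LinearMap.comp_apply, LinearMap.comp_apply, ← hright, coef_one_mul_comm, hleft]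
  · obtain ⟨g, hg, hg'⟩ := hPg y z hy hz
    exact ⟨g, by rw [LinearMap.comp_apply, ← hright, hg], hg'⟩

/-! ## Positivity -/

/-- A nonzero family of Laurent polynomials, in normalized form. -/
theorem exists_normalized {σ : Type*} [Fintype σ] (a : σ → R) (h : ∃ z, a z ≠ 0) :
    ∃ (k : ℤ) (p : σ → Polynomial ℤ), (∀ z, a z = qhalf k * psi (p z)) ∧
      ∃ z, (p z).coeff 0 ≠ 0 := by
  choose k p hp using fun z => exists_qhalf_mul_eq_psi (a z)
  obtain ⟨z₀, hz₀⟩ := h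
  -- As long as all constant terms vanish, X can be divided out of the whole family; the degree of
  -- the nonzero `p z₀` drops each time.
  have key : ∀ (d : ℕ) (k : ℤ) (p : σ → Polynomial ℤ), (∀ z, a z = qhalf k * psi (p z)) →
      (p z₀).natDegree = d → ∃ (k : ℤ) (p : σ → Polynomial ℤ),
        (∀ z, a z = qhalf k * psi (p z)) ∧ ∃ z, (p z).coeff 0 ≠ 0 := by
    intro d
    induction d using Nat.strong_induction_on with
    | _ d ih =>
      intro k p hp hd
      by_cases h0 : ∃ z, (p z).coeff 0 ≠ 0
      · exact ⟨k, p, hp, h0⟩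
      · push Not at h0
        have h1 : ∀ z, p z = Polynomial.X * (p z).divX := fun z => by
          conv_lhs => rw [← Polynomial.X_mul_divX_add (p z), h0, map_zero, add_zero]
        have h2 : (p z₀).divX ≠ 0 := by
          intro h
          apply hz₀
          rw [hp, h1, h, mul_zero, map_zero, mul_zero]
        refine ih (p z₀).divX.natDegree ?_ (k - 1) (fun z => (p z).divX) (fun z => ?_) rfl
        · rw [← hd]
          conv_rhs => rw [h1]
          rw [Polynomial.natDegree_X_mul h2]
          exact Nat.lt_succ_self _
        · rw [hp]
          conv_lhs => rw [h1]
          rw [map_mul, ← mul_assoc]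
          congr 1
          rw [← pow_one (Polynomial.X : Polynomial ℤ), psi_X_pow, qhalf_mul]
          rfl
  refine key _ (∑ z, (k z : ℤ)) (fun z => Polynomial.X ^ (∑ z, k z - k z) * p z) (fun z => ?_) rfl
  have hle : k z ≤ ∑ z, k z := Finset.single_le_sum (fun _ _ => Nat.zero_le _) (Finset.mem_univ z)
  rw [map_mul, psi_X_pow, ← hp, ← mul_assoc, ← mul_assoc, qhalf_mul, qhalf_mul]
  have : (∑ z, (k z : ℤ)) + -((∑ z, k z - k z : ℕ) : ℤ) + -(k z : ℤ) = 0 := by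
    push_cast [Nat.cast_sub hle]
    ring
  rw [this, qhalf_zero, one_mul]

/-- A nonzero shift would make one of the two polynomials divisible by X. -/
theorem eq_zero_of_qhalf_mul {k : ℤ} {f g : Polynomial ℤ} (hf : f.coeff 0 ≠ 0)
    (hg : g.coeff 0 ≠ 0) (h : qhalf k * psi f = psi g) : k = 0 := by
  rcases lt_trichotomy k 0 with hk | hk | hk
  · exfalso
    apply hg
    obtain ⟨m, rfl⟩ := Int.exists_eq_neg_ofNat hk.le
    rw [← psi_X_pow, ← map_mul] at h
    rw [← psi_injective h, Polynomial.mul_coeff_zero, Polynomial.coeff_X_pow, if_neg (by omega),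
      zero_mul]
  · exact hk
  · exfalso
    apply hf
    obtain ⟨m, rfl⟩ := Int.eq_ofNat_of_zero_le hk.le
    have h1 : psi f = psi (Polynomial.X ^ m * g) := by
      rw [map_mul, psi_X_pow, ← h, ← mul_assoc, qhalf_mul, neg_add_cancel, qhalf_zero, one_mul]
    rw [psi_injective h1, Polynomial.mul_coeff_zero, Polynomial.coeff_X_pow, if_neg (by omega),
      zero_mul]

/-- The image of `psi` has only nonpositive exponents, and invariance makes the set of exponents
symmetric. -/
theorem eq_C_of_invert_psi {p : Polynomial ℤ} (h : LaurentPolynomial.invert (psi p) = psi p) :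
    p = Polynomial.C (p.coeff 0) := by
  rw [psi_apply, invert_invert] at h
  have h2 : ∀ (p : Polynomial ℤ) (m : ℕ), p.toLaurent.coeff (m : ℤ) = p.coeff m := fun p m =>
    Finsupp.mapDomain_apply Nat.castEmbedding.injective p.toFinsupp.coeff m
  ext m
  rcases Nat.eq_zero_or_pos m with rfl | hm
  · simp
  · rw [Polynomial.coeff_C, if_neg hm.ne']
    have h1 := congrArg (fun f : R => f.coeff (m : ℤ)) h
    rw [h2, LaurentPolynomial.invert_apply, LaurentPolynomial.coeff_toLaurent,
      Finsupp.mapDomain_of_notMem_range] at h1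
    · exact h1
    · rintro ⟨k, hk⟩
      simp only [Nat.castEmbedding_apply] at hk
      omega

theorem exists_sum_sq_eq_one {σ : Type*} [Fintype σ] [DecidableEq σ] {a : σ → ℤ}
    (h : ∑ z, a z ^ 2 = 1) : ∃ z, (a z = 1 ∨ a z = -1) ∧ ∀ y, y ≠ z → a y = 0 := by
  obtain ⟨z, -, hz⟩ := Finset.exists_ne_zero_of_sum_ne_zero (by rw [h]; exact one_ne_zero)
  have h1 : a z ≠ 0 := fun e => hz (by rw [e]; rfl)
  have h2 : 1 ≤ a z ^ 2 := by
    have := sq_pos_of_ne_zero h1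
    omega
  rw [← Finset.add_sum_erase _ _ (Finset.mem_univ z)] at h
  have h3 : 0 ≤ ∑ y ∈ Finset.univ.erase z, a y ^ 2 := Finset.sum_nonneg fun y _ => sq_nonneg _
  have h4 : ∑ y ∈ Finset.univ.erase z, a y ^ 2 = 0 := by omega
  have h5 : a z ^ 2 = 1 := by omega
  refine ⟨z, by simpa using sq_eq_one_iff.1 h5, fun y hy => ?_⟩
  rw [Finset.sum_eq_zero_iff_of_nonneg fun y _ => sq_nonneg _] at h4
  exact pow_eq_zero_iff two_ne_zero |>.1 (h4 y (Finset.mem_erase.2 ⟨hy, Finset.mem_univ y⟩))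

/-! ## Ideals generated by a parabolic element -/

theorem qhalf_sq (k : ℤ) : qhalf k * qhalf k = qhalf (2 * k) := by
  rw [qhalf_mul, two_mul]

/-- A bar invariant element whose norm for a trace form modulo a cell ideal is a quotient of
polynomials in `q^{-1/2}` with constant term `1` is, up to sign, a Kazhdan–Lusztig element modulo
the ideal. -/
theorem IsCellIdeal.exists_sub_nC_mem {N : Submodule R (Hecke n)} (hN : IsCellIdeal N)
    {t : Hecke n →ₗ[R] R} (ht : ∀ x ∈ N, t x = 0)
    (htg : ∀ y z, nC y ∉ N → nC z ∉ N → ∃ g : Polynomial ℤ,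
      t (nC y * SymHecke.star (nC z)) = psi g ∧ g.coeff 0 = if y = z then 1 else 0)
    {e : Hecke n} (he : bar e = e) {f g : Polynomial ℤ} (hf : f.coeff 0 = 1)
    (hg : g.coeff 0 = 1) (h : psi f * t (e * SymHecke.star e) = psi g) :
    ∃ z, nC z ∉ N ∧ (e - nC z ∈ N ∨ e + nC z ∈ N) := by
  classical
  have hsum : e = ∑ z, coefC z e • nC z := (sum_coefC e).symm
  have hinv : ∀ z, LaurentPolynomial.invert (coefC z e) = coefC z e := by
    intro z
    have h1 : e = ∑ z, LaurentPolynomial.invert (coefC z e) • nC z := by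
      conv_lhs => rw [← he, hsum, bar_sum]
      exact Finset.sum_congr rfl fun z _ => by rw [bar_smul, bar_nC]
    conv_rhs => rw [h1, coefC_sum]
  -- Only the coefficients outside `N` matter, and only there is the Gram matrix known to be almost
  -- the identity.
  obtain ⟨a, ha⟩ : ∃ a : Equiv.Perm (Fin n) → R, ∀ z, a z = if nC z ∈ N then 0 else coefC z e :=
    ⟨_, fun _ => rfl⟩
  set e' := ∑ z, a z • nC z with he'
  have hmem : e - e' ∈ N := by
    rw [hsum, he', ← Finset.sum_sub_distrib]
    refine N.sum_mem fun z _ => ?_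
    rw [ha]
    split_ifs with hz
    · rw [zero_smul, sub_zero]
      exact N.smul_mem _ hz
    · rw [sub_self]
      exact N.zero_mem
  have ht' : t (e * SymHecke.star e) = t (e' * SymHecke.star e') := by
    have h1 : e * SymHecke.star e - e' * SymHecke.star e' =
        (e - e') * SymHecke.star e + e' * SymHecke.star (e - e') := by
      rw [map_sub, sub_mul, mul_sub]
      abel
    rw [← sub_eq_zero, ← map_sub, h1]
    exact ht _ (N.add_mem (hN.right _ _ hmem) (hN.left _ _ (hN.star _ hmem)))
  have hne : ∃ z, a z ≠ 0 := by
    by_contra! h0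
    have h1 : e' = 0 := by simp [he', h0]
    rw [ht', h1, zero_mul, map_zero, mul_zero, ← psi.map_zero] at h
    rw [← psi_injective h] at hg
    simp at hg
  obtain ⟨k, p, hp, z₀, hz₀⟩ := exists_normalized a hne
  have hpN : ∀ z, nC z ∈ N → p z = 0 := by
    intro z hz
    have h1 := hp z
    rw [ha, if_pos hz, eq_comm, mul_eq_zero] at h1
    exact psi_injective ((h1.resolve_left (qhalf_ne_zero k)).trans psi.map_zero.symm)
  have hG : ∀ y z, ∃ G : Polynomial ℤ, nC y ∉ N → nC z ∉ N →
      t (nC y * SymHecke.star (nC z)) = psi G ∧ G.coeff 0 = if y = z then 1 else 0 := by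
    intro y z
    by_cases hy : nC y ∈ N
    · exact ⟨0, fun h => absurd hy h⟩
    · by_cases hz : nC z ∈ N
      · exact ⟨0, fun _ h => absurd hz h⟩
      · obtain ⟨G, hG⟩ := htg y z hy hz
        exact ⟨G, fun _ _ => hG⟩
  choose G hG using hG
  set Q : Polynomial ℤ := ∑ y, ∑ z, p y * p z * G y z with hQ
  have htQ : t (e' * SymHecke.star e') = qhalf (2 * k) * psi Q := by
    rw [he', map_sum, Finset.sum_mul_sum, map_sum, hQ, map_sum, Finset.mul_sum]
    refine Finset.sum_congr rfl fun y _ => ?_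
    rw [map_sum, map_sum, Finset.mul_sum]
    refine Finset.sum_congr rfl fun z _ => ?_
    rw [map_smul, smul_mul_smul_comm, map_smul, smul_eq_mul, hp, hp, RingHom.map_mul,
      RingHom.map_mul, ← qhalf_sq]
    by_cases hy : nC y ∈ N
    · rw [hpN y hy, RingHom.map_zero]
      ring
    · by_cases hz : nC z ∈ N
      · rw [hpN z hz, RingHom.map_zero]
        ring
      · rw [(hG y z hy hz).1]
        ring
  have hQ0 : Q.coeff 0 = ∑ z, (p z).coeff 0 ^ 2 := by
    rw [hQ, Polynomial.finsetSum_coeff]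
    refine Finset.sum_congr rfl fun y _ => ?_
    rw [Polynomial.finsetSum_coeff, Finset.sum_eq_single y]
    · rw [Polynomial.mul_coeff_zero, Polynomial.mul_coeff_zero, ← sq]
      by_cases hy : nC y ∈ N
      · rw [hpN y hy]
        simp
      · rw [(hG y y hy hy).2, if_pos rfl, mul_one]
    · intro z _ hz
      rw [Polynomial.mul_coeff_zero, Polynomial.mul_coeff_zero]
      by_cases hy : nC y ∈ N
      · rw [hpN y hy]
        simp
      · by_cases hz' : nC z ∈ N
        · rw [hpN z hz']
          simp
        · rw [(hG y z hy hz').2, if_neg hz.symm, mul_zero]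
    · simp
  -- The constant term is a sum of squares of integers, so the leading coefficients cannot cancel.
  -- Comparison with the prescribed norm then forces `k = 0` and makes that sum equal to 1.
  have hQpos : Q.coeff 0 ≠ 0 := by
    rw [hQ0]
    refine (Finset.sum_pos' (fun z _ => sq_nonneg _) ⟨z₀, Finset.mem_univ _, ?_⟩).ne'
    exact sq_pos_of_ne_zero hz₀
  have h1 : qhalf (2 * k) * psi (f * Q) = psi g := by
    rw [← h, ht', htQ, RingHom.map_mul]
    ring
  have hfQ : (f * Q).coeff 0 ≠ 0 := by
    rw [Polynomial.mul_coeff_zero, hf, one_mul]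
    exact hQpos
  have hk := eq_zero_of_qhalf_mul hfQ (by rw [hg]; exact one_ne_zero) h1
  have hk0 : k = 0 := by omega
  rw [hk, qhalf_zero, one_mul] at h1
  have h2 : ∑ z, (p z).coeff 0 ^ 2 = 1 := by
    rw [← hQ0, ← hg, ← psi_injective h1, Polynomial.mul_coeff_zero, hf, one_mul]
  obtain ⟨z, hz, hz'⟩ := exists_sum_sq_eq_one h2
  -- With `k = 0`, each coefficient is a bar invariant polynomial in q^{-1/2}, hence an integer.
  have hpC : ∀ y, a y = psi (Polynomial.C ((p y).coeff 0)) := by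
    intro y
    have h3 := hp y
    rw [hk0, qhalf_zero, one_mul] at h3
    rw [← eq_C_of_invert_psi, h3]
    rw [← h3, ha]
    split_ifs
    · exact map_zero _
    · exact hinv y
  have h3 : e' = psi (Polynomial.C ((p z).coeff 0)) • nC z := by
    rw [he', Finset.sum_eq_single z, hpC]
    · intro y _ hy
      rw [hpC, hz' y hy, map_zero, map_zero, zero_smul]
    · simp
  refine ⟨z, fun hzN => ?_, ?_⟩
  · rw [hpN z hzN] at hz
    simp at hz
  · rcases hz with hz | hz
    · left
      rw [h3, hz, map_one, map_one, one_smul] at hmem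
      exact hmem
    · right
      rw [h3, hz, map_neg, map_neg, map_one, map_one, neg_smul, one_smul, sub_neg_eq_add] at hmem
      exact hmem

theorem mul_mul_star_mul {c : Hecke n} (hc : star c = c) {p : R} (hp : c * c = p • c)
    (a b : Hecke n) : a * c * star (b * c) = p • (a * c * star b) := by
  rw [star_mul, hc, ← mul_assoc, mul_assoc a, hp, mul_smul_comm, smul_mul_assoc]

/-- The products `h c k*` for Kazhdan–Lusztig elements `h c` and `k c` are, up to sign,
Kazhdan–Lusztig elements modulo a cell ideal `N`, if `c` spans `c H c` modulo `N`. -/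
theorem IsCellIdeal.exists_mul_sub_nC_mem {N : Submodule R (Hecke n)} (hN : IsCellIdeal N)
    {v : Equiv.Perm (Fin n)} (hv : nC v ∉ N) (hstar : SymHecke.star (nC v) = nC v) {p : R}
    (hp0 : p ≠ 0) (hp : nC v * nC v = p • nC v)
    (hrank : ∀ k, ∃ κ : R, nC v * k * nC v - κ • nC v ∈ N) {y x : Equiv.Perm (Fin n)}
    (hy : nC y ∉ N) (hx : nC x ∉ N) {h k : Hecke n} (hh : nC y = h * nC v)
    (hk : nC x = k * nC v) :
    ∃ z, nC z ∉ N ∧ (h * nC v * SymHecke.star k - nC z ∈ N ∨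
      h * nC v * SymHecke.star k + nC z ∈ N) := by
  obtain ⟨t, ht, htc, htg⟩ := hN.exists_trace
  have hp' : LaurentPolynomial.invert p = p := by
    have h1 := congrArg bar hp
    rw [bar_mul, bar_smul, bar_nC, hp] at h1
    have h2 := congrArg (coefC v) h1
    rw [map_smul, map_smul, coefC_nC, if_pos rfl, smul_eq_mul, smul_eq_mul, mul_one, mul_one] at h2
    exact h2.symm
  have hsk := mul_mul_star_mul hstar hp
  have hE : p • (h * nC v * SymHecke.star k) = nC y * SymHecke.star (nC x) := by
    rw [hk, hh, hsk]
  -- Up to the bar invariant factor `p`, this element is a product of two bar invariant elements;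
  -- the factor cancels because H is torsion-free.
  have hbar : bar (h * nC v * SymHecke.star k) = h * nC v * SymHecke.star k := by
    have h1 := congrArg bar hE
    rw [bar_mul, bar_smul, hp', star_nC, bar_nC, bar_nC, ← star_nC, ← hE, ← sub_eq_zero,
      ← smul_sub] at h1
    exact sub_eq_zero.1 (smul_eq_zero_of_ne hp0 h1)
  -- Rank one factorizes the norm. The unknown scalars κ, p, t(c) and t(h c h*) occur equally on
  -- both sides of t(ee*) t(cc*) = t(yy*) t(xx*), so they need not be computed.
  obtain ⟨κ, hκ⟩ := hrank (SymHecke.star k * k)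
  have hmod : ∀ a b : Hecke n, a - b ∈ N → t a = t b := by
    intro a b hab
    rw [← sub_eq_zero, ← map_sub]
    exact ht _ hab
  have e1 : t (h * nC v * SymHecke.star k * SymHecke.star (h * nC v * SymHecke.star k)) =
      κ * t (h * nC v * SymHecke.star h) := by
    refine (hmod _ (κ • (h * nC v * SymHecke.star h)) ?_).trans (by rw [map_smul, smul_eq_mul])
    have := hN.right (SymHecke.star h) _ (hN.left h _ hκ)
    rw [mul_sub, sub_mul] at this
    convert this using 2
    · rw [star_mul, star_star, star_mul, hstar]
      simp only [mul_assoc]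
    · rw [mul_smul_comm, smul_mul_assoc]
  have e2 : t (nC x * SymHecke.star (nC x)) = κ * t (nC v) := by
    rw [htc, hk]
    refine (hmod _ (κ • nC v) ?_).trans (by rw [map_smul, smul_eq_mul])
    rw [star_mul, hstar]
    convert hκ using 2
    simp only [mul_assoc]
  have e3 : t (nC y * SymHecke.star (nC y)) = p * t (h * nC v * SymHecke.star h) := by
    rw [hh, hsk, map_smul, smul_eq_mul]
  have e4 : t (nC v * SymHecke.star (nC v)) = p * t (nC v) := by
    rw [hstar, hp, map_smul, smul_eq_mul]
  obtain ⟨gv, hgv, hgv'⟩ := htg v v hv hv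
  obtain ⟨gx, hgx, hgx'⟩ := htg x x hx hx
  obtain ⟨gy, hgy, hgy'⟩ := htg y y hy hy
  rw [if_pos rfl] at hgv' hgx' hgy'
  refine hN.exists_sub_nC_mem ht htg hbar hgv' (g := gx * gy) ?_ ?_
  · rw [Polynomial.mul_coeff_zero, hgx', hgy', mul_one]
  · rw [RingHom.map_mul, ← hgv, ← hgx, ← hgy, e1, e2, e3, e4]
    ring

/-- The two-sided ideal generated by the parabolic element of `b`. -/
def parIdeal (b : Fin n → Fin n) : Submodule R (Hecke n) :=
  Submodule.span R {x | ∃ a a', x = a * parSum b * a'}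

theorem mul_mem_parIdeal {b : Fin n → Fin n} (a : Hecke n) {x : Hecke n} (hx : x ∈ parIdeal b) :
    a * x ∈ parIdeal b := by
  induction hx using Submodule.span_induction with
  | mem x hx =>
    obtain ⟨c, c', rfl⟩ := hx
    exact Submodule.subset_span ⟨a * c, c', by simp only [mul_assoc]⟩
  | zero => simp
  | add x y _ _ hx hy => rw [mul_add]; exact Submodule.add_mem _ hx hy
  | smul r x _ hx => rw [mul_smul_comm]; exact Submodule.smul_mem _ r hx

theorem mem_parIdeal_mul {b : Fin n → Fin n} (a : Hecke n) {x : Hecke n} (hx : x ∈ parIdeal b) :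
    x * a ∈ parIdeal b := by
  induction hx using Submodule.span_induction with
  | mem x hx =>
    obtain ⟨c, c', rfl⟩ := hx
    exact Submodule.subset_span ⟨c, c' * a, by simp only [mul_assoc]⟩
  | zero => simp
  | add x y _ _ hx hy => rw [add_mul]; exact Submodule.add_mem _ hx hy
  | smul r x _ hx => rw [smul_mul_assoc]; exact Submodule.smul_mem _ r hx

theorem star_mem_parIdeal {b : Fin n → Fin n} {x : Hecke n} (hx : x ∈ parIdeal b) :
    star x ∈ parIdeal b := by
  induction hx using Submodule.span_induction with
  | mem x hx =>
    obtain ⟨c, c', rfl⟩ := hx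
    exact Submodule.subset_span ⟨star c', star c, by
      rw [star_mul, star_mul, star_parSum, mul_assoc]⟩
  | zero => simp
  | add x y _ _ hx hy => rw [map_add]; exact Submodule.add_mem _ hx hy
  | smul r x _ hx => rw [map_smul]; exact Submodule.smul_mem _ r hx

theorem parSum_mem_parIdeal (b : Fin n → Fin n) : parSum b ∈ parIdeal b :=
  Submodule.subset_span ⟨1, 1, by rw [one_mul, mul_one]⟩

theorem parSum_mul_T {b : Fin n → Fin n} (hb : Monotone b) {w : Equiv.Perm (Fin n)}
    (hw : Fixes b w) : parSum b * T w = q ^ len w • parSum b := by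
  induction w, hw using fixes_induction hb with
  | one => rw [← one_def, mul_one, len_one, pow_zero, one_smul]
  | mul i j hij hbij u hu h ih =>
    have hs : Equiv.swap i j ∈ simples n := ⟨i, j, hij, rfl⟩
    have h1 := (lt_len_mul_swap u hij).2 h
    have h2 := len_mul_simple hs u
    have h3 : len (u * Equiv.swap i j) = len u + 1 := by omega
    rw [T_mul_simple_of_lt hs h1, ← mul_assoc, ih, smul_mul_assoc,
      parSum_mem_eigen b i j hij hbij, smul_smul, h3, pow_succ]

/-- The factor is the Poincaré polynomial of the subgroup, the sum of q^{ℓ(w)}; at q = 1 it becomes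
the order of the subgroup. -/
theorem exists_parSum_mul_self {b : Fin n → Fin n} (hb : Monotone b) :
    ∃ p : R, p ≠ 0 ∧ parSum b * parSum b = p • parSum b := by
  classical
  refine ⟨∑ w, coef w (parSum b) * q ^ len w, fun h => ?_, ?_⟩
  · have h1 := congrArg evalOne h
    have h2 : ∀ w, evalOne (coef w (parSum b) * q ^ len w) = if Fixes b w then 1 else 0 := by
      intro w
      rw [map_mul, map_pow, q, evalOne_qhalf, one_pow, mul_one, coef_parSum]
      split_ifs <;> simp
    rw [map_sum, map_zero, Finset.sum_congr rfl fun w _ => h2 w,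
      Finset.sum_eq_zero_iff_of_nonneg fun w _ => by split_ifs <;> simp] at h1
    have h3 := h1 1 (Finset.mem_univ 1)
    rw [if_pos (Fixes.one b)] at h3
    exact one_ne_zero h3
  · calc parSum b * parSum b = parSum b * ∑ w, coef w (parSum b) • T w := by rw [sum_coef_T]
      _ = _ := by
        rw [Finset.mul_sum, Finset.sum_smul]
        refine Finset.sum_congr rfl fun w _ => ?_
        rw [mul_smul_comm]
        by_cases hw : Fixes b w
        · rw [parSum_mul_T hb hw, smul_smul]
        · rw [coef_parSum, if_neg hw, zero_smul, zero_mul, zero_smul]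

/-- Adding the ideal generated by a parabolic element to a cell ideal that contains those of the
larger fillings gives a cell ideal. -/
theorem IsCellIdeal.sup_parIdeal {N : Submodule R (Hecke n)} (hN : IsCellIdeal N)
    {b : Fin n → Fin n} (hb : Monotone b) (hbN : parSum b ∉ N)
    (hlt : ∀ b' : Fin n → Fin n, Monotone b' → aval b < aval b' → parSum b' ∈ N) :
    IsKLSpanned (N ⊔ parIdeal b) := by
  obtain ⟨v, hv, hmax⟩ := exists_longest b
  have hC := parSum_eq_C hb hv hmax
  have hcv : parSum b = qhalf (len v : ℤ) • nC v := by rw [hC, C_eq_smul_nC]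
  have hvc : nC v = qhalf (-(len v : ℤ)) • parSum b := by rw [hC, nC]
  have hvN : nC v ∉ N := fun h => hbN (by rw [hcv]; exact N.smul_mem _ h)
  have hstar : SymHecke.star (nC v) = nC v := by rw [hvc, map_smul, star_parSum]
  obtain ⟨p, hp0, hp⟩ := exists_parSum_mul_self hb
  have hp' : nC v * nC v = (qhalf (-(len v : ℤ)) * p) • nC v := by
    rw [hvc, smul_mul_smul_comm, hp, smul_smul, smul_smul]
    congr 1
    ring
  have hrank : ∀ k, ∃ κ : R, nC v * k * nC v - κ • nC v ∈ N := by
    intro k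
    obtain ⟨κ, hκ⟩ := exists_parSum_mul_mul_parSum hb hN.spanned hN.left hN.right hlt k
    refine ⟨qhalf (-(len v : ℤ)) * κ, ?_⟩
    have := N.smul_mem (qhalf (-(len v : ℤ)) * qhalf (-(len v : ℤ))) hκ
    convert this using 1
    rw [hvc, smul_mul_assoc, smul_mul_smul_comm, smul_sub, smul_smul, smul_smul]
    congr 2
    ring
  have hgen : ∀ y, nC y ∈ eigen b → ∃ h, nC y = h * nC v := by
    intro y hy
    obtain ⟨g, hg⟩ := exists_mul_parSum hb hy
    exact ⟨qhalf (len v : ℤ) • g, by rw [hg, hcv, mul_smul_comm, smul_mul_assoc]⟩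
  -- The value 0 outside the eigenspace only serves to make `H` a total function.
  have hgen' : ∀ y, ∃ h, nC y ∈ eigen b → nC y = h * nC v := by
    intro y
    by_cases hy : nC y ∈ eigen b
    · obtain ⟨h, hh⟩ := hgen y hy
      exact ⟨h, fun _ => hh⟩
    · exact ⟨0, fun h => absurd h hy⟩
  choose H hH using hgen'
  set Z := {z | nC z ∈ N ⊔ parIdeal b} with hZ
  have hspan : Submodule.span R (C '' Z) ≤ N ⊔ parIdeal b := by
    rw [Submodule.span_le]
    rintro _ ⟨z, hz, rfl⟩
    rw [C_eq_smul_nC]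
    exact Submodule.smul_mem _ _ hz
  have hNZ : N ≤ Submodule.span R (C '' Z) := by
    rw [hN.spanned.eq_span]
    exact Submodule.span_mono (Set.image_mono fun z hz => Submodule.mem_sup_left hz)
  have hcJ : nC v ∈ parIdeal b := by
    rw [hvc]
    exact Submodule.smul_mem _ _ (parSum_mem_parIdeal b)
  -- If one of the two elements lies in `N`, so does the product, after cancelling the scalar.
  -- Otherwise the product is, up to sign, a Kazhdan–Lusztig element modulo `N`, which then lies in
  -- N + J_b.
  have hE : ∀ y x, nC y ∈ eigen b → nC x ∈ eigen b →
      H y * nC v * SymHecke.star (H x) ∈ Submodule.span R (C '' Z) := by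
    intro y x hy hx
    have h0 : (qhalf (-(len v : ℤ)) * p) • (H y * nC v * SymHecke.star (H x)) =
        nC y * SymHecke.star (nC x) := by
      rw [hH y hy, hH x hx, mul_mul_star_mul hstar hp']
    have hne : qhalf (-(len v : ℤ)) * p ≠ 0 := mul_ne_zero (qhalf_ne_zero _) hp0
    by_cases hyN : nC y ∈ N
    · exact hNZ (hN.spanned.mem_of_smul_mem hne (by rw [h0]; exact hN.right _ _ hyN))
    · by_cases hxN : nC x ∈ N
      · exact hNZ (hN.spanned.mem_of_smul_mem hne
          (by rw [h0]; exact hN.left _ _ (hN.star _ hxN)))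
      · obtain ⟨z, -, hz⟩ := hN.exists_mul_sub_nC_mem hvN hstar hne hp' hrank hyN hxN (hH y hy)
          (hH x hx)
        have hEJ : H y * nC v * SymHecke.star (H x) ∈ N ⊔ parIdeal b :=
          Submodule.mem_sup_right (mem_parIdeal_mul _ (mul_mem_parIdeal _ hcJ))
        have key : ∀ m ∈ N, (nC z = H y * nC v * SymHecke.star (H x) - m ∨
            nC z = m - H y * nC v * SymHecke.star (H x)) → nC z ∈ Submodule.span R (C '' Z) := by
          intro m hm h1
          have hzZ : z ∈ Z := by
            rcases h1 with h1 | h1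
            · rw [hZ, Set.mem_ofPred_eq, h1]
              exact Submodule.sub_mem _ hEJ (Submodule.mem_sup_left hm)
            · rw [hZ, Set.mem_ofPred_eq, h1]
              exact Submodule.sub_mem _ (Submodule.mem_sup_left hm) hEJ
          rw [nC]
          exact Submodule.smul_mem _ _ (Submodule.subset_span ⟨z, hzZ, rfl⟩)
        rcases hz with hz | hz
        · have h1 := key _ hz (Or.inl (by abel))
          have := Submodule.add_mem _ (hNZ hz) h1
          rwa [sub_add_cancel] at this
        · have h1 := key _ hz (Or.inr (by abel))
          have := Submodule.sub_mem _ (hNZ hz) h1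
          rwa [add_sub_cancel_right] at this
  -- `a * nC v` lies in the eigenspace, so it expands in Kazhdan–Lusztig elements of the form `H y *
  -- nC v`. Doing this on both sides shows that the products in `hE` span J_b.
  have hexp : ∀ a, ∃ h, a * nC v = h * nC v ∧ ∃ α : Equiv.Perm (Fin n) → R,
      h = ∑ y, α y • H y ∧ ∀ y, α y ≠ 0 → nC y ∈ eigen b := by
    intro a
    have h1 : a * nC v ∈ eigen b := by
      rw [hvc]
      exact mul_mem_eigen ((eigen b).smul_mem _ (parSum_mem_eigen b)) a
    refine ⟨_, ?_, fun y => coefC y (a * nC v), rfl, isKLSpanned_eigen b _ h1⟩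
    conv_lhs => rw [← sum_coefC (a * nC v)]
    rw [Finset.sum_mul]
    refine Finset.sum_congr rfl fun y _ => ?_
    change _ = coefC y (a * nC v) • H y * nC v
    by_cases h0 : coefC y (a * nC v) = 0
    · rw [h0, zero_smul, zero_smul, zero_mul]
    · rw [smul_mul_assoc, ← hH y (isKLSpanned_eigen b _ h1 y h0)]
  have hJ : parIdeal b ≤ Submodule.span R (C '' Z) := by
    rw [parIdeal, Submodule.span_le]
    rintro _ ⟨a, a', rfl⟩
    obtain ⟨h, hh, α, rfl, hα⟩ := hexp a
    obtain ⟨h', hh', β, rfl, hβ⟩ := hexp (SymHecke.star a')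
    have e : a * nC v * a' = (∑ y, α y • H y) * nC v * SymHecke.star (∑ x, β x • H x) := by
      have h2 := congrArg SymHecke.star hh'
      rw [star_mul, star_mul, star_star, hstar] at h2
      rw [hh, mul_assoc, mul_assoc, h2]
    rw [SetLike.mem_coe, hcv, mul_smul_comm, smul_mul_assoc, e]
    refine Submodule.smul_mem _ _ ?_
    rw [Finset.sum_mul, map_sum, Finset.sum_mul_sum]
    refine Submodule.sum_mem _ fun y _ => Submodule.sum_mem _ fun x _ => ?_
    by_cases hy : α y = 0
    · rw [hy, zero_smul, zero_mul, zero_mul]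
      exact Submodule.zero_mem _
    · by_cases hx : β x = 0
      · rw [hx, zero_smul, map_zero, mul_zero]
        exact Submodule.zero_mem _
      · rw [map_smul, smul_mul_assoc, smul_mul_smul_comm]
        exact Submodule.smul_mem _ _ (hE y x (hα y hy) (hβ x hx))
  rw [le_antisymm (sup_le hNZ hJ) hspan]
  exact isKLSpanned_span Z

/-! ## The filtration by the ideals of the parabolic elements -/

/-- The sum of the ideals generated by the parabolic elements of the fillings with value greater
than `k`. -/
def parFiltration (n k : ℕ) : Submodule R (Hecke n) :=
  ⨆ b : {b : Fin n → Fin n // Monotone b ∧ k < aval b}, parIdeal b.1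

theorem parIdeal_le_parFiltration {k : ℕ} {b : Fin n → Fin n} (hb : Monotone b)
    (h : k < aval b) : parIdeal b ≤ parFiltration n k :=
  le_iSup (fun b : {b : Fin n → Fin n // Monotone b ∧ k < aval b} => parIdeal b.1) ⟨b, hb, h⟩

theorem isCellIdeal_parFiltration {k : ℕ} (h : IsKLSpanned (parFiltration n k)) :
    IsCellIdeal (parFiltration n k) where
  spanned := h
  left a x hx := by
    induction hx using Submodule.iSup_induction' with
    | mem i x hx => exact Submodule.mem_iSup_of_mem i (mul_mem_parIdeal a hx)
    | zero => simp
    | add x y _ _ hx hy => rw [mul_add]; exact Submodule.add_mem _ hx hy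
  right a x hx := by
    induction hx using Submodule.iSup_induction' with
    | mem i x hx => exact Submodule.mem_iSup_of_mem i (mem_parIdeal_mul a hx)
    | zero => simp
    | add x y _ _ hx hy => rw [add_mul]; exact Submodule.add_mem _ hx hy
  star x hx := by
    induction hx using Submodule.iSup_induction' with
    | mem i x hx => exact Submodule.mem_iSup_of_mem i (star_mem_parIdeal hx)
    | zero => simp
    | add x y _ _ hx hy => rw [map_add]; exact Submodule.add_mem _ hx hy

theorem IsCellIdeal.parIdeal_le {N : Submodule R (Hecke n)} (hN : IsCellIdeal N)
    {b : Fin n → Fin n} (h : parSum b ∈ N) : parIdeal b ≤ N := by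
  rw [parIdeal, Submodule.span_le]
  rintro _ ⟨a, a', rfl⟩
  exact hN.right _ _ (hN.left _ _ h)

theorem IsCellIdeal.isKLSpanned_sup_parIdeal {k : ℕ} (hN : IsCellIdeal (parFiltration n k))
    {b : Fin n → Fin n} (hb : Monotone b) (hbk : k ≤ aval b) :
    IsKLSpanned (parFiltration n k ⊔ parIdeal b) := by
  by_cases h : parSum b ∈ parFiltration n k
  · rw [sup_eq_left.2 (hN.parIdeal_le h)]
    exact hN.spanned
  · exact hN.sup_parIdeal hb h fun b' hb' hlt =>
      parIdeal_le_parFiltration hb' (hbk.trans_lt hlt) (parSum_mem_parIdeal b')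

/-- Downward induction on `k`, starting where no filling has larger `aval`: N_k is the sum of the
modules N_{k+1} + J_b over the fillings with `aval b > k`. -/
theorem isKLSpanned_parFiltration (n k : ℕ) : IsKLSpanned (parFiltration n k) := by
  obtain ⟨m, hm⟩ : ∃ m, ∀ b : Fin n → Fin n, aval b ≤ k + m := by
    obtain ⟨m, hm⟩ := (Set.finite_range (aval : (Fin n → Fin n) → ℕ)).bddAbove
    exact ⟨m, fun b => (hm ⟨b, rfl⟩).trans (Nat.le_add_left _ _)⟩
  induction m generalizing k with
  | zero => exact isKLSpanned_iSup fun b => absurd b.2.2 (hm b.1).not_gt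
  | succ m ih =>
    have hN := isCellIdeal_parFiltration (ih (k + 1) fun b => (hm b).trans (by omega))
    have e : parFiltration n k = ⨆ b : {b : Fin n → Fin n // Monotone b ∧ k < aval b},
        (parFiltration n (k + 1) ⊔ parIdeal b.1) := by
      apply le_antisymm
      · exact iSup_mono fun b => le_sup_right
      · refine iSup_le fun b => sup_le ?_ (parIdeal_le_parFiltration b.2.1 b.2.2)
        exact iSup_le fun b' => parIdeal_le_parFiltration b'.2.1 (by have := b'.2.2; omega)
    rw [e]
    exact isKLSpanned_iSup fun b => hN.isKLSpanned_sup_parIdeal b.2.1 b.2.2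

/-- Right multiplication into the sign element of `col b` separates the two: x_β H y_{col b} = 0
whenever `aval β > aval b`, while x_b T_d y_{col b} is nonzero for a transversal `d`. -/
theorem parSum_notMem_parFiltration (b : Fin n → Fin n) :
    parSum b ∉ parFiltration n (aval b) := by
  intro h
  have key : ∀ x ∈ parFiltration n (aval b), ∀ a, x * a * sgnSum (col b) = 0 := by
    intro x hx
    induction hx using Submodule.iSup_induction' with
    | mem i x hx =>
      induction hx using Submodule.span_induction with
      | mem x hx =>
        obtain ⟨c, c', rfl⟩ := hx
        intro a
        have h1 : parSum i.1 * (c' * a) * sgnSum (col b) = 0 := by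
          refine parSum_mul_mul_sgnSum_eq_zero i.2.1 (col_monotone b) (fun w hw => ?_) _
          have := hw.aval_le
          rw [sum_col] at this
          exact this.not_gt i.2.2
        have h2 : c * parSum i.1 * c' * a * sgnSum (col b) =
            c * (parSum i.1 * (c' * a) * sgnSum (col b)) := by simp only [mul_assoc]
        rw [h2, h1, mul_zero]
      | zero => simp
      | add x y _ _ hx hy => intro a; rw [add_mul, add_mul, hx, hy, add_zero]
      | smul r x _ hx => intro a; rw [smul_mul_assoc, smul_mul_assoc, hx, smul_zero]
    | zero => simp
    | add x y _ _ hx hy => intro a; rw [add_mul, add_mul, hx, hy, add_zero]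
  exact parSum_mul_sgnSum_ne_zero (col_transversal b) (key _ h _)

/-! ## Two-sided ideals as sub-bimodules -/

theorem smul_mem_ideal (I : Ideal2 n) (r : R) {x : Hecke n} (hx : x ∈ I) : r • x ∈ I := by
  have := I.smul_mem (tens (r • 1) 1) hx
  rwa [tens_smul, smul_mul_assoc, one_mul, mul_one] at this

/-- A submodule stable under multiplication on both sides, as a sub-bimodule. -/
def toIdeal {N : Submodule R (Hecke n)} (hl : ∀ a, ∀ x ∈ N, a * x ∈ N)
    (hr : ∀ a, ∀ x ∈ N, x * a ∈ N) : Ideal2 n where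
  carrier := N
  add_mem' := N.add_mem
  zero_mem' := N.zero_mem
  smul_mem' e x hx := by
    refine TensorProduct.induction_on
      (motive := fun e => @HSMul.hSMul (Env n) (Hecke n) (Hecke n) _ e x ∈ N) e ?_ ?_ ?_
    · change (0 : Env n) • x ∈ N
      rw [zero_smul]
      exact N.zero_mem
    · intro a a'
      have := tens_smul a (MulOpposite.unop a') x
      rw [tens, MulOpposite.op_unop] at this
      rw [this]
      exact hr _ _ (hl _ _ hx)
    · intro e e' he he'
      exact (congrArg (· ∈ N) (add_smul (R := Env n) e e' x)).mpr (N.add_mem he he')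

theorem klIdeal_le_toIdeal {N : Submodule R (Hecke n)} (hN : IsKLSpanned N)
    (hl : ∀ a, ∀ x ∈ N, a * x ∈ N) (hr : ∀ a, ∀ x ∈ N, x * a ∈ N) {w : Equiv.Perm (Fin n)}
    (hw : C w ∈ N) {x : Hecke n} (hx : x ∈ klIdeal w) : x ∈ N := by
  have h1 : toIdeal hl hr ∈ klIdeals w :=
    ⟨hw, {z | nC z ∈ N}, congrArg SetLike.coe hN.eq_span⟩
  exact sInf_le h1 hx

/-- Being spanned by basis elements passes to intersections. -/
theorem nC_mem_klIdeal {w y : Equiv.Perm (Fin n)} {x : Hecke n} (hx : x ∈ klIdeal w)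
    (hy : coefC y x ≠ 0) : nC y ∈ klIdeal w := by
  rw [klIdeal, Submodule.mem_sInf] at hx ⊢
  intro I hI
  obtain ⟨X, hX⟩ := hI.2
  have h1 := hx I hI
  rw [← SetLike.mem_coe, hX] at h1 ⊢
  exact isKLSpanned_span X x h1 y hy

theorem klIdeal_le {w y : Equiv.Perm (Fin n)} (h : C y ∈ klIdeal w) : klIdeal y ≤ klIdeal w :=
  le_sInf fun I hI => sInf_le ⟨Submodule.mem_sInf.1 h I hI, hI.2⟩

/-! ### Generation of the cell bimodule -/

/-- The cell bimodule of a cell that contains a parabolic element is generated by the image of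
its Kazhdan–Lusztig element. -/
theorem span_cellImage_eq_top {w v : Equiv.Perm (Fin n)} (hv : v ∈ cell w)
    (hpar : IsParabolic v) : Submodule.span (Env n) {cellImage hv} = ⊤ := by
  have hvw : klIdeal v = klIdeal w := hv
  obtain ⟨A, hA, hvA, hmax⟩ := hpar
  obtain ⟨b, hb, hbA⟩ := exists_monotone_of_subset_simples hA
  have hC : parSum b = C v :=
    parSum_eq_C hb ((hbA v).1 hvA) fun u hu => hmax u ((hbA u).2 hu)
  have hN := isCellIdeal_parFiltration (isKLSpanned_parFiltration n (aval b))
  have hvN : C v ∉ parFiltration n (aval b) := hC ▸ parSum_notMem_parFiltration b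
  have hsup := hN.isKLSpanned_sup_parIdeal hb le_rfl
  have hl : ∀ a, ∀ x ∈ parFiltration n (aval b) ⊔ parIdeal b,
      a * x ∈ parFiltration n (aval b) ⊔ parIdeal b := by
    intro a x hx
    obtain ⟨y, hy, z, hz, rfl⟩ := Submodule.mem_sup.1 hx
    rw [mul_add]
    exact Submodule.add_mem_sup (hN.left a y hy) (mul_mem_parIdeal a hz)
  have hr : ∀ a, ∀ x ∈ parFiltration n (aval b) ⊔ parIdeal b,
      x * a ∈ parFiltration n (aval b) ⊔ parIdeal b := by
    intro a x hx
    obtain ⟨y, hy, z, hz, rfl⟩ := Submodule.mem_sup.1 hx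
    rw [add_mul]
    exact Submodule.add_mem_sup (hN.right a y hy) (mem_parIdeal_mul a hz)
  have hCJ : C v ∈ parIdeal b := hC ▸ parSum_mem_parIdeal b
  have hJ : ∀ x ∈ parIdeal b, x ∈ Submodule.span (Env n) {C v} := by
    intro x hx
    induction hx using Submodule.span_induction with
    | mem x hx =>
      obtain ⟨a, a', rfl⟩ := hx
      rw [hC, ← tens_smul]
      exact Submodule.smul_mem _ _ (Submodule.mem_span_singleton_self _)
    | zero => exact Submodule.zero_mem _
    | add x y _ _ hx hy => exact Submodule.add_mem _ hx hy
    | smul r x _ hx => exact smul_mem_ideal _ r hx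
  have hlt : ∀ x ∈ klIdeal v, x ∈ parFiltration n (aval b) → x ∈ cellLT w := by
    intro x hx hxN
    rw [← sum_coefC x]
    refine Submodule.sum_mem _ fun y _ => ?_
    by_cases h0 : coefC y x = 0
    · rw [h0, zero_smul]
      exact Submodule.zero_mem _
    · have h1 : C y ∈ klIdeal v := by
        rw [C_eq_smul_nC]
        exact smul_mem_ideal _ _ (nC_mem_klIdeal hx h0)
      have h2 : C y ∈ parFiltration n (aval b) := by
        rw [C_eq_smul_nC]
        exact Submodule.smul_mem _ _ (hN.spanned x hxN y h0)
      -- If y were in the cell, then I_v = I_y would lie in the filtration step, which does not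
      -- contain C_v.
      have h3 : y ∉ cell w := fun hy => hvN <|
        klIdeal_le_toIdeal hN.spanned hN.left hN.right h2
          ((hvw.trans (Eq.symm hy)).le (C_mem_klIdeal v))
      have h4 : klIdeal y ≤ cellLT w :=
        le_iSup₂_of_le y ⟨(klIdeal_le h1).trans hvw.le, h3⟩ le_rfl
      rw [nC]
      exact smul_mem_ideal _ _ (smul_mem_ideal _ _ (h4 (C_mem_klIdeal y)))
  rw [eq_top_iff]
  intro x _
  obtain ⟨⟨h, hh⟩, rfl⟩ := Submodule.Quotient.mk_surjective _ x
  have hhv : h ∈ klIdeal v := hvw.ge hh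
  have hCv : C v ∈ parFiltration n (aval b) ⊔ parIdeal b := Submodule.mem_sup_right hCJ
  -- I_v lies in N + J_b. The part `z` in J_b is a bimodule combination of C_v, and the part `y` in
  -- N vanishes in the quotient by `hlt`.
  obtain ⟨y, hy, z, hz, rfl⟩ := Submodule.mem_sup.1 (klIdeal_le_toIdeal hsup hl hr hCv hhv)
  have hzspan := hJ z hz
  have hle : Submodule.span (Env n) {C v} ≤ klIdeal v :=
    (Submodule.span_singleton_le_iff_mem _ _).2 (C_mem_klIdeal v)
  have hzv : z ∈ klIdeal v := hle hzspan
  have hyv : y ∈ klIdeal v := by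
    have := Submodule.sub_mem _ hhv hzv
    rwa [add_sub_cancel_right] at this
  have hylt := hlt y hyv hy
  have hzw : z ∈ cellLE w := hvw.le hzv
  have e : (Submodule.Quotient.mk ⟨y + z, hh⟩ : CellModule w) =
      Submodule.Quotient.mk ⟨z, hzw⟩ := by
    rw [Submodule.Quotient.eq, Submodule.submoduleOf, Submodule.mem_comap]
    simpa using hylt
  rw [e]
  -- The elements of I_w whose classes are generated by the image of C_v form a sub-bimodule of H
  -- containing C_v, hence all of H C_v H.
  have hmap : Submodule.span (Env n) {C v} ≤
      ((Submodule.span (Env n) {cellImage hv}).comap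
        ((cellLT w).submoduleOf (cellLE w)).mkQ).map (cellLE w).subtype := by
    rw [Submodule.span_singleton_le_iff_mem]
    exact ⟨⟨C v, hvw.le (C_mem_klIdeal v)⟩, Submodule.mem_span_singleton_self _, rfl⟩
  obtain ⟨u, hu, rfl⟩ := hmap hzspan
  exact hu

end SymHecke

end

/-- Let `𝒞` be a two-sided cell of the symmetric group (the one of `w`) and `v ∈ 𝒞` a parabolic
element. Then the bimodule `H_𝒞` is generated by the image of `C_v`. -/
theorem proposition4p4 (n : ℕ) (w v : Equiv.Perm (Fin n)) (hv : v ∈ SymHecke.cell w)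
    (hpar : SymHecke.IsParabolic v) :
    Submodule.span (SymHecke.Env n) {SymHecke.cellImage hv} = ⊤ :=
  SymHecke.span_cellImage_eq_top hv hpar
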